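/- **Setting.** Structures have finitely many unary predicates $0,\dots,k^{\mathsf u}-1$ and binary relation symbols $0,\dots,k-1$ ($k\ge 1$), with an involution $\mathrm{Flip}$ of $k$ fixing $0$: each vertex $a$ has exactly one unary predicate $U(a)$, each ordered pair of distinct vertices has exactly one binary symbol $R(a,b)$, and $R(b,a)=\mathrm{Flip}(R(a,b))$. The symbol $0$ means "no relation"; a structure is irreducible if $R(a,b)\neq 0$ for all $a\ne b$. Let $\mathcal F$ be a finite set of finite irreducible structures with at least two vertices each, pairwise non-embeddable, and let $\mathcal K=\mathrm{Forb}(\mathcal F)$ be the class of finite structures into which no member of $\mathcal F$ embeds. Assume every unary predicate $i$ is non-degenerate: some two-vertex structure in $\mathcal K$ with a non-zero relation has a vertex with predicate $i$. An enumerated structure is one whose underlying set is a cardinal $N\le\omega$. Let $\mathbf K$ be a Fraïssé limit of $\mathcal K$ with underlying set $\omega$ that is *left dense*: for each $m$ and each structure $\mathbf M\in\mathcal K$ on $\{0,\dots,m\}$ agreeing with $\mathbf K$ on $\{0,\dots,m-1\}$, there is an increasing embedding $f:\mathbf M\to\mathbf K$ which is the identity below $m$ and has $R(f(m),r)=0$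 for $m\le r<f(m)$. Subsets of $\omega$ are identified with induced substructures of $\mathbf K$. **Tree.** $T=k^{\mathsf u}\times k^{<\omega}$; for $t=(t^{\mathsf u},t^{\mathsf b})\in T$, $\ell(t)$ is the length of $t^{\mathsf b}$, $t(m)=t^{\mathsf b}(m)$, $t|_m$ is the restriction to length $m$, $s\sqsubseteq t$ means initial segment, $s\perp t$ incomparable, $s\wedge t$ is the longest common initial segment (for $s^{\mathsf u}=t^{\mathsf u}$). Level subsets of $T$ are ordered lexicographically. Put $c(n)=(U(n),(R(n,m))_{m<n})$, $\mathrm{CT}=\{t:\exists a,\ t\sqsubseteq c(a)\}$, $\emptyset_i=(i,\emptyset)$. $\mathrm{Start}(t)$ is the least $m$ with $t(m)\ne0$, if it exists; $\mathrm{Start}(a)=\mathrm{Start}(c(a))$. **Ages.** A $d$-labelled structure has labels $V(b)<d$ in place of unary predicates. A gluing $\gamma=(\rho,\eta,\mathbf I)$ of sort $\rho:d\to k^{\mathsf u}$ consists of $\eta:d\times n\to k$ and a structure $\mathbf I\in\mathcal K$ on $n$. For $d$-labelled $\mathbf B$, $\mathbf B[\gamma]$ is the structure on $\mathbf I\sqcup\mathbf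 B$ extending $\mathbf I$ and the binary part of $\mathbf B$ with $U(b)=\rho(V(b))$ and $R(b,x)=\eta(V(b),x)$. Let $\mathcal K(\gamma)$ be the class of finite $\mathbf B$ with $\mathbf B[\gamma]\in\mathcal K$. For a set $S=\{s_0<\dots<s_{d-1}\}$ of nodes of length $m$ let $\mathcal K(S)=\mathcal K(\gamma)$ where $\rho(i)=s_i^{\mathsf u}$ (the sort $S^{\mathsf u}$), $\eta(i,x)=s_i(x)$, $\mathbf I=\mathbf K\restriction m$; $\mathcal K(s)=\mathcal K(\{s\})$. Classes of structures with different numbers of labels are regarded as different. $P(\rho)$ is the set of all $\mathcal K(S)$ with $S\subseteq\mathrm{CT}\cap T(m)$ for some $m$ and $S^{\mathsf u}=\rho$, ordered by inclusion. $P_i=P(\rho)$ for $\rho$ the sort of rank $1$ with value $i$, and $P_i^{\min}$ is its least element. For $e:d_0\to d$, $\mathcal A^e$ is the class of $d_0$-labelled structures that lie in $\mathcal A$ after relabelling along $e$. $(\mathcal A,\mathcal B)\in\mathrm{Con}(\rho)$ if $\mathcal B\subsetneq\mathcal A$ are in $P(\rho)$ with nothing of $P(\rho)$ strictly between; it is essential,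 $(\mathcal A,\mathcal B)\in\mathrm{ECon}(\rho)$, if moreover $\mathcal A^e=\mathcal B^e$ for every increasing $e:d_0\to d$ with $d_0<d$. $\mathrm{Spec}(\mathcal A)$ is the set of gluings $(\rho,\eta,\mathbf I)$ with $\mathbf I\in\mathcal K$ embeddable in a member of $\mathcal F$ and $\mathcal A\subseteq\mathcal K(\rho,\eta,\mathbf I)$. Let $\gamma\langle i,q,j\rangle$ be the gluing of rank $1$, sort $i$, with $\mathbf I$ a single vertex of unary predicate $j$ and attachment value $q$. We call $(q,j)$ a free relation for $i$ if $q\neq0$ and $\mathcal K(\gamma\langle i,q,j\rangle)=\mathcal K(\emptyset_i)$. Write $i\in\mathsf{Free}$ if $i$ has a free relation. A path in $P_i$ is a chain in $P_i$; for $a\in\mathbf K$ with $U(a)=i$, $\mathrm{Path}(a)=\{\mathcal K(c(a)|_m):m\le a\}$, regarded as a path in $P_i$; paths of vertices with different unary predicates count as different. Fix once and for all arbitrary choices: for every essential change $(\mathcal A,\mathcal B)$, an element $\mathrm{Cause}(\mathcal A,\mathcal B)$ of $\mathrm{Spec}(\mathcal B)\setminus\mathrm{Spec}(\mathcal A)$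 with $|\mathbf I|$ minimum; for every $i\in\mathsf{Free}$, a free relation $\mathsf{Free}(i)=(q,j)$, with $\mathsf{Free}(i)^{\mathsf b}=q$ and $\mathsf{Free}(i)^{\mathsf u}=j$; and a linear order $\le_{path}$ of the maximal paths of all the $P_i$ in which those of $P_i$ precede those of $P_j$ when $i<j$. For $(\mathcal A,\mathcal B)\in\mathrm{Con}(\rho)$ take the increasing injection $e$ with $(\mathcal A^e,\mathcal B^e)\in\mathrm{ECon}(\rho\circ e)$; $\mathrm{Cause}(\mathcal A,\mathcal B)$ is the gluing of sort $\rho$ obtained from $\mathrm{Cause}(\mathcal A^e,\mathcal B^e)$ by setting $\eta(e(i),x)$ to be its value at $(i,x)$ and $\eta=0$ off the image of $e$. **Closure, interior, envelope.** For $\mathbf A\subseteq\mathbf K$ let $c[\mathbf A]|_m=\{c(a)|_m:a\in\mathbf A,\ a\ge m\}$; $\mathrm{SpNode}(\mathbf A)=\{c(a)\wedge c(b):a,b\in\mathbf A,\ U(a)=U(b),\ c(a)\perp c(b)\}$; $\mathrm{sp}(\mathbf A)=\{\ell(x):x\in\mathrm{SpNode}(\mathbf A)\}$; $\mathrm{AC}(\mathbf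 A)=\{m\notin\mathbf A\cup\mathrm{sp}(\mathbf A):\mathcal K(c[\mathbf A]|_m)\ne\mathcal K(c[\mathbf A]|_{m+1})\}$; $\mathrm{Crit}(\mathbf A)=\mathbf A\cup\mathrm{sp}(\mathbf A)\cup\mathrm{AC}(\mathbf A)$. $\mathbf A$ is closed if $\mathrm{Crit}(\mathbf A)=\mathbf A$; the closure $\overline{\mathbf A}$ is the smallest closed set containing $\mathbf A$; the interior $\mathrm{Int}(\mathbf A)$ is the smallest subset of $\mathbf A$ with the same closure as $\mathbf A$; the envelope $\widetilde{\mathbf A}$ is the enumerated structure on $|\overline{\mathbf A}|$ for which the increasing bijection $\widetilde{\mathbf A}\to\overline{\mathbf A}$ is an embedding. Let $\mathrm{Start}(\mathbf A)$ be the set of all existing $\mathrm{Start}(a)$, $a\in\mathbf A$; $\mathrm{FreeStart}(\mathbf A)$ the set of those with $U(a)\in\mathsf{Free}$; $\mathrm{Crit}^+(\mathbf A)=\mathrm{Crit}(\mathbf A)\cup\mathrm{Start}(\mathbf A)$. **Diagonal substructures.** $\mathbf A\subseteq\mathbf K$ is *diagonal* if the following five conditions hold. (1) *Weakly diagonal*: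 $c[\mathbf A]$ is an antichain; $\mathrm{sp}(\mathbf A)\cap\mathbf A=\emptyset$; for $m\in\mathrm{sp}(\mathbf A)$ there is exactly one $s\in\mathrm{SpNode}(\mathbf A)$ of length $m$, it has exactly two successors in $c[\mathbf A]|_{m+1}$, and $t^\frown0\in c[\mathbf A]|_{m+1}$ for all $t\in c[\mathbf A]|_m$; $\mathrm{Start}(a)$ exists for every $a\in\mathbf A$; and $\mathrm{FreeStart}(\mathbf A)$ is an initial segment of $\mathrm{Crit}^+(\mathbf A)$. (2) *Controlled paths*: $\mathrm{Path}(a)$ is a maximal path for each $a\in\mathbf A$; if $a,b\in\mathbf A$, $U(a)=U(b)\notin\mathsf{Free}$ and $\mathrm{Start}(a)=\mathrm{Start}(b)$, then $\mathrm{Path}(a)=\mathrm{Path}(b)$; if $a,b\in\mathbf A$ and $U(a)=U(b)\in\mathsf{Free}$, then $\mathrm{Start}(a)\le\mathrm{Start}(b)$ iff $\mathrm{Path}(a)\le_{path}\mathrm{Path}(b)$; if $a\in\mathbf A$, $i=U(a)\in\mathsf{Free}$ and $m=\mathrm{Start}(a)$, then $c(m)=(\mathsf{Free}(i)^{\mathsf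 u},0^m)$, $c(a)(m)=\mathsf{Free}(i)^{\mathsf b}$, and $c(b)(m)=0$ for all $b\in\mathbf A$ with $b>m$ and $\mathrm{Path}(b)\ne\mathrm{Path}(a)$; and if $a,b\in\mathbf A$, $U(a)<U(b)$ and $U(a),U(b)\in\mathsf{Free}$, then $\mathrm{Start}(a)<\mathrm{Start}(b)$. (3) *Controlled age changes*: for each $m\in\mathrm{AC}(\mathbf A)$, with $\rho=(c[\mathbf A]|_m)^{\mathsf u}$ and $c[\mathbf A]|_{m+1}=\{t_0<\dots<t_{d-1}\}$: the pair $(\mathcal K(c[\mathbf A]|_m),\mathcal K(c[\mathbf A]|_{m+1}))$ is in $\mathrm{Con}(\rho)$, and if $(\rho,\eta,\mathbf I)$ is its cause, there is an increasing embedding $\phi:\mathbf I\to\mathbf K$ with left-leaning image (if $a\in\phi[\mathbf I]$, $x<a$ and $R(a,x)\ne0$ then $x\in\phi[\mathbf I]$) and $\max\phi[\mathbf I]=m$ such that, with $i=\min\phi[\mathbf I]$, $t_j(\phi(x))=\eta(j,x)$ for all $j,x$, $t_j(y)=0$ for $y\in[i,m]\setminus\phi[\mathbf I]$, and $\mathrm{Crit}^+(\mathbf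 A)\cap[i,m]=\{m\}$. (4) *Controlled coding levels*: for each $m\in\mathbf A$, with $c[\mathbf A]|_m=\{s_0<\dots<s_{d-1}\}$, $\rho$ its sort, $c[\mathbf A]|_{m+1}=\{t_0<\dots<t_{d-2}\}$, $c(m)=s_j$, $\phi(\alpha)=t_\alpha(m)$, $\mathcal A=\mathcal K(c[\mathbf A]|_m)$ and $\epsilon:d-1\to d$ the increasing map omitting $j$: for a class $\mathcal C$ let $\mathcal C'$ be the class of $(d-1)$-labelled $\mathbf B$ such that relabelling $\mathbf B$ along $\epsilon$ and adding a new vertex $x$ with label $j$ and $R(b,x)=\phi(V(b))$ gives a member of $\mathcal C$. Then $\mathcal A^{j}=P^{\min}_{\rho(j)}$ (where $\mathcal A^{j}$ is $\mathcal A^{e}$ for $e:1\to d$ with value $j$), $\mathcal A'=\mathcal A^{\epsilon}$, and every $\mathcal B\in P(\rho)$ with $\mathcal B\subsetneq\mathcal A$ has $\mathcal B^\epsilon\subsetneq\mathcal A^\epsilon$ or $\mathcal B'\subsetneq\mathcal A^\epsilon$. (5) *Controlled splitting levels*: for each $m\in\mathrm{sp}(\mathbf A)$, with splitting node $s$ of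 length $m$, $i=s^{\mathsf u}$, and lexicographically smaller and larger successors $t<t'$ of $s$ in $c[\mathbf A]|_{m+1}$: if $i\in\mathsf{Free}$, then $c(m)=(\mathsf{Free}(i)^{\mathsf u},0^m)$ and $t'=s^\frown\mathsf{Free}(i)^{\mathsf b}$; if $i\notin\mathsf{Free}$ and $s\ne(i,0^m)$, then with $r=\mathrm{Start}(s)$, $c(m)=(U(r),0^m)$ and $t'=s^\frown s(r)$; if $i\notin\mathsf{Free}$ and $s=(i,0^m)$, then $(\mathcal K(c[\mathbf A]|_m),\mathcal K(c[\mathbf A]|_{m+1}\setminus\{t\}))\in\mathrm{Con}((c[\mathbf A]|_m)^{\mathsf u})$ and, for some $q\neq 0$ and $j$, $t'=s^\frown q$, $\mathrm{Cause}(\mathcal K(s),\mathcal K(s^\frown q))=\gamma\langle i,q,j\rangle$ and $c(m)=(j,0^m)$. **Diaries.** The diary $\Delta^{\mathbf A}$ of a diagonal $\mathbf A$ is the function with domain $|\mathrm{Crit}(\mathbf A)|\le\omega$ whose value at $n$, for $m$ the $n$-th element of $\mathrm{Crit}(\mathbf A)$, consists of: the label $\mathrm{Cd}$, $\mathrm{sp}$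 or $\mathrm{AC}$ according to whether $m$ is in $\mathbf A$, $\mathrm{sp}(\mathbf A)$ or $\mathrm{AC}(\mathbf A)$; the sort $(c[\mathbf A]|_m)^{\mathsf u}$ and the class $\mathcal K(c[\mathbf A]|_m)$; the position in $c[\mathbf A]|_m$, in lexicographic order, of $c(m)$ (label $\mathrm{Cd}$) or of the splitting node (label $\mathrm{sp}$), and $0$ for label $\mathrm{AC}$; and the passing numbers $(t_0(m),\dots,t_{d-2}(m))$ where $c[\mathbf A]|_{m+1}=\{t_0<\dots<t_{d-2}\}$ for label $\mathrm{Cd}$, and $0$ for the other labels. **Proposition.** If $\mathbf A,\mathbf B\subseteq\mathbf K$ are diagonal and $\Delta^{\mathbf A}=\Delta^{\mathbf B}$, then $\widetilde{\mathbf A}=\widetilde{\mathbf B}$. Furthermore, every diagonal $\mathbf A\subseteq\mathbf K$ satisfies $\mathbf A=\mathrm{Int}(\overline{\mathbf A})$. -/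

import Mathlib

noncomputable section

open Classical

namespace DiaryEnvelope

/-- A finite binary relational language: `ku` unary symbols, `k` binary symbols, of which the
symbol `0` means "no relation", and the involution `flip` relating `R a b` to `R b a`. -/
structure Lang where
  ku : ℕ
  k : ℕ
  k_ne : NeZero k
  flip : Fin k → Fin k
  flip_flip : ∀ q, flip (flip q) = q
  flip_zero : flip 0 = 0

attribute [instance] Lang.k_ne

variable {L : Lang}

/-! ### Structures -/

/-- An `L`-structure on `V`: each vertex satisfies exactly one unary symbol, each pair of distinct
vertices satisfies exactly one binary symbol. The value of `R` on the diagonal is `0` by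
convention. -/
@[ext]
structure Str (L : Lang) (V : Type) where
  U : V → Fin L.ku
  R : V → V → Fin L.k
  R_self : ∀ a, R a a = 0
  R_flip : ∀ a b, R b a = L.flip (R a b)

/-- The structure on `W` induced along `f : W → V`. -/
def Str.pullback {V W : Type} (M : Str L V) (f : W → V) : Str L W where
  U a := M.U (f a)
  R a b := M.R (f a) (f b)
  R_self a := M.R_self (f a)
  R_flip a b := M.R_flip (f a) (f b)

def IsEmb {V W : Type} (f : V → W) (M : Str L V) (N : Str L W) : Prop :=
  Function.Injective f ∧ (∀ a, N.U (f a) = M.U a) ∧ ∀ a b, N.R (f a) (f b) = M.R a b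

def Embeds {V W : Type} (M : Str L V) (N : Str L W) : Prop := ∃ f : V → W, IsEmb f M N

/-- Finite enumerated structures. Every finite structure is isomorphic to one of these. -/
abbrev FinStr (L : Lang) : Type := Σ n : ℕ, Str L (Fin n)

def Irreducible {V : Type} (M : Str L V) : Prop := ∀ a b, a ≠ b → M.R a b ≠ 0

/-- The standing assumptions on the set of forbidden structures. -/
structure Admissible (F : Set (FinStr L)) : Prop where
  finite : F.Finite
  irreducible : ∀ M ∈ F, Irreducible M.2
  two_le : ∀ M ∈ F, 2 ≤ M.1
  incomparable : ∀ M ∈ F, ∀ N ∈ F, M ≠ N → ¬ Embeds M.2 N.2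

/-- No member of `F` embeds into `M`. For finite `M` this says that `M` is in `Forb(F)`. -/
def Forb (F : Set (FinStr L)) {V : Type} (M : Str L V) : Prop := ∀ N ∈ F, ¬ Embeds N.2 M

/-- `i` is non-degenerate: in some two-element structure in `Forb(F)` with a nonzero relation,
at least one of the vertices has unary predicate `i`. -/
def NonDegenerate (F : Set (FinStr L)) (i : Fin L.ku) : Prop :=
  ∃ M : Str L (Fin 2), Forb F M ∧ (∃ v, M.U v = i) ∧ M.R 0 1 ≠ 0

/-- `K` is an enumerated Fraisse limit of `Forb(F)`: its age is `Forb(F)` and it is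
ultrahomogeneous. -/
structure IsFraisseLimit (F : Set (FinStr L)) (K : Str L ℕ) : Prop where
  age : ∀ M : FinStr L, Forb F M.2 ↔ Embeds M.2 K
  ultrahomogeneous : ∀ (M : FinStr L) (f g : Fin M.1 → ℕ), IsEmb f M.2 K → IsEmb g M.2 K →
    ∃ h : ℕ ≃ ℕ, IsEmb h K K ∧ ∀ a, h (f a) = g a

/-- The induced substructure on the first `m` vertices. -/
def initial (K : Str L ℕ) (m : ℕ) : Str L (Fin m) := K.pullback (fun i : Fin m => (i : ℕ))

def LeftDense (F : Set (FinStr L)) (K : Str L ℕ) : Prop :=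
  ∀ (m : ℕ) (M : Str L (Fin (m + 1))), Forb F M → M.pullback Fin.castSucc = initial K m →
    ∃ f : Fin (m + 1) → ℕ, StrictMono f ∧ IsEmb f M K ∧ (∀ i : Fin m, f i.castSucc = i) ∧
      ∀ r, m ≤ r → r < f (Fin.last m) → K.R (f (Fin.last m)) r = 0

/-! ### The tree of types -/

/-- The tree `T = ku × k^{<ω}`, with the lexicographic order (used on level subsets). -/
abbrev Node (L : Lang) : Type := Fin L.ku ×ₗ List (Fin L.k)

def mkNode (i : Fin L.ku) (b : List (Fin L.k)) : Node L := toLex (i, b)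

namespace Node

def un (t : Node L) : Fin L.ku := (ofLex t).1

def bin (t : Node L) : List (Fin L.k) := (ofLex t).2

def len (t : Node L) : ℕ := t.bin.length

/-- The value `t(m)`, for `m < len t`. -/
def val (t : Node L) (m : ℕ) : Fin L.k := t.bin.getD m 0

/-- The restriction `t|_m`. -/
def restr (t : Node L) (m : ℕ) : Node L := mkNode t.un (t.bin.take m)

/-- The immediate successor of `t` in direction `q`. -/
def succ (t : Node L) (q : Fin L.k) : Node L := mkNode t.un (t.bin ++ [q])

/-- `s` is an initial segment of `t`. -/
def Below (s t : Node L) : Prop := s.un = t.un ∧ s.bin <+: t.bin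

def Perp (s t : Node L) : Prop := ¬ Below s t ∧ ¬ Below t s

/-- `x` is the longest common initial segment of `s` and `t`. -/
def IsMeet (x s t : Node L) : Prop :=
  Below x s ∧ Below x t ∧ ∀ y, Below y s → Below y t → Below y x

/-- The node `(i, 0^m)` on the left branch. -/
def left (i : Fin L.ku) (m : ℕ) : Node L := mkNode i (List.replicate m 0)

/-- `m` is the least integer with `t(m) ≠ 0`. -/
def IsStart (t : Node L) (m : ℕ) : Prop := m < t.len ∧ t.val m ≠ 0 ∧ ∀ r < m, t.val r = 0

end Node

/-- The coding function: `code K n` is the type of the vertex `n` over the first `n` vertices. -/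
def code (K : Str L ℕ) (n : ℕ) : Node L :=
  mkNode (K.U n) (List.ofFn fun m : Fin n => K.R n m)

/-- Level `n` of the coding tree. -/
def CT (K : Str L ℕ) (n : ℕ) : Set (Node L) := {t | t.len = n ∧ ∃ a, t.Below (code K a)}

/-! ### Labelled structures, gluings and ages -/

/-- A structure whose vertices carry one of `d` labels in place of unary predicates. -/
@[ext]
structure LabStr (L : Lang) (d : ℕ) (V : Type) where
  lab : V → Fin d
  R : V → V → Fin L.k
  R_self : ∀ a, R a a = 0
  R_flip : ∀ a b, R b a = L.flip (R a b)

/-- The finite structures with `d` labels, represented on the sets `Fin n`. -/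
abbrev FinLab (L : Lang) (d : ℕ) : Type := Σ n : ℕ, LabStr L d (Fin n)

/-- Classes of finite structures with `d` labels. -/
abbrev AgeClass (L : Lang) (d : ℕ) : Type := Set (FinLab L d)

/-- `e · B`: change labels along `e`. -/
def LabStr.relabel {d d' : ℕ} {V : Type} (e : Fin d → Fin d') (B : LabStr L d V) :
    LabStr L d' V where
  lab b := e (B.lab b)
  R := B.R
  R_self := B.R_self
  R_flip := B.R_flip

/-- The class `A^e` of all `B` with `e · B` in `A`. -/
def AgeClass.pull {d d' : ℕ} (A : AgeClass L d') (e : Fin d → Fin d') : AgeClass L d :=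
  {B | (⟨B.1, B.2.relabel e⟩ : FinLab L d') ∈ A}

/-- A gluing `(ρ, η, I)` of rank `d`. Membership of `I` in `Forb(F)` is imposed where gluings are
quantified over. -/
structure Gluing (L : Lang) (d : ℕ) where
  sort : Fin d → Fin L.ku
  size : ℕ
  att : Fin d → Fin size → Fin L.k
  str : Str L (Fin size)

/-- The structure `B[γ]`. -/
def glue {d : ℕ} {V : Type} (B : LabStr L d V) (γ : Gluing L d) : Str L (Fin γ.size ⊕ V) where
  U
    | .inl x => γ.str.U x
    | .inr b => γ.sort (B.lab b)
  R
    | .inl x, .inl y => γ.str.R x y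
    | .inl x, .inr b => L.flip (γ.att (B.lab b) x)
    | .inr b, .inl x => γ.att (B.lab b) x
    | .inr b, .inr b' => B.R b b'
  R_self
    | .inl x => γ.str.R_self x
    | .inr b => B.R_self b
  R_flip
    | .inl x, .inl y => γ.str.R_flip x y
    | .inl _, .inr _ => (L.flip_flip _).symm
    | .inr _, .inl _ => rfl
    | .inr b, .inr b' => B.R_flip b b'

/-- The age of a gluing. -/
def gluingAge (F : Set (FinStr L)) {d : ℕ} (γ : Gluing L d) : AgeClass L d :=
  {B | Forb F (glue B.2 γ)}

/-- The gluing of a function `σ` into level `m` of `T`. -/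
def treeGluing (K : Str L ℕ) (m : ℕ) {d : ℕ} (σ : Fin d → Node L) : Gluing L d where
  sort i := (σ i).un
  size := m
  att i x := (σ i).val x
  str := initial K m

/-- The age of a function `σ` into level `m` of `T`. -/
def age (F : Set (FinStr L)) (K : Str L ℕ) (m : ℕ) {d : ℕ} (σ : Fin d → Node L) : AgeClass L d :=
  gluingAge F (treeGluing K m σ)

/-- The age of a single node. -/
def nodeAge (F : Set (FinStr L)) (K : Str L ℕ) (t : Node L) : AgeClass L 1 :=
  age F K t.len (fun _ : Fin 1 => t)

/-- The poset `P(ρ)` of ages of sort `ρ`. -/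
def P (F : Set (FinStr L)) (K : Str L ℕ) {d : ℕ} (ρ : Fin d → Fin L.ku) : Set (AgeClass L d) :=
  {A | ∃ (n : ℕ) (σ : Fin d → Node L), StrictMono σ ∧ (∀ i, σ i ∈ CT K n) ∧
    (∀ i, (σ i).un = ρ i) ∧ A = age F K n σ}

/-- The sort of rank one with value `i`. -/
def sort1 (i : Fin L.ku) : Fin 1 → Fin L.ku := fun _ => i

/-- The least element of `P_i`. -/
def Pmin (F : Set (FinStr L)) (K : Str L ℕ) (i : Fin L.ku) : AgeClass L 1 :=
  ⋂₀ P F K (sort1 i)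

/-- Consecutive age changes. -/
def Con (F : Set (FinStr L)) (K : Str L ℕ) {d : ℕ} (ρ : Fin d → Fin L.ku)
    (A B : AgeClass L d) : Prop :=
  A ∈ P F K ρ ∧ B ∈ P F K ρ ∧ B ⊂ A ∧ ¬ ∃ C ∈ P F K ρ, B ⊂ C ∧ C ⊂ A

/-- Essential consecutive age changes. -/
def ECon (F : Set (FinStr L)) (K : Str L ℕ) {d : ℕ} (ρ : Fin d → Fin L.ku)
    (A B : AgeClass L d) : Prop :=
  Con F K ρ A B ∧ ∀ (d₀ : ℕ) (e : Fin d₀ → Fin d), StrictMono e → d₀ < d → A.pull e = B.pull e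

/-- The spectrum of a class `A` of sort `ρ`: gluings of sort `ρ`, whose structure is in `Forb(F)`
and embeds into a member of `F`, and whose age contains `A`. -/
def Spec (F : Set (FinStr L)) {d : ℕ} (ρ : Fin d → Fin L.ku) (A : AgeClass L d) :
    Set (Gluing L d) :=
  {γ | γ.sort = ρ ∧ Forb F γ.str ∧ (∃ M ∈ F, Embeds γ.str M.2) ∧ A ⊆ gluingAge F γ}

/-- The gluing `(ρ, e) · ζ`: extend the attachment map by zero off the image of `e`. -/
def Gluing.extend {d₀ d : ℕ} (ρ : Fin d → Fin L.ku) (e : Fin d₀ → Fin d) (ζ : Gluing L d₀) :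
    Gluing L d where
  sort := ρ
  size := ζ.size
  att i x := Function.extend e (fun i₀ => ζ.att i₀ x) (fun _ => 0) i
  str := ζ.str

/-- The rank one gluing attaching everything by `q` to a single vertex with unary predicate `j`. -/
def pointGluing (i : Fin L.ku) (q : Fin L.k) (j : Fin L.ku) : Gluing L 1 where
  sort := sort1 i
  size := 1
  att _ _ := q
  str :=
    { U := fun _ => j
      R := fun _ _ => 0
      R_self := fun _ => rfl
      R_flip := fun _ _ => L.flip_zero.symm }

/-- `(q, j)` is a free relation for `i`. -/
def IsFreeRel (F : Set (FinStr L)) (K : Str L ℕ) (i : Fin L.ku) (q : Fin L.k) (j : Fin L.ku) :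
    Prop :=
  q ≠ 0 ∧ gluingAge F (pointGluing i q j) = nodeAge F K (Node.left i 0)

/-- `i` has a free relation. -/
def HasFree (F : Set (FinStr L)) (K : Str L ℕ) (i : Fin L.ku) : Prop :=
  ∃ q j, IsFreeRel F K i q j

/-! ### Paths -/

/-- A path in `P_i`: a linearly ordered subset. -/
def IsPath (F : Set (FinStr L)) (K : Str L ℕ) (i : Fin L.ku) (p : Set (AgeClass L 1)) : Prop :=
  p ⊆ P F K (sort1 i) ∧ IsChain (· ⊆ ·) p

/-- `x.2` is a maximal path in `P_i`, where `i = x.1`. -/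
def IsMaxPath (F : Set (FinStr L)) (K : Str L ℕ) (x : Fin L.ku × Set (AgeClass L 1)) : Prop :=
  Maximal (IsPath F K x.1) x.2

/-- The path of the vertex `a`, tagged with its unary predicate. -/
def path (F : Set (FinStr L)) (K : Str L ℕ) (a : ℕ) : Fin L.ku × Set (AgeClass L 1) :=
  (K.U a, {C | ∃ m ≤ a, C = nodeAge F K ((code K a).restr m)})

/-- The three arbitrary choices that are fixed once and for all: a cause of each essential
consecutive age change (of minimum size), a free relation for each `i` that has one, and a linear
order of the maximal paths which respects the unary predicates. -/
structure Choices (F : Set (FinStr L)) (K : Str L ℕ) where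
  cause : ∀ {d : ℕ}, (Fin d → Fin L.ku) → AgeClass L d → AgeClass L d → Gluing L d
  cause_mem : ∀ {d : ℕ} (ρ : Fin d → Fin L.ku) (A B : AgeClass L d), ECon F K ρ A B →
    cause ρ A B ∈ Spec F ρ B \ Spec F ρ A
  cause_min : ∀ {d : ℕ} (ρ : Fin d → Fin L.ku) (A B : AgeClass L d), ECon F K ρ A B →
    ∀ γ ∈ Spec F ρ B \ Spec F ρ A, (cause ρ A B).size ≤ γ.size
  free : Fin L.ku → Fin L.k × Fin L.ku
  free_spec : ∀ i, HasFree F K i → IsFreeRel F K i (free i).1 (free i).2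
  pathLE : Fin L.ku × Set (AgeClass L 1) → Fin L.ku × Set (AgeClass L 1) → Prop
  pathLE_total : ∀ x y, IsMaxPath F K x → IsMaxPath F K y → pathLE x y ∨ pathLE y x
  pathLE_antisymm : ∀ x y, IsMaxPath F K x → IsMaxPath F K y → pathLE x y → pathLE y x → x = y
  pathLE_trans : ∀ x y z, IsMaxPath F K x → IsMaxPath F K y → IsMaxPath F K z →
    pathLE x y → pathLE y z → pathLE x z
  pathLE_of_lt : ∀ x y, IsMaxPath F K x → IsMaxPath F K y → x.1 < y.1 → pathLE x y

/-- `γ` is the cause of the (not necessarily essential) consecutive age change `(A, B)`. -/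
def IsCause {F : Set (FinStr L)} {K : Str L ℕ} (ch : Choices F K) {d : ℕ}
    (ρ : Fin d → Fin L.ku) (A B : AgeClass L d) (γ : Gluing L d) : Prop :=
  ∃ (d₀ : ℕ) (e : Fin d₀ → Fin d), StrictMono e ∧ ECon F K (ρ ∘ e) (A.pull e) (B.pull e) ∧
    γ = Gluing.extend ρ e (ch.cause (ρ ∘ e) (A.pull e) (B.pull e))

/-! ### Critical levels, closures, interiors, envelopes -/

theorem level_finite (K : Str L ℕ) (A : Set ℕ) (m : ℕ) :
    {t : Node L | ∃ a ∈ A, m ≤ a ∧ t = (code K a).restr m}.Finite := by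
  have h1 : {l : List (Fin L.k) | l.length = m}.Finite := List.finite_length_eq _ _
  have h2 : ((Set.univ : Set (Fin L.ku)) ×ˢ {l : List (Fin L.k) | l.length = m}).Finite :=
    Set.finite_univ.prod h1
  refine (h2.image toLex).subset ?_
  rintro t ⟨a, -, hm, rfl⟩
  refine ⟨((code K a).un, (code K a).bin.take m), ⟨Set.mem_univ _, ?_⟩, rfl⟩
  simp [code, mkNode, Node.bin, hm]

/-- The level set `c[A]|_m = {c(a)|_m : a ∈ A, a ≥ m}`. -/
def level (K : Str L ℕ) (A : Set ℕ) (m : ℕ) : Finset (Node L) := (level_finite K A m).toFinset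

/-- The lexicographically increasing enumeration of a level set. -/
def vec (S : Finset (Node L)) : Fin S.card → Node L := S.orderEmbOfFin rfl

/-- `S = {s 0 < s 1 < ... < s (d-1)}`. -/
def Lists {d : ℕ} (s : Fin d → Node L) (S : Finset (Node L)) : Prop :=
  StrictMono s ∧ Set.range s = (S : Set (Node L))

/-- The age of `c[A]|_m`, together with the size of `c[A]|_m`. -/
def levelAge (F : Set (FinStr L)) (K : Str L ℕ) (A : Set ℕ) (m : ℕ) : Σ d : ℕ, AgeClass L d :=
  ⟨(level K A m).card, age F K m (vec (level K A m))⟩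

/-- Splitting nodes. -/
def SpNode (K : Str L ℕ) (A : Set ℕ) : Set (Node L) :=
  {x | ∃ a ∈ A, ∃ b ∈ A, K.U a = K.U b ∧ (code K a).Perp (code K b) ∧
    x.IsMeet (code K a) (code K b)}

/-- Splitting levels. -/
def Sp (K : Str L ℕ) (A : Set ℕ) : Set ℕ := Node.len '' SpNode K A

/-- Age-change levels. -/
def AC (F : Set (FinStr L)) (K : Str L ℕ) (A : Set ℕ) : Set ℕ :=
  {m | m ∉ A ∪ Sp K A ∧ levelAge F K A m ≠ levelAge F K A (m + 1)}

/-- Critical levels. -/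
def Crit (F : Set (FinStr L)) (K : Str L ℕ) (A : Set ℕ) : Set ℕ := A ∪ Sp K A ∪ AC F K A

def Closed (F : Set (FinStr L)) (K : Str L ℕ) (A : Set ℕ) : Prop := Crit F K A = A

/-- The closure: the smallest closed set containing `A`. -/
def cl (F : Set (FinStr L)) (K : Str L ℕ) (A : Set ℕ) : Set ℕ :=
  ⋂₀ {C | A ⊆ C ∧ Closed F K C}

/-- `S` is the interior of `A`: the smallest subset of `A` with the same closure as `A`. -/
def IsInteriorOf (F : Set (FinStr L)) (K : Str L ℕ) (A S : Set ℕ) : Prop :=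
  IsLeast {S' | S' ⊆ A ∧ cl F K S' = cl F K A} S

/-- The set `N = {0, ..., N-1}` for `N ≤ ω`. -/
abbrev Below (N : ℕ∞) : Type := {n : ℕ // (n : ℕ∞) < N}

/-- Countable enumerated structures: structures whose underlying set is a cardinal `N ≤ ω`. -/
abbrev EnumStr (L : Lang) : Type := Σ N : ℕ∞, Str L (Below N)

/-- The increasing enumeration of a set of natural numbers. -/
def enum (A : Set ℕ) (n : Below A.encard) : ℕ := Nat.nth (· ∈ A) n.1

/-- The envelope of `A`: the enumerated structure on `|cl A|` for which the increasing bijection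
onto `cl A` is an embedding. -/
def envelope (F : Set (FinStr L)) (K : Str L ℕ) (A : Set ℕ) : EnumStr L :=
  ⟨(cl F K A).encard, K.pullback (enum (cl F K A))⟩

/-! ### Diagonal substructures -/

/-- `m` is the start level of the vertex `a`. -/
def IsStart (K : Str L ℕ) (a m : ℕ) : Prop := (code K a).IsStart m

def Start (K : Str L ℕ) (A : Set ℕ) : Set ℕ := {m | ∃ a ∈ A, IsStart K a m}

/-- The start levels of vertices whose unary predicate has a free relation. -/
def FreeStart (F : Set (FinStr L)) (K : Str L ℕ) (A : Set ℕ) : Set ℕ :=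
  {m | ∃ a ∈ A, HasFree F K (K.U a) ∧ IsStart K a m}

def CritPlus (F : Set (FinStr L)) (K : Str L ℕ) (A : Set ℕ) : Set ℕ := Crit F K A ∪ Start K A

structure WeaklyDiagonal (F : Set (FinStr L)) (K : Str L ℕ) (A : Set ℕ) : Prop where
  antichain : ∀ a ∈ A, ∀ b ∈ A, a ≠ b → ¬ (code K a).Below (code K b)
  disjoint : Sp K A ∩ A = ∅
  unique_split : ∀ m ∈ Sp K A, ∃! s, s ∈ SpNode K A ∧ s.len = m
  two_succ : ∀ s ∈ SpNode K A, {t | t ∈ level K A (s.len + 1) ∧ s.Below t}.ncard = 2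
  succ_zero : ∀ m ∈ Sp K A, ∀ t ∈ level K A m, t.succ 0 ∈ level K A (m + 1)
  exists_start : ∀ a ∈ A, ∃ m, IsStart K a m
  freeStart_subset : FreeStart F K A ⊆ CritPlus F K A
  freeStart_initial : ∀ x ∈ CritPlus F K A, ∀ y ∈ FreeStart F K A, x < y → x ∈ FreeStart F K A

/-- Controlled paths. In `free_start`, the start vertex of a path `p` in `P_i`, where `i` has a free
relation, is a vertex coded on the left branch, related by the chosen free relation to the vertices
of `A` with path `p` and unrelated to every other vertex of `A` above it. -/
structure ControlledPaths {F : Set (FinStr L)} {K : Str L ℕ} (ch : Choices F K) (A : Set ℕ) :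
    Prop where
  maximal : ∀ a ∈ A, IsMaxPath F K (path F K a)
  nonfree : ∀ a ∈ A, ∀ b ∈ A, K.U a = K.U b → ¬ HasFree F K (K.U a) →
    ∀ m, IsStart K a m → IsStart K b m → path F K a = path F K b
  free_order : ∀ a ∈ A, ∀ b ∈ A, K.U a = K.U b → HasFree F K (K.U a) →
    ∀ m n, IsStart K a m → IsStart K b n → (m ≤ n ↔ ch.pathLE (path F K a) (path F K b))
  free_start : ∀ a ∈ A, HasFree F K (K.U a) → ∀ m, IsStart K a m →
    code K m = Node.left (ch.free (K.U a)).2 m ∧ (code K a).val m = (ch.free (K.U a)).1 ∧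
      ∀ b ∈ A, m < b → path F K b ≠ path F K a → (code K b).val m = 0
  free_sep : ∀ a ∈ A, ∀ b ∈ A, HasFree F K (K.U a) → HasFree F K (K.U b) → K.U a < K.U b →
    ∀ m n, IsStart K a m → IsStart K b n → m < n

/-- Whenever `a ∈ S`, `x < a` and `R(a, x) ≠ 0`, then `x ∈ S`. -/
def LeftLeaning (K : Str L ℕ) (S : Set ℕ) : Prop := ∀ a ∈ S, ∀ x < a, K.R a x ≠ 0 → x ∈ S

/-- `m` is a controlled age-change level of `A`. -/
def ControlledACLevel {F : Set (FinStr L)} {K : Str L ℕ} (ch : Choices F K) (A : Set ℕ) (m : ℕ) :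
    Prop :=
  ∃ (d : ℕ) (s t : Fin d → Node L), Lists s (level K A m) ∧ Lists t (level K A (m + 1)) ∧
    Con F K (fun i => (s i).un) (age F K m s) (age F K (m + 1) t) ∧
    ∃ γ : Gluing L d, IsCause ch (fun i => (s i).un) (age F K m s) (age F K (m + 1) t) γ ∧
    ∃ φ : Fin γ.size → ℕ, StrictMono φ ∧ IsEmb φ γ.str K ∧ LeftLeaning K (Set.range φ) ∧
      IsGreatest (Set.range φ) m ∧
      ∃ i, IsLeast (Set.range φ) i ∧
        (∀ j x, (t j).val (φ x) = γ.att j x) ∧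
        (∀ j, ∀ y ∈ Set.Icc i m, y ∉ Set.range φ → (t j).val y = 0) ∧
        CritPlus F K A ∩ Set.Icc i m = {m}

/-- The structure `B⟨j, π, φ⟩`: add a new (last) vertex `x` labelled `j`, with `R(b, x)` given by
`φ`, and change the labels of the old vertices along `π`. -/
def LabStr.addPoint {l d n : ℕ} (B : LabStr L l (Fin n)) (j : Fin d) (π : Fin l → Fin d)
    (φ : Fin l → Fin L.k) : LabStr L d (Fin (n + 1)) where
  lab := Fin.lastCases j fun b => π (B.lab b)
  R := Fin.lastCases (Fin.lastCases 0 fun b => L.flip (φ (B.lab b)))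
    fun b => Fin.lastCases (φ (B.lab b)) fun b' => B.R b b'
  R_self a := by
    induction a using Fin.lastCases with
    | last => simp
    | cast b => simp [B.R_self]
  R_flip a c := by
    induction a using Fin.lastCases with
    | last =>
      induction c using Fin.lastCases with
      | last => simp [L.flip_zero]
      | cast b => simp [L.flip_flip]
    | cast a =>
      induction c using Fin.lastCases with
      | last => simp
      | cast b => simpa using B.R_flip a b

/-- The class of all `B` with `B⟨j, π, φ⟩` in `A`. -/
def AgeClass.next {l d : ℕ} (A : AgeClass L d) (j : Fin d) (π : Fin l → Fin d)
    (φ : Fin l → Fin L.k) : AgeClass L l :=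
  {B | (⟨B.1 + 1, B.2.addPoint j π φ⟩ : FinLab L d) ∈ A}

/-- Controlled coding triples `(A, j, φ)`; `j.succAbove` is the increasing map skipping `j`. -/
structure ControlledCodingTriple (F : Set (FinStr L)) (K : Str L ℕ) {e : ℕ}
    (ρ : Fin (e + 1) → Fin L.ku) (A : AgeClass L (e + 1)) (j : Fin (e + 1))
    (φ : Fin e → Fin L.k) : Prop where
  mem : A ∈ P F K ρ
  min : A.pull (fun _ : Fin 1 => j) = Pmin F K (ρ j)
  next_eq : A.next j j.succAbove φ = A.pull j.succAbove
  minimal : ∀ B ∈ P F K ρ, B ⊂ A →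
    B.pull j.succAbove ⊂ A.pull j.succAbove ∨ B.next j j.succAbove φ ⊂ A.pull j.succAbove

/-- `m` is a controlled coding level of `A`. -/
def ControlledCodingLevel (F : Set (FinStr L)) (K : Str L ℕ) (A : Set ℕ) (m : ℕ) : Prop :=
  ∃ (e : ℕ) (s : Fin (e + 1) → Node L) (t : Fin e → Node L), Lists s (level K A m) ∧
    Lists t (level K A (m + 1)) ∧ ∃ j, s j = code K m ∧
      ControlledCodingTriple F K (fun i => (s i).un) (age F K m s) j (fun α => (t α).val m)

/-- `m` is a controlled splitting level of `A`. Here `s α` is the splitting node, and `t α.castSucc`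
and `t α.succ` are its two successors. -/
def ControlledSpLevel {F : Set (FinStr L)} {K : Str L ℕ} (ch : Choices F K) (A : Set ℕ) (m : ℕ) :
    Prop :=
  ∃ (d : ℕ) (s : Fin d → Node L) (t : Fin (d + 1) → Node L), Lists s (level K A m) ∧
    Lists t (level K A (m + 1)) ∧ ∃ α : Fin d, s α ∈ SpNode K A ∧
      (HasFree F K (s α).un →
        code K m = Node.left (ch.free (s α).un).2 m ∧
          t α.succ = (s α).succ (ch.free (s α).un).1) ∧
      (¬ HasFree F K (s α).un → s α ≠ Node.left (s α).un m →
        ∃ r, (s α).IsStart r ∧ code K m = Node.left (K.U r) m ∧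
          t α.succ = (s α).succ ((s α).val r)) ∧
      (¬ HasFree F K (s α).un → s α = Node.left (s α).un m →
        Con F K (fun i => (s i).un) (age F K m s)
          (age F K (m + 1) (t ∘ α.castSucc.succAbove)) ∧
        ∃ q j, q ≠ 0 ∧ t α.succ = (s α).succ q ∧
          ch.cause (sort1 (s α).un) (nodeAge F K (s α)) (nodeAge F K ((s α).succ q)) =
            pointGluing (s α).un q j ∧
          code K m = Node.left j m)

structure Diagonal {F : Set (FinStr L)} {K : Str L ℕ} (ch : Choices F K) (A : Set ℕ) : Prop where
  weak : WeaklyDiagonal F K A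
  paths : ControlledPaths ch A
  ageChange : ∀ m ∈ AC F K A, ControlledACLevel ch A m
  coding : ∀ m ∈ A, ControlledCodingLevel F K A m
  splitting : ∀ m ∈ Sp K A, ControlledSpLevel ch A m

/-! ### Diaries -/

inductive Label
  | Cd
  | AC
  | sp

/-- The possible entries of a diary: label, class (with its sort), position, passing numbers. -/
structure Entry (L : Lang) where
  label : Label
  size : ℕ
  sort : Fin size → Fin L.ku
  cls : AgeClass L size
  pos : ℕ
  pass : Fin (size - 1) → Fin L.k

/-- The diary entry of `A` at the critical level `m`. The position of a node is the number of nodes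
of the level set that precede it lexicographically; at a splitting level it is that of the (unique)
splitting node of length `m`. -/
def entry (F : Set (FinStr L)) (K : Str L ℕ) (A : Set ℕ) (m : ℕ) : Entry L where
  label := if m ∈ A then .Cd else if m ∈ Sp K A then .sp else .AC
  size := (level K A m).card
  sort i := (vec (level K A m) i).un
  cls := age F K m (vec (level K A m))
  pos :=
    if m ∈ A then ((level K A m).filter (· < code K m)).card
    else if m ∈ Sp K A then
      ((level K A m).filter fun s => ∀ x ∈ SpNode K A, x.len = m → s < x).card
    else 0
  pass j :=
    if m ∈ A then
      if h : (j : ℕ) < (level K A (m + 1)).card then (vec (level K A (m + 1)) ⟨j, h⟩).val m else 0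
    else 0

/-- The diary of `A`: a function from `|Crit A|` to entries. -/
def diary (F : Set (FinStr L)) (K : Str L ℕ) (A : Set ℕ) : Σ N : ℕ∞, (Below N → Entry L) :=
  ⟨(Crit F K A).encard, fun n => entry F K A (enum (Crit F K A) n)⟩

end DiaryEnvelope

end

noncomputable section

open Classical

namespace DiaryEnvelope

variable {L : Lang}

/-! ### Embeddings and cliques -/

/-! Members of `F` are irreducible, so a copy of one occupies a clique, and by `forb_of_clique` it
suffices to control cliques. A clique through a vertex `m` only contains vertices related to `m`.
For this reason age changes are recast as failures of `Stable`: attaching vertices of `A` over the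
first `m + 1` vertices of `K` instead of the first `m` creates no forbidden structure. By
`closed_iff`, closed sets are those that contain their splitting levels and are stable at every
level outside them. Both conditions survive intersections, so closures are closed.

For diagonal `A`, the cause of an age change at `m` is irreducible with a left-leaning image, so
this image is `nbhd K m`. The `hull` collects the critical levels, the free start levels and these
neighbourhoods. A member of the hull outside `A` is related to a smaller vertex only inside a common
neighbourhood, because the vertices at splitting and free start levels lie on the left branch. Thus
adding such members to `A` changes almost nothing: the hull is closed (`Diagonal.closed_hull`).
Coding levels are stable for `A` (`Diagonal.stable_of_mem`), and by the same reasoning deleting a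
vertex of `A` from the closure leaves a closed set, which gives the statement on interiors.

In the other direction, minimality of causes puts every `nbhd K m` into the closure
(`Realised.mem_cl`). So the closure is known up to noncritical free start levels, and these need not
be decided.

Equal diaries give a `Matching` of critical levels. Going down from the coding level of a vertex,
the diary determines the rank of its node at each critical level (`Matching.rk_eq_aux`), hence its
predicate, its path, its passing numbers, and whether its relation at a splitting level vanishes.
The value of a nonzero relation at a splitting level is prescribed by the choices. At an age-change
level the cause depends on the two ages alone (`Realised.unique`), and free start levels are ordered
by predicates and paths. The matching therefore extends to an isomorphism `HullRel` of the hulls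
that respects order, predicates and relations. The preimage of the closure of `B` is closed and
contains `A` (`Matched.closed_preimage`); by symmetry `HullRel` carries one closure onto the other,
and the envelopes coincide. -/

theorem IsEmb.comp {V W X : Type} {f : V → W} {g : W → X} {M : Str L V} {N : Str L W}
    {O : Str L X} (hg : IsEmb g N O) (hf : IsEmb f M N) : IsEmb (g ∘ f) M O :=
  ⟨hg.1.comp hf.1, fun a => (hg.2.1 _).trans (hf.2.1 a),
    fun a b => (hg.2.2 _ _).trans (hf.2.2 a b)⟩

theorem Forb.of_isEmb {F : Set (FinStr L)} {V W : Type} {M : Str L V} {N : Str L W} (h : Forb F N)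
    {f : V → W} (hf : IsEmb f M N) : Forb F M :=
  fun O hO ⟨g, hg⟩ => h O hO ⟨f ∘ g, hf.comp hg⟩

theorem IsEmb.irreducible {V W : Type} {f : V → W} {M : Str L V} {N : Str L W} (hf : IsEmb f M N)
    (hN : Irreducible N) : Irreducible M := fun a b hab => by
  rw [← hf.2.2]
  exact hN _ _ fun h => hab (hf.1 h)

/-- All distinct vertices of `S` are related in `M`. -/
def Clique {V : Type} (M : Str L V) (S : Set V) : Prop := ∀ u ∈ S, ∀ v ∈ S, u ≠ v → M.R u v ≠ 0

/-- `e` covers `S`, and is an embedding of `N` into `M` as far as vertices mapped to `S` are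
concerned. -/
def Covers {V W : Type} (e : W → V) (N : Str L W) (M : Str L V) (S : Set V) : Prop :=
  S ⊆ Set.range e ∧ (∀ w, e w ∈ S → N.U w = M.U (e w)) ∧
    ∀ w w', e w ∈ S → e w' ∈ S → e w ≠ e w' → N.R w w' = M.R (e w) (e w')

theorem Covers.of_isEmb {V W : Type} {e : W → V} {M : Str L V} {N : Str L W} {S : Set V}
    (he : IsEmb e N M) (hS : S ⊆ Set.range e) : Covers e N M S :=
  ⟨hS, fun w _ => (he.2.1 w).symm, fun w w' _ _ _ => (he.2.2 w w').symm⟩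

/-- Lift the copy of `O` along `e`, choosing a preimage for each of its vertices. As `Covers` says
nothing about pairs with the same image, the diagonal is treated separately. -/
theorem not_isEmb_of_covers {F : Set (FinStr L)} {V W : Type} {M : Str L V} {N : Str L W}
    (hN : Forb F N) {O : FinStr L} (hO : O ∈ F) {g : Fin O.1 → V} (hg : IsEmb g O.2 M)
    {e : W → V} (he : Covers e N M (Set.range g)) : False := by
  choose h hh using fun a => he.1 ⟨a, rfl⟩
  refine hN O hO ⟨h, ?_, ?_, ?_⟩
  · intro a b hab
    exact hg.1 (by rw [← hh a, ← hh b, hab])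
  · intro a
    rw [he.2.1 _ (by rw [hh]; exact ⟨a, rfl⟩), hh, hg.2.1]
  · intro a b
    by_cases hab : a = b
    · subst hab; rw [N.R_self, O.2.R_self]
    · rw [he.2.2 _ _ (by rw [hh]; exact ⟨a, rfl⟩) (by rw [hh]; exact ⟨b, rfl⟩)
        (by rw [hh, hh]; exact fun h => hab (hg.1 h)), hh, hh, hg.2.2]

theorem clique_range {F : Set (FinStr L)} (hF : Admissible F) {V : Type} {M : Str L V}
    {O : FinStr L} (hO : O ∈ F) {g : Fin O.1 → V} (hg : IsEmb g O.2 M) : Clique M (Set.range g) := by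
  rintro _ ⟨a, rfl⟩ _ ⟨b, rfl⟩ hab
  rw [hg.2.2]
  exact hF.irreducible O hO a b fun h => hab (h ▸ rfl)

/-- To show that `M` is in `Forb F`, it suffices to cover each clique of `M` by a structure in
`Forb F`. -/
theorem forb_of_clique {F : Set (FinStr L)} (hF : Admissible F) {V : Type} {M : Str L V}
    (H : ∀ S : Set V, Clique M S →
      ∃ (W : Type) (N : Str L W) (e : W → V), Forb F N ∧ Covers e N M S) : Forb F M := by
  rintro O hO ⟨g, hg⟩
  obtain ⟨W, N, e, hN, he⟩ := H _ (clique_range hF hO hg)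
  exact not_isEmb_of_covers hN hO hg he

/-! ### Joins -/

/-- The structure on `W ⊕ V` extending `I` and `M` in which `R (b, x) = η b x`. -/
def join {V W : Type} (I : Str L W) (M : Str L V) (η : V → W → Fin L.k) : Str L (W ⊕ V) where
  U
    | .inl x => I.U x
    | .inr b => M.U b
  R
    | .inl x, .inl y => I.R x y
    | .inl x, .inr b => L.flip (η b x)
    | .inr b, .inl x => η b x
    | .inr b, .inr b' => M.R b b'
  R_self
    | .inl x => I.R_self x
    | .inr b => M.R_self b
  R_flip
    | .inl x, .inl y => I.R_flip x y
    | .inl _, .inr _ => (L.flip_flip _).symm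
    | .inr _, .inl _ => rfl
    | .inr b, .inr b' => M.R_flip b b'

section join

variable {V W : Type} (I : Str L W) (M : Str L V) (η : V → W → Fin L.k)

@[simp] theorem join_U_inl (x : W) : (join I M η).U (.inl x) = I.U x := rfl
@[simp] theorem join_U_inr (b : V) : (join I M η).U (.inr b) = M.U b := rfl
@[simp] theorem join_R_inl_inl (x y : W) : (join I M η).R (.inl x) (.inl y) = I.R x y := rfl
@[simp] theorem join_R_inl_inr (x : W) (b : V) :
    (join I M η).R (.inl x) (.inr b) = L.flip (η b x) := rfl
@[simp] theorem join_R_inr_inl (x : W) (b : V) : (join I M η).R (.inr b) (.inl x) = η b x := rfl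
@[simp] theorem join_R_inr_inr (b c : V) : (join I M η).R (.inr b) (.inr c) = M.R b c := rfl

end join

/-- The structure obtained from a labelled structure by replacing labels with unary predicates. -/
def LabStr.toStr {d : ℕ} {V : Type} (B : LabStr L d V) (ρ : Fin d → Fin L.ku) : Str L V where
  U b := ρ (B.lab b)
  R := B.R
  R_self := B.R_self
  R_flip := B.R_flip

theorem glue_eq_join {d : ℕ} {V : Type} (B : LabStr L d V) (γ : Gluing L d) :
    glue B γ = join γ.str (B.toStr γ.sort) (fun b x => γ.att (B.lab b) x) := by
  ext u v
  · rcases u with u | u <;> rfl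
  · rcases u with u | u <;> rcases v with v | v <;> rfl

/-- The structure `M` glued to the first `m` vertices of `K`, where `b` is attached in the way in
which the vertex `f b` of `K` is. -/
def vglue (K : Str L ℕ) (m : ℕ) {V : Type} (M : Str L V) (f : V → ℕ) : Str L (Fin m ⊕ V) :=
  join (initial K m) M (fun b x => K.R (f b) x)

@[simp] theorem initial_U (K : Str L ℕ) (m : ℕ) (x : Fin m) : (initial K m).U x = K.U x := rfl
@[simp] theorem initial_R (K : Str L ℕ) (m : ℕ) (x y : Fin m) :
    (initial K m).R x y = K.R x y := rfl

theorem forb_initial {F : Set (FinStr L)} {K : Str L ℕ} (hK : IsFraisseLimit F K) (m : ℕ) :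
    Forb F (initial K m) :=
  (hK.age ⟨m, initial K m⟩).2 ⟨fun i => i, Fin.val_injective, fun _ => rfl, fun _ _ => rfl⟩

/-- Used mostly in contrapositive form: a clique through `x` avoids every attached vertex unrelated
to `x`. -/
theorem clique_inl_of_zero {V W : Type} {I : Str L W} {M : Str L V} {η : V → W → Fin L.k}
    {S : Set (W ⊕ V)} (hS : Clique (join I M η) S) {x : W} {b : V} (hx : .inl x ∈ S)
    (hb : .inr b ∈ S) : η b x ≠ 0 := by
  simpa using hS _ hb _ hx (by simp)

/-! ### Nodes -/

namespace Node

theorem eq_iff {s t : Node L} : s = t ↔ s.un = t.un ∧ s.bin = t.bin := by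
  constructor
  · rintro rfl; simp
  · rintro ⟨h1, h2⟩
    exact ofLex.injective (Prod.ext h1 h2)

@[simp] theorem un_mkNode (i : Fin L.ku) (b : List (Fin L.k)) : (mkNode i b).un = i := rfl
@[simp] theorem bin_mkNode (i : Fin L.ku) (b : List (Fin L.k)) : (mkNode i b).bin = b := rfl

theorem lt_iff {s t : Node L} : s < t ↔ s.un < t.un ∨ s.un = t.un ∧ s.bin < t.bin :=
  Prod.Lex.lt_iff

end Node

theorem append_lt_append_iff {α : Type*} [LinearOrder α] {l l' : List α} (h : l.length = l'.length)
    (p q : α) : l ++ [p] < l' ++ [q] ↔ l < l' ∨ l = l' ∧ p < q := by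
  induction l generalizing l' with
  | nil =>
    obtain rfl : l' = [] := by simpa using h.symm
    simp [List.cons_lt_cons_iff]
  | cons a l ih =>
    cases l' with
    | nil => simp at h
    | cons b l' =>
      have := ih (l' := l') (by simpa using h)
      simp only [List.cons_append, List.cons_lt_cons_iff, this, List.cons.injEq]
      tauto

theorem Node.succ_lt_succ {s t : Node L} (h : s.len = t.len) (p q : Fin L.k) :
    s.succ p < t.succ q ↔ s < t ∨ s = t ∧ p < q := by
  rw [Node.lt_iff, Node.lt_iff, Node.eq_iff]
  simp only [Node.succ, Node.un_mkNode, Node.bin_mkNode, append_lt_append_iff h]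
  tauto

theorem Node.succ_inj {s t : Node L} {p q : Fin L.k} : s.succ p = t.succ q ↔ s = t ∧ p = q := by
  rw [Node.eq_iff, Node.eq_iff]
  simp only [Node.succ, Node.un_mkNode, Node.bin_mkNode]
  constructor
  · rintro ⟨h1, h2⟩
    have := List.append_inj' h2 rfl
    exact ⟨⟨h1, this.1⟩, by simpa using this.2⟩
  · rintro ⟨⟨h1, h2⟩, rfl⟩
    simp [h1, h2]

/-- The restriction to length `m` of the node coded by the vertex `a`. -/
def cut (K : Str L ℕ) (a m : ℕ) : Node L := (code K a).restr m

theorem cut_eq (K : Str L ℕ) {a m : ℕ} (h : m ≤ a) :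
    cut K a m = mkNode (K.U a) (List.ofFn fun r : Fin m => K.R a r) := by
  rw [Node.eq_iff]
  refine ⟨rfl, ?_⟩
  simp only [cut, code, Node.restr, Node.bin_mkNode]
  apply List.ext_getElem
  · simp [h]
  · intro n h1 h2
    simp

@[simp] theorem cut_un (K : Str L ℕ) (a m : ℕ) : (cut K a m).un = K.U a := rfl

theorem cut_len (K : Str L ℕ) {a m : ℕ} (h : m ≤ a) : (cut K a m).len = m := by
  simp [cut_eq K h, Node.len]

theorem cut_val (K : Str L ℕ) {a m x : ℕ} (h : m ≤ a) (hx : x < m) :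
    (cut K a m).val x = K.R a x := by
  simp [cut_eq K h, Node.val, hx]

theorem cut_self (K : Str L ℕ) (a : ℕ) : cut K a a = code K a := by
  rw [cut_eq K le_rfl]; rfl

theorem cut_eq_cut (K : Str L ℕ) {a b m : ℕ} (ha : m ≤ a) (hb : m ≤ b) :
    cut K a m = cut K b m ↔ K.U a = K.U b ∧ ∀ r < m, K.R a r = K.R b r := by
  rw [cut_eq K ha, cut_eq K hb, Node.eq_iff]
  simp only [Node.un_mkNode, Node.bin_mkNode, List.ofFn_inj, funext_iff]
  exact and_congr_right fun _ => ⟨fun h r hr => h ⟨r, hr⟩, fun h r => h r r.2⟩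

theorem cut_succ (K : Str L ℕ) {a m : ℕ} (h : m < a) :
    cut K a (m + 1) = (cut K a m).succ (K.R a m) := by
  rw [cut_eq K h, cut_eq K h.le, Node.eq_iff]
  refine ⟨rfl, ?_⟩
  simp only [Node.succ, Node.bin_mkNode]
  rw [List.ofFn_succ_last]
  rfl

theorem cut_restr (K : Str L ℕ) {a m n : ℕ} (h : m ≤ n) : (cut K a n).restr m = cut K a m := by
  simp [cut, Node.restr, List.take_take, h]

theorem cut_eq_left (K : Str L ℕ) {a m : ℕ} (h : m ≤ a) (i : Fin L.ku) :
    cut K a m = Node.left i m ↔ K.U a = i ∧ ∀ r < m, K.R a r = 0 := by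
  rw [cut_eq K h, Node.eq_iff]
  simp only [Node.left, Node.un_mkNode, Node.bin_mkNode, ← List.ofFn_const, List.ofFn_inj,
    funext_iff]
  exact and_congr_right fun _ => ⟨fun h r hr => h ⟨r, hr⟩, fun h r => h r r.2⟩

theorem code_eq_left (K : Str L ℕ) {m : ℕ} (i : Fin L.ku) :
    code K m = Node.left i m ↔ K.U m = i ∧ ∀ r < m, K.R m r = 0 := by
  rw [← cut_self, cut_eq_left K le_rfl]

theorem below_code_iff (K : Str L ℕ) {x : Node L} {a : ℕ} :
    x.Below (code K a) ↔ x.len ≤ a ∧ x = cut K a x.len := by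
  constructor
  · rintro ⟨h1, h2⟩
    refine ⟨by simpa [code, Node.len] using h2.length_le, ?_⟩
    rw [Node.eq_iff]
    exact ⟨h1, List.prefix_iff_eq_take.1 h2⟩
  · rintro ⟨-, h⟩
    rw [h]
    exact ⟨rfl, List.take_prefix _ _⟩

theorem cut_below_code (K : Str L ℕ) {a b m : ℕ} (ha : m ≤ a) (h : cut K a m = cut K b m)
    (hb : m ≤ b) : (cut K a m).Below (code K b) := by
  rw [below_code_iff, cut_len K ha]
  exact ⟨hb, h⟩

theorem isStart_iff (K : Str L ℕ) {a m : ℕ} :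
    IsStart K a m ↔ m < a ∧ K.R a m ≠ 0 ∧ ∀ r < m, K.R a r = 0 := by
  have hl : (code K a).len = a := by simp [code, Node.len]
  have hv : ∀ r < a, (code K a).val r = K.R a r := fun r hr => by
    rw [← cut_self, cut_val K le_rfl hr]
  unfold IsStart Node.IsStart
  rw [hl]
  refine and_congr_right fun h => ?_
  rw [hv m h]
  exact and_congr_right fun _ => forall₂_congr fun r hr => by rw [hv r (hr.trans h)]

theorem code_val (K : Str L ℕ) {a r : ℕ} (h : r < a) : (code K a).val r = K.R a r := by
  rw [← cut_self, cut_val K le_rfl h]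

theorem IsStart.unique {K : Str L ℕ} {a m n : ℕ} (h : IsStart K a m) (h' : IsStart K a n) :
    m = n := by
  rw [isStart_iff] at h h'
  rcases lt_trichotomy m n with hl | rfl | hl
  · exact absurd (h'.2.2 m hl) h.2.1
  · rfl
  · exact absurd (h.2.2 n hl) h'.2.1

/-! ### Levels and ranks -/

theorem mem_level {K : Str L ℕ} {A : Set ℕ} {m : ℕ} {t : Node L} :
    t ∈ level K A m ↔ ∃ a ∈ A, m ≤ a ∧ t = cut K a m := by
  simp [level, cut]

theorem cut_mem_level {K : Str L ℕ} {A : Set ℕ} {m a : ℕ} (ha : a ∈ A) (h : m ≤ a) :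
    cut K a m ∈ level K A m := mem_level.2 ⟨a, ha, h, rfl⟩

/-- The longest common initial segment of two codes ends where the two vertices first disagree. From
here on splitting is handled through such disagreements rather than through meets of nodes. -/
theorem mem_spNode {K : Str L ℕ} {A : Set ℕ} {x : Node L} :
    x ∈ SpNode K A ↔ ∃ a ∈ A, ∃ b ∈ A, ∃ m, m < a ∧ m < b ∧ cut K a m = cut K b m ∧
      K.R a m ≠ K.R b m ∧ x = cut K a m := by
  constructor
  · rintro ⟨a, ha, b, hb, hU, hperp, hx⟩
    -- Without a disagreement below both vertices, the code of the smaller one would be an initial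
    -- segment of the other.
    have hex : ∃ m, m < a ∧ m < b ∧ K.R a m ≠ K.R b m := by
      by_contra! hcon
      rcases le_total a b with hab | hab
      · refine hperp.1 ?_
        rw [← cut_self K a]
        exact cut_below_code K le_rfl ((cut_eq_cut K le_rfl hab).2
          ⟨hU, fun r hr => hcon r hr (hr.trans_le hab)⟩) hab
      · refine hperp.2 ?_
        rw [← cut_self K b]
        exact cut_below_code K le_rfl ((cut_eq_cut K le_rfl hab).2
          ⟨hU.symm, fun r hr => (hcon r (hr.trans_le hab) hr).symm⟩) hab
    set m := Nat.find hex with hm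
    obtain ⟨hma, hmb, hne⟩ := Nat.find_spec hex
    have heq : cut K a m = cut K b m := (cut_eq_cut K hma.le hmb.le).2 ⟨hU, fun r hr => by
      by_contra h
      exact Nat.find_min hex hr ⟨hr.trans hma, hr.trans hmb, h⟩⟩
    refine ⟨a, ha, b, hb, m, hma, hmb, heq, hne, ?_⟩
    have h1 := (below_code_iff K).1 hx.1
    have h2 := (below_code_iff K).1 hx.2.1
    have h3 := hx.2.2 (cut K a m) (cut_below_code K hma.le rfl hma.le)
      (cut_below_code K hma.le heq hmb.le)
    have h4 : m ≤ x.len := by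
      have := h3.2.length_le
      rwa [show (cut K a m).bin.length = m from cut_len K hma.le] at this
    rcases h4.eq_or_lt with h5 | h5
    · rw [h5]; exact h1.2
    · exfalso
      have h6 := (cut_eq_cut K h1.1 h2.1).1 (h1.2.symm.trans h2.2)
      exact hne (h6.2 m h5)
  · rintro ⟨a, ha, b, hb, m, hma, hmb, heq, hne, rfl⟩
    have hag := (cut_eq_cut K hma.le hmb.le).1 heq
    refine ⟨a, ha, b, hb, hag.1, ⟨fun h => ?_, fun h => ?_⟩, ?_, ?_, ?_⟩
    · rw [below_code_iff, show (code K a).len = a by simp [code, Node.len], ← cut_self K a] at h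
      exact hne (((cut_eq_cut K le_rfl h.1).1 h.2).2 m hma)
    · rw [below_code_iff, show (code K b).len = b by simp [code, Node.len], ← cut_self K b] at h
      exact hne (((cut_eq_cut K le_rfl h.1).1 h.2).2 m hmb).symm
    · exact cut_below_code K hma.le rfl hma.le
    · exact cut_below_code K hma.le heq hmb.le
    · intro y hya hyb
      rw [below_code_iff] at hya hyb
      have h6 := (cut_eq_cut K hya.1 hyb.1).1 (hya.2.symm.trans hyb.2)
      have hle : y.len ≤ m := by
        by_contra! h
        exact hne (h6.2 m h)
      rw [hya.2]
      refine ⟨rfl, ?_⟩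
      have := cut_restr K (a := a) hle
      rw [← this]
      exact List.take_prefix _ _

theorem mem_sp {K : Str L ℕ} {A : Set ℕ} {m : ℕ} :
    m ∈ Sp K A ↔ ∃ a ∈ A, ∃ b ∈ A, m < a ∧ m < b ∧ cut K a m = cut K b m ∧ K.R a m ≠ K.R b m := by
  constructor
  · rintro ⟨x, hx, rfl⟩
    obtain ⟨a, ha, b, hb, m, hma, hmb, heq, hne, rfl⟩ := mem_spNode.1 hx
    rw [cut_len K hma.le]
    exact ⟨a, ha, b, hb, hma, hmb, heq, hne⟩
  · rintro ⟨a, ha, b, hb, hma, hmb, heq, hne⟩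
    exact ⟨cut K a m, mem_spNode.2 ⟨a, ha, b, hb, m, hma, hmb, heq, hne, rfl⟩, cut_len K hma.le⟩

theorem Sp_mono {K : Str L ℕ} {A B : Set ℕ} (h : A ⊆ B) : Sp K A ⊆ Sp K B := fun m hm => by
  obtain ⟨a, ha, b, hb, h'⟩ := mem_sp.1 hm
  exact mem_sp.2 ⟨a, h ha, b, h hb, h'⟩

theorem cut_succ_lt {K : Str L ℕ} {a b m : ℕ} (ha : m < a) (hb : m < b) :
    cut K a (m + 1) < cut K b (m + 1) ↔
      cut K a m < cut K b m ∨ cut K a m = cut K b m ∧ K.R a m < K.R b m := by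
  rw [cut_succ K ha, cut_succ K hb,
    Node.succ_lt_succ ((cut_len K ha.le).trans (cut_len K hb.le).symm)]

theorem cut_succ_inj {K : Str L ℕ} {a b m : ℕ} (ha : m < a) (hb : m < b) :
    cut K a (m + 1) = cut K b (m + 1) ↔ cut K a m = cut K b m ∧ K.R a m = K.R b m := by
  rw [cut_succ K ha, cut_succ K hb, Node.succ_inj]

/-! ### Ranks and enumerations of level sets -/

/-- The number of elements of `S` below `t`. -/
def rank (S : Finset (Node L)) (t : Node L) : ℕ := (S.filter (· < t)).card

theorem rank_lt_rank {S : Finset (Node L)} {s t : Node L} (hs : s ∈ S) (h : s < t) :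
    rank S s < rank S t := by
  refine Finset.card_lt_card ?_
  rw [Finset.ssubset_iff_of_subset]
  · exact ⟨s, by simp [hs, h], by simp⟩
  · intro u
    simp only [Finset.mem_filter]
    exact fun hu => ⟨hu.1, hu.2.trans h⟩

theorem rank_inj {S : Finset (Node L)} {s t : Node L} (hs : s ∈ S) (ht : t ∈ S)
    (h : rank S s = rank S t) : s = t := by
  rcases lt_trichotomy s t with hl | rfl | hl
  · exact absurd h (rank_lt_rank hs hl).ne
  · rfl
  · exact absurd h (rank_lt_rank ht hl).ne'

theorem Lists.card_eq {d : ℕ} {s : Fin d → Node L} {S : Finset (Node L)} (h : Lists s S) :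
    S.card = d := by
  have : S = Finset.univ.image s := by
    ext x; simp [← Finset.mem_coe, ← h.2]
  rw [this, Finset.card_image_of_injective _ h.1.injective, Finset.card_univ, Fintype.card_fin]

theorem Lists.mem {d : ℕ} {s : Fin d → Node L} {S : Finset (Node L)} (h : Lists s S) (i : Fin d) :
    s i ∈ S := by
  rw [← Finset.mem_coe, ← h.2]; exact ⟨i, rfl⟩

theorem Lists.exists_eq {d : ℕ} {s : Fin d → Node L} {S : Finset (Node L)} (h : Lists s S)
    {t : Node L} (ht : t ∈ S) : ∃ i, s i = t := by
  rwa [← Finset.mem_coe, ← h.2] at ht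

theorem Lists.rank_eq {d : ℕ} {s : Fin d → Node L} {S : Finset (Node L)} (h : Lists s S)
    (i : Fin d) : rank S (s i) = i := by
  have : S.filter (· < s i) = (Finset.Iio i).image s := by
    ext x
    simp only [Finset.mem_filter, Finset.mem_image, Finset.mem_Iio]
    constructor
    · rintro ⟨hx, hlt⟩
      obtain ⟨j, rfl⟩ := h.exists_eq hx
      exact ⟨j, h.1.lt_iff_lt.1 hlt, rfl⟩
    · rintro ⟨j, hj, rfl⟩
      exact ⟨h.mem j, h.1 hj⟩
  rw [rank, this, Finset.card_image_of_injective _ h.1.injective, Fin.card_Iio]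

theorem lists_vec (S : Finset (Node L)) : Lists (vec S) S :=
  ⟨(S.orderEmbOfFin rfl).strictMono, S.range_orderEmbOfFin rfl⟩

theorem Lists.unique {d : ℕ} {s t : Fin d → Node L} {S : Finset (Node L)} (hs : Lists s S)
    (ht : Lists t S) : s = t := by
  funext i
  exact rank_inj (hs.mem i) (ht.mem i) (by rw [hs.rank_eq, ht.rank_eq])

/-- The rank of `c(a)|_m` in `c[A]|_m`. -/
def rk (K : Str L ℕ) (A : Set ℕ) (m a : ℕ) : ℕ := rank (level K A m) (cut K a m)

theorem Lists.exists_index {K : Str L ℕ} {A : Set ℕ} {m a : ℕ} {d : ℕ} {s : Fin d → Node L}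
    (h : Lists s (level K A m)) (ha : a ∈ A) (hm : m ≤ a) :
    ∃ i : Fin d, s i = cut K a m ∧ (i : ℕ) = rk K A m a := by
  obtain ⟨i, hi⟩ := h.exists_eq (cut_mem_level ha hm)
  exact ⟨i, hi, by rw [rk, ← hi, h.rank_eq]⟩

/-! ### The passage from one level to the next -/

theorem cut_injOn_of_not_mem_sp {K : Str L ℕ} {A : Set ℕ} {m a b : ℕ} (hm : m ∉ Sp K A)
    (ha : a ∈ A) (hb : b ∈ A) (hma : m < a) (hmb : m < b) (h : cut K a m = cut K b m) :
    cut K a (m + 1) = cut K b (m + 1) := by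
  rw [cut_succ_inj hma hmb]
  refine ⟨h, ?_⟩
  by_contra hne
  exact hm (mem_sp.2 ⟨a, ha, b, hb, hma, hmb, h, hne⟩)

theorem cut_succ_lt_of_not_mem_sp {K : Str L ℕ} {A : Set ℕ} {m a b : ℕ} (hm : m ∉ Sp K A)
    (ha : a ∈ A) (hb : b ∈ A) (hma : m < a) (hmb : m < b) :
    cut K a (m + 1) < cut K b (m + 1) ↔ cut K a m < cut K b m := by
  rw [cut_succ_lt hma hmb]
  constructor
  · rintro (h | ⟨h, h'⟩)
    · exact h
    · exact absurd ((cut_succ_inj hma hmb).1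
        (cut_injOn_of_not_mem_sp hm ha hb hma hmb h)).2 h'.ne
  · exact Or.inl

/-- Away from splitting levels, restriction is injective from level `m + 1` to level `m`. -/
theorem card_filter_restr {K : Str L ℕ} {A : Set ℕ} {m : ℕ} (hm : m ∉ Sp K A) (a : ℕ)
    (ha : a ∈ A) (hma : m < a) :
    rk K A (m + 1) a =
      ((level K A m).filter fun s => s < cut K a m ∧ ∃ b ∈ A, m < b ∧ s = cut K b m).card := by
  refine Finset.card_bij (fun t _ => t.restr m) ?_ ?_ ?_
  · intro t ht
    simp only [Finset.mem_filter, mem_level] at ht ⊢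
    obtain ⟨⟨b, hb, hmb, rfl⟩, hlt⟩ := ht
    rw [cut_restr K (by omega)]
    exact ⟨⟨b, hb, by omega, rfl⟩, (cut_succ_lt_of_not_mem_sp hm hb ha hmb hma).1 hlt, b, hb, hmb,
      rfl⟩
  · intro t ht u hu htu
    simp only [Finset.mem_filter, mem_level] at ht hu
    obtain ⟨⟨b, hb, hmb, rfl⟩, -⟩ := ht
    obtain ⟨⟨c, hc, hmc, rfl⟩, -⟩ := hu
    rw [cut_restr K (by omega), cut_restr K (by omega)] at htu
    exact cut_injOn_of_not_mem_sp hm hb hc hmb hmc htu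
  · intro s hs
    simp only [Finset.mem_filter] at hs
    obtain ⟨-, hlt, b, hb, hmb, rfl⟩ := hs
    refine ⟨cut K b (m + 1), ?_, cut_restr K (by omega)⟩
    simp only [Finset.mem_filter]
    exact ⟨cut_mem_level hb hmb, (cut_succ_lt_of_not_mem_sp hm hb ha hmb hma).2 hlt⟩

theorem rk_succ_of_noncritical {K : Str L ℕ} {A : Set ℕ} {m a : ℕ} (hA : m ∉ A) (hm : m ∉ Sp K A)
    (ha : a ∈ A) (hma : m < a) : rk K A (m + 1) a = rk K A m a := by
  rw [card_filter_restr hm a ha hma]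
  refine congrArg Finset.card (Finset.filter_congr fun s hs => ?_)
  rw [and_iff_left]
  obtain ⟨b, hb, hmb, rfl⟩ := mem_level.1 hs
  exact ⟨b, hb, lt_of_le_of_ne hmb fun h => hA (h ▸ hb), rfl⟩

theorem card_level_succ {K : Str L ℕ} {A : Set ℕ} {m : ℕ} (hA : m ∉ A) (hm : m ∉ Sp K A) :
    (level K A (m + 1)).card = (level K A m).card := by
  refine Finset.card_bij (fun t _ => t.restr m) ?_ ?_ ?_
  · intro t ht
    simp only [mem_level] at ht ⊢
    obtain ⟨b, hb, hmb, rfl⟩ := ht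
    rw [cut_restr K (by omega)]
    exact ⟨b, hb, by omega, rfl⟩
  · intro t ht u hu htu
    simp only [mem_level] at ht hu
    obtain ⟨b, hb, hmb, rfl⟩ := ht
    obtain ⟨c, hc, hmc, rfl⟩ := hu
    rw [cut_restr K (by omega), cut_restr K (by omega)] at htu
    exact cut_injOn_of_not_mem_sp hm hb hc hmb hmc htu
  · intro s hs
    obtain ⟨b, hb, hmb, rfl⟩ := mem_level.1 hs
    exact ⟨cut K b (m + 1), cut_mem_level hb (lt_of_le_of_ne hmb fun h => hA (h ▸ hb)),
      cut_restr K (by omega)⟩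

/-- At a coding level, one node is removed. -/
theorem rk_of_coding {K : Str L ℕ} {A : Set ℕ} {m a : ℕ} (hA : m ∈ A) (hm : m ∉ Sp K A)
    (hanti : ∀ b ∈ A, m < b → cut K b m ≠ code K m) (ha : a ∈ A) (hma : m < a) :
    rk K A m a = rk K A (m + 1) a +
      if rank (level K A m) (code K m) ≤ rk K A (m + 1) a then 1 else 0 := by
  have hmem : code K m ∈ level K A m := by
    rw [← cut_self]; exact cut_mem_level hA le_rfl
  have hex : ∀ s ∈ level K A m, s ≠ code K m ↔ ∃ b ∈ A, m < b ∧ s = cut K b m := by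
    intro s hs
    constructor
    · intro hne
      obtain ⟨b, hb, hmb, rfl⟩ := mem_level.1 hs
      refine ⟨b, hb, lt_of_le_of_ne hmb ?_, rfl⟩
      rintro rfl
      exact hne (cut_self K m)
    · rintro ⟨b, hb, hmb, rfl⟩
      exact hanti b hb hmb
  have h1 : rk K A (m + 1) a =
      (((level K A m).filter (· < cut K a m)).erase (code K m)).card := by
    rw [card_filter_restr hm a ha hma]
    congr 1
    ext s
    simp only [Finset.mem_filter, Finset.mem_erase]
    constructor
    · rintro ⟨hs, h, h'⟩
      exact ⟨(hex s hs).2 h', hs, h⟩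
    · rintro ⟨h', hs, h⟩
      exact ⟨hs, h, (hex s hs).1 h'⟩
  -- The rank at `m + 1` alone decides the case. A node after the coding node has lost one
  -- predecessor and still has rank at least that of the coding node; a node before it keeps its
  -- smaller rank.
  rcases lt_trichotomy (code K m) (cut K a m) with h | h | h
  · have h2 : rk K A (m + 1) a = rk K A m a - 1 := by
      rw [h1, Finset.card_erase_of_mem (by simp [hmem, h])]; rfl
    have h3 : rank (level K A m) (code K m) < rk K A m a := rank_lt_rank hmem h
    rw [if_pos (by omega)]
    omega
  · exact absurd h.symm (hanti a ha hma)
  · have h2 : rk K A (m + 1) a = rk K A m a := by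
      rw [h1, Finset.erase_eq_of_notMem]; rfl
      simp [h.le]
    have h3 : rk K A m a < rank (level K A m) (code K m) :=
      rank_lt_rank (cut_mem_level ha hma.le) h
    rw [if_neg (by omega)]
    omega

theorem card_level_of_coding {K : Str L ℕ} {A : Set ℕ} {m : ℕ} (hA : m ∈ A) (hm : m ∉ Sp K A)
    (hanti : ∀ b ∈ A, m < b → cut K b m ≠ code K m) :
    (level K A (m + 1)).card = (level K A m).card - 1 := by
  have hmem : code K m ∈ level K A m := by
    rw [← cut_self]; exact cut_mem_level hA le_rfl
  rw [← Finset.card_erase_of_mem hmem]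
  refine Finset.card_bij (fun t _ => t.restr m) ?_ ?_ ?_
  · intro t ht
    simp only [mem_level, Finset.mem_erase] at ht ⊢
    obtain ⟨b, hb, hmb, rfl⟩ := ht
    rw [cut_restr K (by omega)]
    exact ⟨hanti b hb hmb, b, hb, by omega, rfl⟩
  · intro t ht u hu htu
    simp only [mem_level] at ht hu
    obtain ⟨b, hb, hmb, rfl⟩ := ht
    obtain ⟨c, hc, hmc, rfl⟩ := hu
    rw [cut_restr K (by omega), cut_restr K (by omega)] at htu
    exact cut_injOn_of_not_mem_sp hm hb hc hmb hmc htu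
  · intro s hs
    simp only [mem_level, Finset.mem_erase] at hs
    obtain ⟨hne, b, hb, hmb, rfl⟩ := hs
    refine ⟨cut K b (m + 1), cut_mem_level hb (lt_of_le_of_ne hmb ?_), cut_restr K (by omega)⟩
    rintro rfl
    exact hne (cut_self K m)

/-! ### Stability -/

theorem vglue_isEmb_right {K : Str L ℕ} {m : ℕ} {V W : Type} (M : Str L V) (f : V → ℕ) {g : W → V}
    (hg : Function.Injective g) :
    IsEmb (Sum.map id g) (vglue K m (M.pullback g) (f ∘ g)) (vglue K m M f) := by
  refine ⟨Function.injective_id.sumMap hg, ?_, ?_⟩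
  · rintro (x | b) <;> rfl
  · rintro (x | b) (y | c) <;> rfl

theorem vglue_isEmb_left {K : Str L ℕ} {m n : ℕ} (h : m ≤ n) {V : Type} (M : Str L V) (f : V → ℕ) :
    IsEmb (Sum.map (Fin.castLE h) id) (vglue K m M f) (vglue K n M f) := by
  refine ⟨(Fin.castLE_injective h).sumMap Function.injective_id, ?_, ?_⟩
  · rintro (x | b) <;> rfl
  · rintro (x | b) (y | c) <;> rfl

/-- Structures attached in the ways in which vertices of `A` are attached do not notice the
vertex `m`. -/
def Stable (F : Set (FinStr L)) (K : Str L ℕ) (A : Set ℕ) (m : ℕ) : Prop :=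
  ∀ (V : Type) [Finite V] (M : Str L V) (f : V → ℕ),
    (∀ b, f b ∈ A ∧ m < f b ∧ M.U b = K.U (f b)) →
      Forb F (vglue K m M f) → Forb F (vglue K (m + 1) M f)

/-- Ages only contain structures on the sets `Fin n`, whereas later arguments attach structures on
sums and subtypes. An enumeration of `V` bridges the two. -/
theorem stable_of_fin {F : Set (FinStr L)} {K : Str L ℕ} {A : Set ℕ} {m : ℕ}
    (h : ∀ (n : ℕ) (M : Str L (Fin n)) (f : Fin n → ℕ),
      (∀ b, f b ∈ A ∧ m < f b ∧ M.U b = K.U (f b)) →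
        Forb F (vglue K m M f) → Forb F (vglue K (m + 1) M f)) : Stable F K A m := by
  intro V _ M f hf hforb
  obtain ⟨n, ⟨e⟩⟩ := Finite.exists_equiv_fin V
  have h1 := h n (M.pullback e.symm) (f ∘ e.symm) (fun b => hf _)
    (hforb.of_isEmb (vglue_isEmb_right M f e.symm.injective))
  have h2 := h1.of_isEmb (vglue_isEmb_right _ _ e.injective)
  have h3 : (M.pullback e.symm).pullback e = M := by
    ext <;> simp [Str.pullback]
  have h4 : (f ∘ e.symm) ∘ e = f := by
    funext; simp
  rwa [h3, h4] at h2

/-- A clique through `m` contains only attached vertices related to `m`, and these are attached like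
members of `A`. A clique avoiding `m` already lives over the first `m` vertices. So enlarging `A` by
vertices unrelated to `m` preserves stability. -/
theorem Stable.of_nonzero {F : Set (FinStr L)} (hF : Admissible F) {K : Str L ℕ} {A D : Set ℕ}
    {m : ℕ} (h : Stable F K A m) (hD : ∀ x ∈ D, m < x → K.R x m ≠ 0 → x ∈ A) :
    Stable F K D m := by
  intro V _ M f hf hforb
  refine forb_of_clique hF fun S hS => ?_
  by_cases hm : .inl (Fin.last m) ∈ S
  · refine ⟨_, vglue K (m + 1) (M.pullback (Subtype.val : {b // K.R (f b) m ≠ 0} → V)) (f ∘ (↑)),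
      Sum.map id (↑), ?_, Covers.of_isEmb (vglue_isEmb_right M f Subtype.val_injective) ?_⟩
    · exact h _ _ _ (fun b => ⟨hD _ (hf b).1 (hf b).2.1 b.2, (hf b).2.1, (hf b).2.2⟩)
        (hforb.of_isEmb (vglue_isEmb_right M f Subtype.val_injective))
    · rintro (x | b) hx
      · exact ⟨.inl x, rfl⟩
      · exact ⟨.inr ⟨b, clique_inl_of_zero hS hm hx⟩, rfl⟩
  · refine ⟨_, vglue K m M f, Sum.map (Fin.castLE m.le_succ) id, hforb,
      Covers.of_isEmb (vglue_isEmb_left m.le_succ M f) ?_⟩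
    rintro (x | b) hx
    · induction x using Fin.lastCases with
      | last => exact absurd hx hm
      | cast x => exact ⟨.inl x, rfl⟩
    · exact ⟨.inr b, rfl⟩

theorem Stable.mono {F : Set (FinStr L)} {K : Str L ℕ} {A D : Set ℕ}
    {m : ℕ} (h : Stable F K A m) (hD : D ⊆ A) : Stable F K D m :=
  fun V _ M f hf => h V M f fun b => ⟨hD (hf b).1, (hf b).2⟩

/-! ### Ages of levels -/

/-- Replace the unary predicates by labels. -/
def Str.toLab {d : ℕ} {V : Type} (M : Str L V) (lab : V → Fin d) : LabStr L d V where
  lab := lab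
  R := M.R
  R_self := M.R_self
  R_flip := M.R_flip

theorem mem_age {F : Set (FinStr L)} {K : Str L ℕ} {m d n : ℕ} {s : Fin d → Node L}
    {B : LabStr L d (Fin n)} : (⟨n, B⟩ : FinLab L d) ∈ age F K m s ↔
      Forb F (join (initial K m) (B.toStr fun i => (s i).un)
        (fun b x => (s (B.lab b)).val x)) := by
  change Forb F (glue _ _) ↔ _
  rw [glue_eq_join]
  rfl

theorem mem_gluingAge {F : Set (FinStr L)} {d n : ℕ} {γ : Gluing L d} {B : LabStr L d (Fin n)} :
    (⟨n, B⟩ : FinLab L d) ∈ gluingAge F γ ↔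
      Forb F (join γ.str (B.toStr γ.sort) (fun b x => γ.att (B.lab b) x)) := by
  rw [← glue_eq_join]
  rfl

/-- Passage from nodes to vertices: a label may be replaced by any vertex whose restriction is the
node with that label. Ages at different levels then become glued structures over one `K` and can be
compared by embeddings. -/
theorem mem_age_iff_forb_vglue {F : Set (FinStr L)} {K : Str L ℕ} {m d n : ℕ} {s : Fin d → Node L}
    {B : LabStr L d (Fin n)} {M : Str L (Fin n)} {f : Fin n → ℕ}
    (h : ∀ b, m ≤ f b ∧ s (B.lab b) = cut K (f b) m ∧ M.U b = K.U (f b)) (hR : M.R = B.R) :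
    (⟨n, B⟩ : FinLab L d) ∈ age F K m s ↔ Forb F (vglue K m M f) := by
  rw [mem_age]
  have h1 : (B.toStr fun i => (s i).un) = M := by
    ext b c
    · simp [LabStr.toStr, (h b).2.1, (h b).2.2]
    · simp [LabStr.toStr, hR]
  have h2 : (fun b (x : Fin m) => (s (B.lab b)).val x) = fun b (x : Fin m) => K.R (f b) x := by
    funext b x
    rw [(h b).2.1, cut_val K (h b).1 x.2]
  rw [h1, h2]
  rfl

theorem Lists.levelAge_eq {F : Set (FinStr L)} {K : Str L ℕ} {A : Set ℕ} {m d : ℕ}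
    {s : Fin d → Node L} (h : Lists s (level K A m)) : levelAge F K A m = ⟨d, age F K m s⟩ := by
  obtain rfl := h.card_eq
  rw [levelAge, h.unique (lists_vec _)]

theorem exists_lists {S : Finset (Node L)} {d : ℕ} (h : S.card = d) :
    ∃ s : Fin d → Node L, Lists s S := by
  subst h
  exact ⟨_, lists_vec S⟩

/-- At a level which is neither coding nor splitting, each vertex of `A` has the same index in the
enumerations of the two level sets. -/
theorem Lists.eq_cut_of_noncritical {K : Str L ℕ} {A : Set ℕ} {m a d : ℕ} {s t : Fin d → Node L}
    (hA : m ∉ A) (hm : m ∉ Sp K A) (hs : Lists s (level K A m)) (ht : Lists t (level K A (m + 1)))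
    (ha : a ∈ A) (hma : m < a) {j : Fin d} (hj : t j = cut K a (m + 1)) : s j = cut K a m := by
  obtain ⟨i, hi, hi'⟩ := hs.exists_index ha hma.le
  obtain rfl : i = j := by
    apply Fin.ext
    rw [hi', ← ht.rank_eq j, hj, ← rk_succ_of_noncritical hA hm ha hma]
    rfl
  exact hi

theorem Lists.exists_vertex_of_noncritical {K : Str L ℕ} {A : Set ℕ} {m d : ℕ}
    {s t : Fin d → Node L} (hA : m ∉ A) (hm : m ∉ Sp K A) (hs : Lists s (level K A m))
    (ht : Lists t (level K A (m + 1))) (j : Fin d) :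
    ∃ a ∈ A, m < a ∧ s j = cut K a m ∧ t j = cut K a (m + 1) := by
  obtain ⟨a, ha, hma, hj⟩ := mem_level.1 (ht.mem j)
  exact ⟨a, ha, hma, hs.eq_cut_of_noncritical hA hm ht ha hma hj, hj⟩

theorem age_succ_subset_of_noncritical {F : Set (FinStr L)} {K : Str L ℕ} {A : Set ℕ} {m d : ℕ}
    {s t : Fin d → Node L} (hA : m ∉ A) (hm : m ∉ Sp K A) (hs : Lists s (level K A m))
    (ht : Lists t (level K A (m + 1))) : age F K (m + 1) t ⊆ age F K m s := by
  rintro ⟨n, B⟩ hB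
  choose a ha hma hsa hta using hs.exists_vertex_of_noncritical hA hm ht
  rw [mem_age_iff_forb_vglue (M := B.toStr fun i => (s i).un) (f := fun b => a (B.lab b))
    (fun b => ⟨hma _, hta _, by simp [LabStr.toStr, hsa]⟩) rfl] at hB
  rw [mem_age_iff_forb_vglue (M := B.toStr fun i => (s i).un) (f := fun b => a (B.lab b))
    (fun b => ⟨(hma _).le, hsa _, by simp [LabStr.toStr, hsa]⟩) rfl]
  exact hB.of_isEmb (vglue_isEmb_left m.le_succ _ _)

/-- Away from coding and splitting levels, restriction is an order-preserving bijection between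
consecutive level sets, so a label names the same vertices at both levels. One inclusion of ages
always holds; the other one is stability. -/
theorem age_eq_age_succ_iff_stable {F : Set (FinStr L)} {K : Str L ℕ} {A : Set ℕ} {m d : ℕ}
    {s t : Fin d → Node L} (hA : m ∉ A) (hm : m ∉ Sp K A) (hs : Lists s (level K A m))
    (ht : Lists t (level K A (m + 1))) : age F K m s = age F K (m + 1) t ↔ Stable F K A m := by
  constructor
  · intro h
    refine stable_of_fin fun n M f hf hforb => ?_
    choose lab hlab _ using fun b => ht.exists_index (hf b).1 (hf b).2.1
    rw [← mem_age_iff_forb_vglue (B := M.toLab lab) (s := s) (fun b => ⟨(hf b).2.1.le,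
      hs.eq_cut_of_noncritical hA hm ht (hf b).1 (hf b).2.1 (hlab b), (hf b).2.2⟩) rfl, h] at hforb
    exact (mem_age_iff_forb_vglue (fun b => ⟨(hf b).2.1, hlab b, (hf b).2.2⟩) rfl).1 hforb
  · intro h
    refine Set.Subset.antisymm ?_ (age_succ_subset_of_noncritical hA hm hs ht)
    rintro ⟨n, B⟩ hB
    choose a ha hma hsa hta using hs.exists_vertex_of_noncritical hA hm ht
    rw [mem_age_iff_forb_vglue (M := B.toStr fun i => (s i).un) (f := fun b => a (B.lab b))
      (fun b => ⟨(hma _).le, hsa _, by simp [LabStr.toStr, hsa]⟩) rfl] at hB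
    rw [mem_age_iff_forb_vglue (M := B.toStr fun i => (s i).un) (f := fun b => a (B.lab b))
      (fun b => ⟨hma _, hta _, by simp [LabStr.toStr, hsa]⟩) rfl]
    exact h _ _ _ (fun b => ⟨ha _, hma _, by simp [LabStr.toStr, hsa]⟩) hB

theorem levelAge_eq_iff_stable {F : Set (FinStr L)} {K : Str L ℕ} {A : Set ℕ} {m : ℕ}
    (hA : m ∉ A) (hm : m ∉ Sp K A) :
    levelAge F K A m = levelAge F K A (m + 1) ↔ Stable F K A m := by
  obtain ⟨s, hs⟩ := exists_lists (S := level K A m) rfl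
  obtain ⟨t, ht⟩ := exists_lists (card_level_succ hA hm)
  rw [hs.levelAge_eq, ht.levelAge_eq, ← age_eq_age_succ_iff_stable hA hm hs ht]
  simp

theorem mem_AC {F : Set (FinStr L)} {K : Str L ℕ} {A : Set ℕ} {m : ℕ} :
    m ∈ AC F K A ↔ m ∉ A ∧ m ∉ Sp K A ∧ ¬ Stable F K A m := by
  simp only [AC, Set.mem_ofPred_eq, Set.mem_union, not_or, and_assoc]
  exact and_congr_right fun h => and_congr_right fun h' => not_congr (levelAge_eq_iff_stable h h')

theorem mem_crit {F : Set (FinStr L)} {K : Str L ℕ} {A : Set ℕ} {m : ℕ} :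
    m ∈ Crit F K A ↔ m ∈ A ∨ m ∈ Sp K A ∨ ¬ Stable F K A m ∧ m ∉ A ∧ m ∉ Sp K A := by
  simp only [Crit, Set.mem_union, mem_AC]
  tauto

theorem stable_of_not_mem_crit {F : Set (FinStr L)} {K : Str L ℕ} {A : Set ℕ} {m : ℕ}
    (h : m ∉ Crit F K A) : Stable F K A m := by
  rw [mem_crit] at h
  by_contra hs
  by_cases hA : m ∈ A <;> by_cases hm : m ∈ Sp K A <;> simp_all

/-! ### Closures -/

/-- This form shows how the conditions vary with the set: splitting levels grow with it, while
stability passes to subsets. -/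
theorem closed_iff {F : Set (FinStr L)} {K : Str L ℕ} {C : Set ℕ} :
    Closed F K C ↔ Sp K C ⊆ C ∧ ∀ m ∉ C, Stable F K C m := by
  constructor
  · intro h
    constructor
    · intro m hm
      rw [← h, mem_crit]; tauto
    · intro m hm
      apply stable_of_not_mem_crit
      rwa [h]
  · rintro ⟨h1, h2⟩
    ext m
    rw [mem_crit]
    have := @h1 m
    have := h2 m
    tauto

theorem subset_cl (F : Set (FinStr L)) (K : Str L ℕ) (A : Set ℕ) : A ⊆ cl F K A :=
  fun _ ha _ hC => hC.1 ha

theorem cl_subset {F : Set (FinStr L)} {K : Str L ℕ} {A C : Set ℕ} (h : A ⊆ C)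
    (hC : Closed F K C) : cl F K A ⊆ C := fun _ ha => ha C ⟨h, hC⟩

/-- A splitting level of the intersection is one of each closed set above `A`. A level missed by the
intersection is missed by some such set, whose stability there is inherited. -/
theorem closed_cl (F : Set (FinStr L)) (K : Str L ℕ) (A : Set ℕ) : Closed F K (cl F K A) := by
  rw [closed_iff]
  constructor
  · rintro m hm C hC
    exact (closed_iff.1 hC.2).1 (Sp_mono (cl_subset hC.1 hC.2) hm)
  · intro m hm
    simp only [cl, Set.mem_sInter, not_forall] at hm
    obtain ⟨C, hC, hmC⟩ := hm
    exact ((closed_iff.1 hC.2).2 m hmC).mono (cl_subset hC.1 hC.2)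

/-- If removing any one vertex of `A` from the closure of `A` leaves a closed set, then `A` is the
interior of its closure. -/
theorem isInteriorOf_cl {F : Set (FinStr L)} {K : Str L ℕ} {A : Set ℕ}
    (h : ∀ a ∈ A, Closed F K (cl F K A \ {a})) : IsInteriorOf F K (cl F K A) A := by
  have hcl : cl F K (cl F K A) = cl F K A :=
    (cl_subset subset_rfl (closed_cl F K A)).antisymm (subset_cl F K _)
  refine ⟨⟨subset_cl F K A, hcl.symm⟩, ?_⟩
  rintro S ⟨hS, hS'⟩ a ha
  by_contra haS
  have h1 : cl F K S ⊆ cl F K A \ {a} := cl_subset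
    (fun x hx => ⟨hS hx, fun hxa => haS (by rw [← Set.mem_singleton_iff.1 hxa]; exact hx)⟩) (h a ha)
  rw [hS', hcl] at h1
  exact (h1 (subset_cl F K A ha)).2 rfl

/-! ### Ages of nodes -/

section nodeAge

variable {F : Set (FinStr L)} {K : Str L ℕ}

theorem nodeAge_cut {a m : ℕ} (h : m ≤ a) :
    nodeAge F K (cut K a m) = age F K m (fun _ : Fin 1 => cut K a m) := by
  rw [nodeAge, cut_len K h]

theorem mem_nodeAge_cut {a m n : ℕ} {B : LabStr L 1 (Fin n)} (h : m ≤ a) :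
    (⟨n, B⟩ : FinLab L 1) ∈ nodeAge F K (cut K a m) ↔
      Forb F (vglue K m (B.toStr fun _ => K.U a) fun _ => a) := by
  rw [nodeAge_cut h]
  exact mem_age_iff_forb_vglue (fun b => ⟨h, rfl, rfl⟩) rfl

theorem nodeAge_cut_anti {a m n : ℕ} (h : m ≤ n) (hn : n ≤ a) :
    nodeAge F K (cut K a n) ⊆ nodeAge F K (cut K a m) := by
  rintro ⟨l, B⟩ hB
  rw [mem_nodeAge_cut hn] at hB
  rw [mem_nodeAge_cut (h.trans hn)]
  exact hB.of_isEmb (vglue_isEmb_left h _ _)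

theorem isEmb_inr {V W : Type} (I : Str L W) (M : Str L V) (η : V → W → Fin L.k) :
    IsEmb Sum.inr M (join I M η) :=
  ⟨Sum.inr_injective, fun _ => rfl, fun _ _ => rfl⟩

theorem isEmb_inl {V W : Type} (I : Str L W) (M : Str L V) (η : V → W → Fin L.k) :
    IsEmb Sum.inl I (join I M η) :=
  ⟨Sum.inl_injective, fun _ => rfl, fun _ _ => rfl⟩

/-- A clique cannot meet both sides when no vertex of one is related to a vertex of the other. -/
theorem forb_join_of_zero (hF : Admissible F) {V W : Type} {I : Str L W} {M : Str L V}
    {η : V → W → Fin L.k} (hI : Forb F I) (hM : Forb F M) (h : ∀ b x, η b x = 0) :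
    Forb F (join I M η) := by
  refine forb_of_clique hF fun S hS => ?_
  by_cases hx : ∃ x, .inl x ∈ S
  · obtain ⟨x, hx⟩ := hx
    refine ⟨_, I, _, hI, Covers.of_isEmb (isEmb_inl I M η) ?_⟩
    rintro (y | b) hb
    · exact ⟨y, rfl⟩
    · exact absurd (h b x) (clique_inl_of_zero hS hx hb)
  · refine ⟨_, M, _, hM, Covers.of_isEmb (isEmb_inr I M η) ?_⟩
    rintro (y | b) hb
    · exact absurd ⟨y, hb⟩ hx
    · exact ⟨b, rfl⟩

theorem mem_nodeAge_left_zero {i : Fin L.ku} {n : ℕ} (hF : Admissible F) (hK : IsFraisseLimit F K)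
    {B : LabStr L 1 (Fin n)} :
    (⟨n, B⟩ : FinLab L 1) ∈ nodeAge F K (Node.left i 0) ↔ Forb F (B.toStr fun _ => i) := by
  change _ ∈ age F K 0 _ ↔ _
  rw [mem_age]
  exact ⟨fun h => h.of_isEmb (isEmb_inr _ _ _),
    fun h => forb_join_of_zero hF (forb_initial hK 0) h fun _ x => x.elim0⟩

theorem nodeAge_of_zero (hF : Admissible F) (hK : IsFraisseLimit F K) {a m : ℕ} (h : m ≤ a)
    (h0 : ∀ r < m, K.R a r = 0) :
    nodeAge F K (cut K a m) = nodeAge F K (Node.left (K.U a) 0) := by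
  ext ⟨n, B⟩
  rw [mem_nodeAge_cut h, mem_nodeAge_left_zero hF hK]
  exact ⟨fun h => h.of_isEmb (isEmb_inr _ _ _),
    fun h => forb_join_of_zero hF (forb_initial hK m) h fun _ x => h0 _ x.2⟩

theorem mem_pointGluing {i j : Fin L.ku} {q : Fin L.k} {n : ℕ} {B : LabStr L 1 (Fin n)} :
    (⟨n, B⟩ : FinLab L 1) ∈ gluingAge F (pointGluing i q j) ↔
      Forb F (join (pointGluing i q j).str (B.toStr fun _ => i) fun _ _ => q) :=
  mem_gluingAge

/-- If `i` has no free relation, then the age changes at the start of a vertex with predicate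
`i`. -/
theorem nodeAge_start_ne (hF : Admissible F) (hK : IsFraisseLimit F K) {a r : ℕ}
    (hr : IsStart K a r) (hfree : ¬ HasFree F K (K.U a)) :
    nodeAge F K (cut K a (r + 1)) ≠ nodeAge F K (Node.left (K.U a) 0) := by
  intro heq
  rw [isStart_iff] at hr
  -- The start itself would provide a free relation: the single vertex `r`, attached by `R a r`,
  -- excludes no more than the first `r + 1` vertices do, and those are assumed to exclude nothing.
  refine hfree ⟨K.R a r, K.U r, hr.2.1, Set.Subset.antisymm ?_ ?_⟩
  · rintro ⟨n, B⟩ hB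
    rw [mem_pointGluing] at hB
    rw [mem_nodeAge_left_zero hF hK]
    exact hB.of_isEmb (isEmb_inr _ _ _)
  · rintro ⟨n, B⟩ hB
    rw [← heq, mem_nodeAge_cut hr.1] at hB
    rw [mem_pointGluing]
    refine hB.of_isEmb (f := Sum.map (fun _ => Fin.last r) id) ⟨?_, ?_, ?_⟩
    · exact Function.Injective.sumMap (fun x y _ => Subsingleton.elim (α := Fin 1) x y)
        Function.injective_id
    · rintro (x | b) <;> rfl
    · rintro (x | b) (y | c)
      · exact K.R_self r
      all_goals rfl

theorem Stable.nodeAge_eq {A : Set ℕ} {a m : ℕ} (h : Stable F K A m) (ha : a ∈ A) (hm : m < a) :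
    nodeAge F K (cut K a (m + 1)) = nodeAge F K (cut K a m) := by
  refine (nodeAge_cut_anti m.le_succ hm).antisymm ?_
  rintro ⟨n, B⟩ hB
  rw [mem_nodeAge_cut hm.le] at hB
  rw [mem_nodeAge_cut hm]
  exact h _ _ _ (fun b => ⟨ha, hm, rfl⟩) hB

end nodeAge

/-! ### Coding levels -/

section diagonal

variable {F : Set (FinStr L)} {K : Str L ℕ} {ch : Choices F K} {A : Set ℕ}

theorem WeaklyDiagonal.not_mem_sp (hA : WeaklyDiagonal F K A) {m : ℕ} (hm : m ∈ A) :
    m ∉ Sp K A := fun h => by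
  have : m ∈ Sp K A ∩ A := ⟨h, hm⟩
  rw [hA.disjoint] at this
  exact this

theorem WeaklyDiagonal.cut_ne (hA : WeaklyDiagonal F K A) {m : ℕ} (hm : m ∈ A) :
    ∀ b ∈ A, m < b → cut K b m ≠ code K m := fun b hb hmb h => by
  refine hA.antichain m hm b hb hmb.ne ?_
  rw [← cut_self] at h ⊢
  exact cut_below_code K le_rfl h.symm hmb.le

/-- Removing the coding node shifts the positions from `j` on by one; the correction term of
`rk_of_coding` is exactly `j.succAbove`. -/
theorem Lists.eq_cut_of_coding (hA : WeaklyDiagonal F K A) {m a e : ℕ}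
    {s : Fin (e + 1) → Node L} {t : Fin e → Node L} (hm : m ∈ A) (hs : Lists s (level K A m))
    (ht : Lists t (level K A (m + 1))) {j : Fin (e + 1)} (hj : s j = code K m)
    (ha : a ∈ A) (hma : m < a) {α : Fin e} (hα : t α = cut K a (m + 1)) :
    s (j.succAbove α) = cut K a m := by
  obtain ⟨i, hi, hi'⟩ := hs.exists_index ha hma.le
  rw [← hi]
  congr 1
  apply Fin.ext
  rw [hi', rk_of_coding hm (hA.not_mem_sp hm) (hA.cut_ne hm) ha hma, ← hj, hs.rank_eq, rk, ← hα,
    ht.rank_eq, Fin.succAbove]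
  by_cases h : (j : ℕ) ≤ α
  · rw [if_pos h, if_neg (by simpa [Fin.lt_def] using h)]
    rfl
  · rw [if_neg h, if_pos (by simpa [Fin.lt_def] using h)]
    rfl

/-- The condition `next_eq` on controlled coding triples says that adding a vertex in position `j`,
related to the others by the passing numbers, is always allowed. The vertex `m` of `K` plays the
role of this new vertex. -/
theorem Diagonal.stable_of_mem (hA : Diagonal ch A) {m : ℕ} (hm : m ∈ A) : Stable F K A m := by
  obtain ⟨e, s, t, hs, ht, j, hj, htri⟩ := hA.coding m hm
  refine stable_of_fin fun n M f hf hforb => ?_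
  choose lab hlab _ using fun b => ht.exists_index (hf b).1 (hf b).2.1
  have hs' : ∀ b, s (j.succAbove (lab b)) = cut K (f b) m := fun b =>
    Lists.eq_cut_of_coding hA.weak hm hs ht hj (hf b).1 (hf b).2.1 (hlab b)
  have h1 : (⟨n, M.toLab lab⟩ : FinLab L e) ∈ (age F K m s).pull j.succAbove :=
    (mem_age_iff_forb_vglue (fun b => ⟨(hf b).2.1.le, hs' b, (hf b).2.2⟩) rfl).2 hforb
  rw [← htri.next_eq] at h1
  have h2 := (mem_age_iff_forb_vglue (f := Fin.lastCases m f)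
    (M := LabStr.toStr _ fun i => (s i).un) (fun b => by
      induction b using Fin.lastCases with
      | last =>
        simp only [Fin.lastCases_last, LabStr.addPoint, LabStr.toStr]
        exact ⟨le_rfl, by rw [hj, cut_self], by rw [hj]; rfl⟩
      | cast b =>
        simp only [Fin.lastCases_castSucc, LabStr.addPoint, LabStr.toStr]
        exact ⟨(hf b).2.1.le, hs' b, by rw [← cut_un K (f b) m, ← hs' b]; rfl⟩) rfl).1 h1
  have h3 : ∀ b, (t (lab b)).val m = K.R (f b) m := fun b => by
    rw [hlab, cut_val K (hf b).2.1 m.lt_succ_self]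
  have hU : ∀ b, (s (j.succAbove (lab b))).un = M.U b := fun b => by
    rw [hs', cut_un, (hf b).2.2]
  -- The last vertex `m` of the base is sent to the added point; everything else stays in place.
  refine h2.of_isEmb
    (f := Sum.elim (Fin.lastCases (.inr (Fin.last n)) fun x => .inl x) fun b => .inr b.castSucc)
    ⟨?_, ?_, ?_⟩
  · rintro (x | b) (y | c) h
    · induction x using Fin.lastCases <;> induction y using Fin.lastCases <;> simp_all
    · induction x using Fin.lastCases <;> simp_all [Fin.ext_iff]
      omega
    · induction y using Fin.lastCases <;> simp_all [Fin.ext_iff]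
      omega
    · simpa using h
  · rintro (x | b)
    · induction x using Fin.lastCases with
      | last => simp [vglue, LabStr.toStr, LabStr.addPoint, Str.toLab, hj]; rfl
      | cast x => simp [vglue]
    · simp [vglue, LabStr.toStr, LabStr.addPoint, Str.toLab, hU]
  · rintro (x | b) (y | c)
    · induction x using Fin.lastCases with
      | last =>
        induction y using Fin.lastCases with
        | last => simp [vglue, LabStr.toStr, LabStr.addPoint, K.R_self]
        | cast y => simp [vglue]
      | cast x =>
        induction y using Fin.lastCases with
        | last => simp [vglue, ← K.R_flip]
        | cast y => simp [vglue]
    · induction x using Fin.lastCases with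
      | last => simp [vglue, LabStr.toStr, LabStr.addPoint, Str.toLab, h3]
      | cast x => simp [vglue]
    · induction y using Fin.lastCases with
      | last => simp [vglue, LabStr.toStr, LabStr.addPoint, Str.toLab, h3]
      | cast y => simp [vglue]
    · simp [vglue, LabStr.toStr, LabStr.addPoint, Str.toLab]

theorem mem_or_mem_sp_or_mem_AC {m : ℕ} (hm : m ∈ Crit F K A) :
    m ∈ A ∨ m ∈ Sp K A ∨ m ∈ AC F K A := by
  rcases hm with (h | h) | h <;> simp [h]

/-! ### Start levels -/

theorem Diagonal.exists_isStart (hA : Diagonal ch A) {a : ℕ} (ha : a ∈ A) : ∃ m, IsStart K a m :=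
  hA.weak.exists_start a ha

/-- Up to its start the node has the full age of its predicate. Stability would preserve this age
across the start, contrary to `nodeAge_start_ne`. -/
theorem not_stable_start (hF : Admissible F) (hK : IsFraisseLimit F K) {a r : ℕ}
    (ha : a ∈ A) (hr : IsStart K a r) (hfree : ¬ HasFree F K (K.U a)) : ¬ Stable F K A r := by
  intro h
  have hr' := (isStart_iff K).1 hr
  refine nodeAge_start_ne hF hK hr hfree ?_
  rw [h.nodeAge_eq ha hr'.1, nodeAge_of_zero hF hK hr'.1.le hr'.2.2]

theorem start_mem_crit (hF : Admissible F) (hK : IsFraisseLimit F K) {a r : ℕ}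
    (ha : a ∈ A) (hr : IsStart K a r) (hfree : ¬ HasFree F K (K.U a)) : r ∈ Crit F K A := by
  by_contra h
  exact not_stable_start hF hK ha hr hfree (stable_of_not_mem_crit h)

/-- Coding levels are stable; starts without a free relation are not. -/
theorem Diagonal.start_not_mem (hF : Admissible F) (hK : IsFraisseLimit F K) (hA : Diagonal ch A)
    {a r : ℕ} (ha : a ∈ A) (hr : IsStart K a r) (hfree : ¬ HasFree F K (K.U a)) : r ∉ A :=
  fun h => not_stable_start hF hK ha hr hfree (hA.stable_of_mem h)

theorem path_fst {a b : ℕ} (h : path F K a = path F K b) : K.U a = K.U b :=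
  congrArg Prod.fst h

theorem ch_pathLE_refl {a : ℕ} (h : IsMaxPath F K (path F K a)) :
    ch.pathLE (path F K a) (path F K a) := by
  rcases ch.pathLE_total _ _ h h with h | h <;> exact h

/-- Two vertices of `A` with the same path start at the same level, if their predicate has a free
relation. -/
theorem Diagonal.isStart_of_path_eq (hA : Diagonal ch A) {a b m : ℕ} (ha : a ∈ A) (hb : b ∈ A)
    (hfree : HasFree F K (K.U a)) (hm : IsStart K a m) (h : path F K a = path F K b) :
    IsStart K b m := by
  obtain ⟨n, hn⟩ := hA.exists_isStart hb
  have hU := path_fst h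
  have hr := ch_pathLE_refl (ch := ch) (hA.paths.maximal a ha)
  have h1 : m ≤ n := (hA.paths.free_order a ha b hb hU hfree m n hm hn).2 (by rwa [← h])
  have h2 : n ≤ m := (hA.paths.free_order b hb a ha hU.symm (hU ▸ hfree) n m hn hm).2
    (by rwa [← h])
  rwa [le_antisymm h1 h2]

theorem Diagonal.free_start_U (hA : Diagonal ch A) {a m : ℕ} (ha : a ∈ A)
    (hfree : HasFree F K (K.U a)) (hm : IsStart K a m) : K.U m = (ch.free (K.U a)).2 :=
  ((code_eq_left K _).1 (hA.paths.free_start a ha hfree m hm).1).1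

theorem Diagonal.free_start_zero (hA : Diagonal ch A) {a m r : ℕ} (ha : a ∈ A)
    (hfree : HasFree F K (K.U a)) (hm : IsStart K a m) (hr : r < m) : K.R m r = 0 :=
  ((code_eq_left K _).1 (hA.paths.free_start a ha hfree m hm).1).2 r hr

theorem Diagonal.free_start_R (hA : Diagonal ch A) {a m : ℕ} (ha : a ∈ A)
    (hfree : HasFree F K (K.U a)) (hm : IsStart K a m) : K.R a m = (ch.free (K.U a)).1 := by
  rw [← (hA.paths.free_start a ha hfree m hm).2.1, code_val K ((isStart_iff K).1 hm).1]

/-- The vertices of `A` which are related to a free start level `m` are those starting at `m`. -/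
theorem Diagonal.path_eq_of_free_start (hA : Diagonal ch A) {a b m : ℕ} (ha : a ∈ A)
    (hfree : HasFree F K (K.U a)) (hm : IsStart K a m) (hb : b ∈ A) (hmb : m < b)
    (hR : K.R b m ≠ 0) : path F K a = path F K b := by
  by_contra h
  have := (hA.paths.free_start a ha hfree m hm).2.2 b hb hmb fun h' => h h'.symm
  rw [code_val K hmb] at this
  exact hR this

/-- A free start level is coded on the left branch, whereas every member of `A` has a start. -/
theorem Diagonal.free_start_not_mem (hA : Diagonal ch A) {m : ℕ} (hm : m ∈ FreeStart F K A) :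
    m ∉ A := by
  intro h
  obtain ⟨a, ha, hfree, hs⟩ := hm
  obtain ⟨r, hr⟩ := hA.exists_isStart h
  rw [isStart_iff] at hr
  exact hr.2.1 (hA.free_start_zero ha hfree hs hr.1)

/-- The members of `A` related to `m` all have the path of `a`, so they share its start and are
attached to `m` by the chosen free relation. Freeness says that attaching to such a point excludes
nothing. -/
theorem Diagonal.free_start_stable (hF : Admissible F) (hK : IsFraisseLimit F K)
    (hA : Diagonal ch A) {m : ℕ} (hm : m ∈ FreeStart F K A) : Stable F K A m := by
  obtain ⟨a, ha, hfree, hs⟩ := hm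
  have hst : Stable F K {b | b ∈ A ∧ K.R b m ≠ 0} m := by
    refine stable_of_fin fun n M f hf hforb => ?_
    have hpath : ∀ b, path F K a = path F K (f b) := fun b =>
      hA.path_eq_of_free_start ha hfree hs (hf b).1.1 (hf b).2.1 (hf b).1.2
    have hfs : ∀ b, IsStart K (f b) m := fun b =>
      hA.isStart_of_path_eq ha (hf b).1.1 hfree hs (hpath b)
    have hR : ∀ b, K.R (f b) m = (ch.free (K.U a)).1 := fun b => by
      rw [path_fst (hpath b)]
      exact hA.free_start_R (hf b).1.1 (path_fst (hpath b) ▸ hfree) (hfs b)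
    have h1 : (⟨n, M.toLab fun _ => 0⟩ : FinLab L 1) ∈ nodeAge F K (Node.left (K.U a) 0) := by
      rw [mem_nodeAge_left_zero hF hK]
      refine hforb.of_isEmb (f := Sum.inr) ⟨Sum.inr_injective, fun b => ?_, fun _ _ => rfl⟩
      change M.U b = K.U a
      rw [(hf b).2.2, path_fst (hpath b)]
    rw [← (ch.free_spec _ hfree).2, mem_pointGluing] at h1
    refine forb_of_clique hF fun S hS => ?_
    -- As `m` is unrelated to all smaller vertices, a clique through it contains no other vertex of
    -- the base and is covered by the one-point gluing.
    by_cases hm : .inl (Fin.last m) ∈ S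
    · refine ⟨_, _, Sum.map (fun _ => Fin.last m) id, h1, ?_, ?_, ?_⟩
      · rintro (x | b) hx
        · induction x using Fin.lastCases with
          | last => exact ⟨.inl (0 : Fin 1), rfl⟩
          | cast x =>
            have := hS _ hm _ hx (by simp [Fin.ext_iff]; omega)
            exact absurd (hA.free_start_zero ha hfree hs x.2) this
        · exact ⟨.inr b, rfl⟩
      · rintro (x | b) -
        · exact (hA.free_start_U ha hfree hs).symm
        · exact ((hf b).2.2.trans (path_fst (hpath b)).symm).symm
      · rintro (x | b) (y | c) - - hne
        · exact absurd rfl hne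
        · exact congrArg L.flip (hR c).symm
        · exact (hR b).symm
        · rfl
    · refine ⟨_, vglue K m M f, Sum.map (Fin.castLE m.le_succ) id, hforb,
        Covers.of_isEmb (vglue_isEmb_left m.le_succ M f) ?_⟩
      rintro (x | b) hx
      · induction x using Fin.lastCases with
        | last => exact absurd hx hm
        | cast x => exact ⟨.inl x, rfl⟩
      · exact ⟨.inr b, rfl⟩
  exact hst.of_nonzero hF fun x hx _ hR => ⟨hx, hR⟩

theorem Diagonal.mem_sp_of_free_start (hF : Admissible F) (hK : IsFraisseLimit F K)
    (hA : Diagonal ch A) {m : ℕ} (hm : m ∈ FreeStart F K A) (hc : m ∈ Crit F K A) :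
    m ∈ Sp K A := by
  have h1 := hA.free_start_not_mem hm
  have h2 := hA.free_start_stable hF hK hm
  rw [mem_crit] at hc
  tauto

end diagonal

section diagonal

variable {F : Set (FinStr L)} {K : Str L ℕ} {ch : Choices F K} {A : Set ℕ}

/-! ### Age-change levels -/

/-- The vertex `m` together with the smaller vertices related to it. -/
def nbhd (K : Str L ℕ) (m : ℕ) : Set ℕ := {x | x = m ∨ x < m ∧ K.R m x ≠ 0}

theorem mem_nbhd {m x : ℕ} : x ∈ nbhd K m ↔ x = m ∨ x < m ∧ K.R m x ≠ 0 := Iff.rfl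

theorem le_of_mem_nbhd {m x : ℕ} (h : x ∈ nbhd K m) : x ≤ m := by
  rcases h with h | h <;> omega

/-- The cause of the essential change underlying a consecutive change from `𝒜` to `ℬ`. -/
def essCause (ch : Choices F K) {d d₀ : ℕ} (ρ : Fin d → Fin L.ku) (𝒜 ℬ : AgeClass L d)
    (e : Fin d₀ → Fin d) : Gluing L d₀ := ch.cause (ρ ∘ e) (𝒜.pull e) (ℬ.pull e)

/-- The cause of the age change of `A` at `m` is realised by `φ`. -/
structure Realised (ch : Choices F K) (A : Set ℕ) (m : ℕ) {d d₀ : ℕ} (s t : Fin d → Node L)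
    (ρ : Fin d → Fin L.ku) (𝒜 ℬ : AgeClass L d) (e : Fin d₀ → Fin d)
    (φ : Fin (essCause ch ρ 𝒜 ℬ e).size → ℕ) : Prop where
  lists : Lists s (level K A m)
  lists_succ : Lists t (level K A (m + 1))
  sort : ρ = fun i => (s i).un
  age : 𝒜 = age F K m s
  age_succ : ℬ = DiaryEnvelope.age F K (m + 1) t
  strictMono : StrictMono e
  econ : ECon F K (ρ ∘ e) (𝒜.pull e) (ℬ.pull e)
  mono : StrictMono φ
  isEmb : IsEmb φ (essCause ch ρ 𝒜 ℬ e).str K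
  range_eq : Set.range φ = nbhd K m
  leaning : LeftLeaning K (nbhd K m)
  att : ∀ j x, (t j).val (φ x) = ((essCause ch ρ 𝒜 ℬ e).extend ρ e).att j x
  crit : ∀ x ∈ nbhd K m, ∀ c ∈ CritPlus F K A, x ≤ c → c ≤ m → c = m

/-- The cause embeds into a member of `F` and is therefore irreducible, so every vertex of its image
other than the greatest, `m`, is related to `m`. Left-leaning gives the converse, which identifies
the image with `nbhd K m`. -/
theorem Diagonal.exists_realised (hF : Admissible F) (hA : Diagonal ch A) {m : ℕ}
    (hm : m ∈ AC F K A) : ∃ (d d₀ : ℕ) (s t : Fin d → Node L) (ρ : Fin d → Fin L.ku)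
      (𝒜 ℬ : AgeClass L d) (e : Fin d₀ → Fin d) (φ : Fin (essCause ch ρ 𝒜 ℬ e).size → ℕ),
      Realised ch A m s t ρ 𝒜 ℬ e φ := by
  obtain ⟨d, s, t, hs, ht, -, γ, ⟨d₀, e, he, hec, rfl⟩, φ, hφ, hemb, hll, hmax, i, hi, hatt, -,
    hcrit⟩ := hA.ageChange m hm
  have hirr : Irreducible (ch.cause ((fun i => (s i).un) ∘ e) ((age F K m s).pull e)
      ((age F K (m + 1) t).pull e)).str := by
    obtain ⟨M, hM, f, hf⟩ := (ch.cause_mem _ _ _ hec).1.2.2.1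
    exact hf.irreducible (hF.irreducible M hM)
  have hrange : Set.range φ = nbhd K m := by
    obtain ⟨z, hz⟩ := hmax.1
    ext x
    rw [mem_nbhd]
    constructor
    · rintro ⟨y, rfl⟩
      rcases (hmax.2 ⟨y, rfl⟩).eq_or_lt with h | h
      · exact .inl h
      · refine .inr ⟨h, ?_⟩
        rw [← hz, hemb.2.2]
        refine hirr _ _ ?_
        rintro rfl
        omega
    · rintro (rfl | ⟨h, h'⟩)
      · exact hmax.1
      · exact hll m hmax.1 x h h'
  refine ⟨d, d₀, s, t, _, _, _, e, φ, hs, ht, rfl, rfl, rfl, he, hec, hφ, hemb, hrange, hrange ▸ hll,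
    hatt, ?_⟩
  intro x hx c hc hxc hcm
  rw [← hrange] at hx
  have : c ∈ CritPlus F K A ∩ Set.Icc i m := ⟨hc, (hi.2 hx).trans hxc, hcm⟩
  rw [hcrit] at this
  exact this

theorem Diagonal.nbhd_leaning (hF : Admissible F) (hA : Diagonal ch A) {m : ℕ}
    (hm : m ∈ AC F K A) : LeftLeaning K (nbhd K m) := by
  obtain ⟨d, d₀, s, t, ρ, 𝒜, ℬ, e, φ, h⟩ := hA.exists_realised hF hm
  exact h.leaning

theorem Diagonal.nbhd_critPlus (hF : Admissible F) (hA : Diagonal ch A) {m : ℕ}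
    (hm : m ∈ AC F K A) {x c : ℕ} (hx : x ∈ nbhd K m) (hc : c ∈ CritPlus F K A) (hxc : x ≤ c)
    (hcm : c ≤ m) : c = m := by
  obtain ⟨d, d₀, s, t, ρ, 𝒜, ℬ, e, φ, h⟩ := hA.exists_realised hF hm
  exact h.crit x hx c hc hxc hcm

theorem mem_AC_not_mem {m : ℕ} (hm : m ∈ AC F K A) : m ∉ A := (mem_AC.1 hm).1

theorem mem_AC_not_mem_sp {m : ℕ} (hm : m ∈ AC F K A) : m ∉ Sp K A := (mem_AC.1 hm).2.1

theorem mem_AC_crit {m : ℕ} (hm : m ∈ AC F K A) : m ∈ Crit F K A := .inr hm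

theorem mem_sp_crit {m : ℕ} (hm : m ∈ Sp K A) : m ∈ Crit F K A := .inl (.inr hm)

theorem mem_crit_of_mem {m : ℕ} (hm : m ∈ A) : m ∈ Crit F K A := .inl (.inl hm)

theorem mem_critPlus_of_crit {m : ℕ} (hm : m ∈ Crit F K A) : m ∈ CritPlus F K A := .inl hm

theorem freeStart_critPlus {m : ℕ} (hm : m ∈ FreeStart F K A) : m ∈ CritPlus F K A := by
  obtain ⟨a, ha, -, hs⟩ := hm
  exact .inr ⟨a, ha, hs⟩

/-! ### Splitting levels -/

/-- The vertex coded at a splitting level is on the left branch. -/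
theorem Diagonal.sp_left (hA : Diagonal ch A) {m r : ℕ} (hm : m ∈ Sp K A) (hr : r < m) :
    K.R m r = 0 := by
  obtain ⟨d, s, t, hs, ht, α, hα, h1, h2, h3⟩ := hA.splitting m hm
  have : ∃ i, code K m = Node.left i m := by
    by_cases hfree : HasFree F K (s α).un
    · exact ⟨_, (h1 hfree).1⟩
    · by_cases hleft : s α = Node.left (s α).un m
      · obtain ⟨-, q, j, -, -, -, h⟩ := h3 hfree hleft
        exact ⟨_, h⟩
      · obtain ⟨r, -, h, -⟩ := h2 hfree hleft
        exact ⟨_, h⟩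
  obtain ⟨i, hi⟩ := this
  exact ((code_eq_left K i).1 hi).2 r hr

theorem Diagonal.free_left (hA : Diagonal ch A) {m r : ℕ} (hm : m ∈ FreeStart F K A) (hr : r < m) :
    K.R m r = 0 := by
  obtain ⟨a, ha, hfree, hs⟩ := hm
  exact hA.free_start_zero ha hfree hs hr

/-! ### A closed set containing `A` -/

/-- The critical levels, the free start levels, and the vertices used to change ages. -/
def hull (F : Set (FinStr L)) (K : Str L ℕ) (A : Set ℕ) : Set ℕ :=
  {x | x ∈ Crit F K A ∨ x ∈ FreeStart F K A ∨ ∃ m ∈ AC F K A, x ∈ nbhd K m}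

theorem subset_hull : A ⊆ hull F K A := fun _ ha => .inl (mem_crit_of_mem ha)

theorem hull_cases {x : ℕ} (hx : x ∈ hull F K A) :
    x ∈ A ∨ (x ∈ Sp K A ∨ x ∈ FreeStart F K A) ∨ ∃ m ∈ AC F K A, x ∈ nbhd K m := by
  rcases hx with h | h | h
  · rcases mem_or_mem_sp_or_mem_AC h with h | h | h
    · exact .inl h
    · exact .inr (.inl (.inl h))
    · exact .inr (.inr ⟨x, h, .inl rfl⟩)
  · exact .inr (.inl (.inr h))
  · exact .inr (.inr h)

/-- A vertex of the hull outside `A` is only related to smaller vertices which belong to the same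
age-change level. -/
theorem Diagonal.exists_nbhd_of_ne_zero (hF : Admissible F) (hA : Diagonal ch A) {x y : ℕ}
    (hx : x ∈ hull F K A) (hxA : x ∉ A) (hyx : y < x) (hR : K.R x y ≠ 0) :
    ∃ m ∈ AC F K A, x ∈ nbhd K m ∧ y ∈ nbhd K m := by
  rcases hull_cases hx with h | (h | h) | ⟨m, hm, h⟩
  · exact absurd h hxA
  · exact absurd (hA.sp_left h hyx) hR
  · exact absurd (hA.free_left h hyx) hR
  · exact ⟨m, hm, h, hA.nbhd_leaning hF hm x h y hyx hR⟩

/-- Otherwise `x` and `y` share a neighbourhood `nbhd K m`. No critical or start level other than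
`m` lies between a member of it and `m`, so `y = m`, although `y < x ≤ m`. -/
theorem Diagonal.hull_zero_of_critPlus (hF : Admissible F) (hA : Diagonal ch A) {x y : ℕ}
    (hx : x ∈ hull F K A) (hxA : x ∉ A) (hyx : y < x) (hy : y ∈ CritPlus F K A) :
    K.R x y = 0 := by
  by_contra hR
  obtain ⟨m, hm, hxm, hym⟩ := hA.exists_nbhd_of_ne_zero hF hx hxA hyx hR
  have h1 := hA.nbhd_critPlus hF hm hym hy le_rfl (le_of_mem_nbhd hym)
  have := le_of_mem_nbhd hxm
  omega

theorem Diagonal.hull_zero_of_not_mem (hF : Admissible F) (hA : Diagonal ch A) {x y : ℕ}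
    (hx : x ∈ hull F K A) (hxA : x ∉ A) (hyx : y < x) (hy : y ∉ hull F K A) : K.R x y = 0 := by
  by_contra hR
  obtain ⟨m, hm, hxm, hym⟩ := hA.exists_nbhd_of_ne_zero hF hx hxA hyx hR
  exact hy (.inr (.inr ⟨m, hm, hym⟩))

theorem start_critPlus {a m : ℕ} (ha : a ∈ A) (h : IsStart K a m) : m ∈ CritPlus F K A :=
  .inr ⟨a, ha, h⟩

theorem start_mem_hull (hF : Admissible F) (hK : IsFraisseLimit F K) {a m : ℕ}
    (ha : a ∈ A) (h : IsStart K a m) : m ∈ hull F K A := by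
  by_cases hfree : HasFree F K (K.U a)
  · exact .inr (.inl ⟨a, ha, hfree, h⟩)
  · exact .inl (start_mem_crit hF hK ha h hfree)

/-- A vertex `b` of `A` and a vertex `x` of the hull outside `A` can only split at the start level
of `b`. -/
theorem Diagonal.isStart_of_split (hF : Admissible F) (hA : Diagonal ch A) {x b m : ℕ}
    (hx : x ∈ hull F K A) (hxA : x ∉ A) (hb : b ∈ A) (hmx : m < x) (hmb : m < b)
    (hcut : cut K x m = cut K b m) (hR : K.R b m ≠ 0) : IsStart K b m := by
  rw [isStart_iff]
  refine ⟨hmb, hR, ?_⟩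
  by_contra! hcon
  obtain ⟨r, hr, hbr⟩ := hcon
  have hag := (cut_eq_cut K hmx.le hmb.le).1 hcut
  have hxr : K.R x r ≠ 0 := by rwa [hag.2 r hr]
  obtain ⟨p, hp, hxp, hrp⟩ := hA.exists_nbhd_of_ne_zero hF hx hxA (hr.trans hmx) hxr
  have hex : ∃ q, K.R b q ≠ 0 := ⟨r, hbr⟩
  set q := Nat.find hex with hq
  have hqr : q ≤ r := Nat.find_min' hex hbr
  have hqs : IsStart K b q := (isStart_iff K).2 ⟨by omega, Nat.find_spec hex, fun u hu => by
    simpa using Nat.find_min hex hu⟩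
  -- The start `q` of `b` lies below the splitting level, so `x` is related to `q` as well.
  -- Left-leaning puts the start level `q` into `nbhd K p` strictly below `p`, which is impossible.
  have hxq : K.R x q ≠ 0 := by
    rw [hag.2 q (by omega)]
    exact Nat.find_spec hex
  have hqp : q ∈ nbhd K p := hA.nbhd_leaning hF hp x hxp q (by omega) hxq
  have h1 := hA.nbhd_critPlus hF hp hqp (start_critPlus hb hqs) le_rfl (le_of_mem_nbhd hqp)
  have := le_of_mem_nbhd hxp
  omega

/-- Members of the hull outside `A` are unrelated to a level `m` outside the hull. A splitting at
`m` therefore involves two members of `A`, making `m` critical, or one member, making `m` its start;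
both kinds of levels are in the hull. Stability at `m` is inherited from `A` by `Stable.of_nonzero`.
-/
theorem Diagonal.closed_hull (hF : Admissible F) (hK : IsFraisseLimit F K) (hA : Diagonal ch A) :
    Closed F K (hull F K A) := by
  rw [closed_iff]
  constructor
  · intro m hm
    by_contra hmh
    have key : ∀ x ∈ hull F K A, m < x → x ∉ A → K.R x m = 0 := fun x hx hmx hxA =>
      hA.hull_zero_of_not_mem hF hx hxA hmx hmh
    obtain ⟨x, hx, y, hy, hmx, hmy, hcut, hne⟩ := mem_sp.1 hm
    by_cases hxA : x ∈ A
    · by_cases hyA : y ∈ A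
      · exact hmh (.inl (mem_sp_crit (mem_sp.2 ⟨x, hxA, y, hyA, hmx, hmy, hcut, hne⟩)))
      · have h0 := key y hy hmy hyA
        exact hmh (start_mem_hull hF hK hxA
          (hA.isStart_of_split hF hy hyA hxA hmy hmx hcut.symm (by rwa [h0] at hne)))
    · have h0 := key x hx hmx hxA
      by_cases hyA : y ∈ A
      · exact hmh (start_mem_hull hF hK hyA
          (hA.isStart_of_split hF hx hxA hyA hmx hmy hcut (by rw [h0] at hne; exact hne.symm)))
      · exact hne (h0.trans (key y hy hmy hyA).symm)
  · intro m hm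
    have hst : Stable F K A m := stable_of_not_mem_crit fun h => hm (.inl h)
    refine hst.of_nonzero hF fun x hx hmx hR => ?_
    by_contra hxA
    exact hR (hA.hull_zero_of_not_mem hF hx hxA hmx hm)

theorem Diagonal.cl_subset_hull (hF : Admissible F) (hK : IsFraisseLimit F K)
    (hA : Diagonal ch A) : cl F K A ⊆ hull F K A :=
  cl_subset subset_hull (hA.closed_hull hF hK)

/-- A diagonal substructure is the interior of its closure. -/
theorem Diagonal.isInteriorOf (hF : Admissible F) (hK : IsFraisseLimit F K) (hA : Diagonal ch A) :
    IsInteriorOf F K (cl F K A) A := by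
  have hsub := hA.cl_subset_hull hF hK
  have hcl := closed_iff.1 (closed_cl F K A)
  refine isInteriorOf_cl fun a ha => closed_iff.2 ⟨?_, ?_⟩
  · intro m hm
    refine ⟨hcl.1 (Sp_mono Set.sdiff_subset hm), ?_⟩
    rintro rfl
    have key : ∀ x ∈ cl F K A, m < x → x ∉ A → K.R x m = 0 := fun x hx hmx hxA =>
      hA.hull_zero_of_critPlus hF (hsub hx) hxA hmx (mem_critPlus_of_crit (mem_crit_of_mem ha))
    -- A coding level is never a start level of `A`, so after the reduction to the start of a member
    -- of `A` no new splitting can occur at it.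
    have hno : ∀ b ∈ A, ¬ IsStart K b m := fun b hb hs => by
      by_cases hfree : HasFree F K (K.U b)
      · exact hA.free_start_not_mem ⟨b, hb, hfree, hs⟩ ha
      · exact Diagonal.start_not_mem hF hK hA hb hs hfree ha
    obtain ⟨x, ⟨hx, -⟩, y, ⟨hy, -⟩, hmx, hmy, hcut, hne⟩ := mem_sp.1 hm
    by_cases hxA : x ∈ A
    · by_cases hyA : y ∈ A
      · exact hA.weak.not_mem_sp ha (mem_sp.2 ⟨x, hxA, y, hyA, hmx, hmy, hcut, hne⟩)
      · have h0 := key y hy hmy hyA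
        exact hno x hxA
          (hA.isStart_of_split hF (hsub hy) hyA hxA hmy hmx hcut.symm (by rwa [h0] at hne))
    · have h0 := key x hx hmx hxA
      by_cases hyA : y ∈ A
      · exact hno y hyA (hA.isStart_of_split hF (hsub hx) hxA hyA hmx hmy hcut
          (by rw [h0] at hne; exact hne.symm))
      · exact hne (h0.trans (key y hy hmy hyA).symm)
  · intro m hm
    -- At the deleted vertex itself, stability comes from the coding condition on `A`; elsewhere it
    -- comes from the closure, of which this is a subset.
    by_cases hma : m = a
    · subst hma
      refine (hA.stable_of_mem ha).of_nonzero hF fun x hx hmx hR => ?_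
      by_contra hxA
      exact hR (hA.hull_zero_of_critPlus hF (hsub hx.1) hxA hmx
        (mem_critPlus_of_crit (mem_crit_of_mem ha)))
    · exact (hcl.2 m fun h => hm ⟨h, hma⟩).mono Set.sdiff_subset

end diagonal

/-! ### The vertices realising a cause belong to the closure -/

/-- The restriction of a gluing along a map into its underlying set. -/
def Gluing.restrict {d k : ℕ} (ζ : Gluing L d) (g : Fin k → Fin ζ.size) : Gluing L d where
  sort := ζ.sort
  size := k
  att i x := ζ.att i (g x)
  str := ζ.str.pullback g

theorem Gluing.isEmb_restrict {d k : ℕ} (ζ : Gluing L d) {g : Fin k → Fin ζ.size}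
    (hg : Function.Injective g) : IsEmb g (ζ.restrict g).str ζ.str :=
  ⟨hg, fun _ => rfl, fun _ _ => rfl⟩

theorem gluingAge_subset_restrict {F : Set (FinStr L)} {d k : ℕ} (ζ : Gluing L d)
    {g : Fin k → Fin ζ.size} (hg : Function.Injective g) :
    gluingAge F ζ ⊆ gluingAge F (ζ.restrict g) := by
  rintro ⟨n, B⟩ hB
  rw [mem_gluingAge] at hB ⊢
  refine hB.of_isEmb (f := Sum.map g id) ⟨hg.sumMap Function.injective_id, ?_, ?_⟩
  · rintro (x | b) <;> rfl
  · rintro (x | b) (y | c) <;> rfl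

theorem Spec.restrict {F : Set (FinStr L)} {d k : ℕ} {ρ : Fin d → Fin L.ku} {A : AgeClass L d}
    {ζ : Gluing L d} (hζ : ζ ∈ Spec F ρ A) {g : Fin k → Fin ζ.size} (hg : Function.Injective g) :
    ζ.restrict g ∈ Spec F ρ A := by
  obtain ⟨h1, h2, ⟨M, hM, f, hf⟩, h4⟩ := hζ
  exact ⟨h1, h2.of_isEmb (ζ.isEmb_restrict hg), ⟨M, hM, f ∘ g, hf.comp (ζ.isEmb_restrict hg)⟩,
    h4.trans (gluingAge_subset_restrict ζ hg)⟩

section diagonal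

variable {F : Set (FinStr L)} {K : Str L ℕ} {ch : Choices F K} {A : Set ℕ}

theorem Realised.vertex {m d d₀ : ℕ} {s t : Fin d → Node L} {ρ : Fin d → Fin L.ku}
    {𝒜 ℬ : AgeClass L d} {e : Fin d₀ → Fin d} {φ : Fin (essCause ch ρ 𝒜 ℬ e).size → ℕ}
    (h : Realised ch A m s t ρ 𝒜 ℬ e φ) (hm : m ∈ AC F K A) (j : Fin d) :
    ∃ a ∈ A, m < a ∧ s j = cut K a m ∧ t j = cut K a (m + 1) :=
  h.lists.exists_vertex_of_noncritical (mem_AC_not_mem hm) (mem_AC_not_mem_sp hm) h.lists_succ j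

theorem Realised.le {m d d₀ : ℕ} {s t : Fin d → Node L} {ρ : Fin d → Fin L.ku}
    {𝒜 ℬ : AgeClass L d} {e : Fin d₀ → Fin d} {φ : Fin (essCause ch ρ 𝒜 ℬ e).size → ℕ}
    (h : Realised ch A m s t ρ 𝒜 ℬ e φ) (x) : φ x ≤ m :=
  le_of_mem_nbhd (h.range_eq.subset ⟨x, rfl⟩)

/-- If a gluing `ζ` realised in `K` by `φ` detects a structure which no proper restriction of `ζ`
detects, then the image of `φ` is contained in the closure. -/
theorem mem_cl_of_critical_gluing (hF : Admissible F) {d n m : ℕ} {ζ : Gluing L d}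
    {D : LabStr L d (Fin n)} {a : Fin d → ℕ} {φ : Fin ζ.size → ℕ} (ha : ∀ i, a i ∈ A)
    (hma : ∀ i, m < a i) (hsort : ∀ i, ζ.sort i = K.U (a i)) (hmono : StrictMono φ)
    (hemb : IsEmb φ ζ.str K) (hle : ∀ x, φ x ≤ m) (hll : LeftLeaning K (Set.range φ))
    (hatt : ∀ i x, K.R (a i) (φ x) = ζ.att i x)
    (hD : Forb F (vglue K m (D.toStr ζ.sort) fun b => a (D.lab b)))
    (hN : ¬ Forb F (join ζ.str (D.toStr ζ.sort) fun b x => ζ.att (D.lab b) x))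
    (hmin : ∀ (k : ℕ) (g : Fin k → Fin ζ.size), Function.Injective g → k < ζ.size →
      (⟨n, D⟩ : FinLab L d) ∈ gluingAge F (ζ.restrict g)) (y : Fin ζ.size) :
    φ y ∈ cl F K A := by
  -- Induction downwards: the images of all larger vertices of `ζ` are already known to be in the
  -- closure.
  induction y using WellFoundedGT.induction with
  | ind y ih =>
  by_contra hy
  have hst := (closed_iff.1 (closed_cl F K A)).2 _ hy
  let J := join ζ.str (D.toStr ζ.sort) fun b x => ζ.att (D.lab b) x
  -- The part of `ζ` above `y` is moved to the attached side. Its images lie in the closure, so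
  -- stability of the closure at `φ y` applies to it together with `D`.
  let V := {z : Fin ζ.size // y < z} ⊕ Fin n
  let f : V → ℕ := Sum.elim (fun z => φ z) fun b => a (D.lab b)
  let M : Str L V := J.pullback (Sum.map (↑) id)
  have h1 : Forb F (vglue K (φ y) M f) := by
    refine forb_of_clique hF fun S hS => ?_
    -- If the clique contains some `z` above `y`, then its base vertices are related to `φ z` and
    -- hence in the image of `φ`, so the clique is covered by `ζ` without `y`, which does not
    -- exclude `D`. If not, it lives in the structure of `hD`.
    by_cases hz : ∃ z, .inr (.inl z) ∈ S
    · obtain ⟨z, hz⟩ := hz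
      have hcard : (Finset.univ.erase y).card = ζ.size - 1 := by
        rw [Finset.card_erase_of_mem (Finset.mem_univ _), Finset.card_univ, Fintype.card_fin]
      let g : Fin (ζ.size - 1) → Fin ζ.size := (Finset.univ.erase y).orderEmbOfFin hcard
      have hg : Function.Injective g := ((Finset.univ.erase y).orderEmbOfFin hcard).injective
      have hgy : ∀ x, g x ≠ y := fun x =>
        (Finset.mem_erase.1 ((Finset.univ.erase y).orderEmbOfFin_mem hcard x)).1
      have hgr : ∀ z, z ≠ y → ∃ x, g x = z := fun z hz => by
        have : z ∈ Set.range g := by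
          rw [Finset.range_orderEmbOfFin]
          simpa using hz
        exact this
      have h2 := hmin _ g hg (by have := y.2; omega)
      rw [mem_gluingAge] at h2
      have key : ∀ x, ¬ g x < y → y < g x := fun x hx =>
        lt_of_le_of_ne (not_lt.1 hx) (hgy x).symm
      refine ⟨_, _, Sum.elim
        (fun x => if hx : g x < y then .inl ⟨φ (g x), hmono hx⟩ else .inr (.inl ⟨g x, key x hx⟩))
        fun b => .inr (.inr b), h2, ?_, ?_, ?_⟩
      · rintro (w | z' | b) hw
        · have h3 := hS _ hz _ hw (by simp)
          have h4 : (w : ℕ) ∈ Set.range φ :=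
            hll (φ z) ⟨z, rfl⟩ w (w.2.trans (hmono z.2)) h3
          obtain ⟨z', hz'⟩ := h4
          have h5 : z' < y := hmono.lt_iff_lt.1 (by rw [hz']; exact w.2)
          obtain ⟨x, rfl⟩ := hgr z' h5.ne
          exact ⟨.inl x, by simp [h5, hz']⟩
        · obtain ⟨x, hx⟩ := hgr z' z'.2.ne'
          exact ⟨.inl x, by simp [hx, z'.2.le]⟩
        · exact ⟨.inr b, rfl⟩
      · rintro (x | b) -
        · by_cases hx : g x < y
          · simp only [Sum.elim_inl, dif_pos hx]
            exact (hemb.2.1 _).symm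
          · simp only [Sum.elim_inl, dif_neg hx]
            rfl
        · rfl
      · rintro (x | b) (x' | b') - - -
        · by_cases hx : g x < y <;> by_cases hx' : g x' < y <;>
            simp only [Sum.elim_inl, dif_pos, dif_neg, hx, hx', not_false_eq_true]
          · exact (hemb.2.2 _ _).symm
          · exact (hemb.2.2 (g x) (g x')).symm.trans (K.R_flip _ _)
          · exact (hemb.2.2 (g x) (g x')).symm
          · rfl
        · by_cases hx : g x < y <;>
            simp only [Sum.elim_inl, Sum.elim_inr, dif_pos, dif_neg, hx, not_false_eq_true]
          · exact congrArg L.flip (hatt (D.lab b') (g x)).symm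
          · rfl
        · by_cases hx : g x' < y <;>
            simp only [Sum.elim_inl, Sum.elim_inr, dif_pos, dif_neg, hx, not_false_eq_true]
          · exact (hatt (D.lab b) (g x')).symm
          · rfl
        · rfl
    · refine ⟨_, vglue K (φ y) (D.toStr ζ.sort) fun b => a (D.lab b), Sum.map id Sum.inr,
        hD.of_isEmb (vglue_isEmb_left (hle y) _ _), Covers.of_isEmb
          (vglue_isEmb_right M f (g := Sum.inr) Sum.inr_injective) ?_⟩
      rintro (w | z | b) hw
      · exact ⟨.inl w, rfl⟩
      · exact absurd ⟨z, hw⟩ hz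
      · exact ⟨.inr b, rfl⟩
  have h2 := hst V M f (by
    rintro (z | b)
    · exact ⟨ih z z.2, hmono z.2, (hemb.2.1 _).symm⟩
    · exact ⟨subset_cl F K A (ha _), (hle y).trans_lt (hma _), hsort _⟩) h1
  have hlt : ∀ z, ¬ y < z → φ z < φ y + 1 := fun z hz =>
    Nat.lt_succ_of_le (hmono.monotone (not_lt.1 hz))
  -- With `φ y` added to the base, all of `ζ` is present again: vertices up to `y` in the base, the
  -- others attached.
  refine hN (h2.of_isEmb (f := Sum.elim
    (fun z => if hz : y < z then .inr (.inl ⟨z, hz⟩) else .inl ⟨φ z, hlt z hz⟩)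
    fun b => .inr (.inr b)) ⟨?_, ?_, ?_⟩)
  · rintro (z | b) (z' | b') hzz
    · by_cases hz : y < z <;> by_cases hz' : y < z' <;>
        simp only [Sum.elim_inl, dif_pos, dif_neg, hz, hz', not_false_eq_true] at hzz
      · exact congrArg (fun z => Sum.inl (Subtype.val z)) (Sum.inl_injective (Sum.inr_injective hzz))
      · simp at hzz
      · simp at hzz
      · simpa [hmono.injective.eq_iff] using hzz
    · by_cases hz : y < z <;> simp [hz] at hzz
    · by_cases hz' : y < z' <;> simp [hz'] at hzz
    · exact congrArg Sum.inr (Sum.inr_injective (Sum.inr_injective hzz))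
  · rintro (z | b)
    · by_cases hz : y < z <;> simp only [Sum.elim_inl, dif_pos, dif_neg, hz, not_false_eq_true]
      · rfl
      · exact hemb.2.1 _
    · rfl
  · rintro (z | b) (z' | b')
    · by_cases hz : y < z <;> by_cases hz' : y < z' <;>
        simp only [Sum.elim_inl, dif_pos, dif_neg, hz, hz', not_false_eq_true]
      · rfl
      · exact hemb.2.2 _ _
      · exact (K.R_flip _ _).symm.trans (hemb.2.2 z z')
      · exact hemb.2.2 _ _
    · by_cases hz : y < z <;>
        simp only [Sum.elim_inl, Sum.elim_inr, dif_pos, dif_neg, hz, not_false_eq_true]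
      · rfl
      · exact congrArg L.flip (hatt (D.lab b') z)
    · by_cases hz : y < z' <;>
        simp only [Sum.elim_inl, Sum.elim_inr, dif_pos, dif_neg, hz, not_false_eq_true]
      · rfl
      · exact hatt (D.lab b) z'
    · rfl

theorem Realised.att_eq {m d d₀ : ℕ} {s t : Fin d → Node L}
    {ρ : Fin d → Fin L.ku} {𝒜 ℬ : AgeClass L d} {e : Fin d₀ → Fin d}
    {φ : Fin (essCause ch ρ 𝒜 ℬ e).size → ℕ} (h : Realised ch A m s t ρ 𝒜 ℬ e φ) (i : Fin d₀) (x) :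
    (t (e i)).val (φ x) = (essCause ch ρ 𝒜 ℬ e).att i x := by
  rw [h.att]
  exact h.strictMono.injective.extend_apply (fun i₀ => (essCause ch ρ 𝒜 ℬ e).att i₀ x)
    (fun _ => 0) i

/-- Choose `D` in the old age that is excluded by the cause. A proper restriction of the cause still
belongs to the spectrum of the new age; by minimality of size it belongs to that of the old one too,
so it does not exclude `D`. -/
theorem Realised.mem_cl (hF : Admissible F) {m d d₀ : ℕ} {s t : Fin d → Node L}
    {ρ : Fin d → Fin L.ku} {𝒜 ℬ : AgeClass L d} {e : Fin d₀ → Fin d}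
    {φ : Fin (essCause ch ρ 𝒜 ℬ e).size → ℕ}
    (h : Realised ch A m s t ρ 𝒜 ℬ e φ) (hm : m ∈ AC F K A) (y) : φ y ∈ cl F K A := by
  choose a ha hma hsa hta using h.vertex hm
  obtain ⟨hζB, hζA⟩ := ch.cause_mem _ _ _ h.econ
  have hnot : ¬ 𝒜.pull e ⊆ gluingAge F (essCause ch ρ 𝒜 ℬ e) := fun hsub =>
    hζA ⟨hζB.1, hζB.2.1, hζB.2.2.1, hsub⟩
  obtain ⟨⟨n, D⟩, hD, hDn⟩ := Set.not_subset.1 hnot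
  have hsort : ∀ i, (essCause ch ρ 𝒜 ℬ e).sort i = K.U (a (e i)) := fun i => by
    rw [show (essCause ch ρ 𝒜 ℬ e).sort = ρ ∘ e from hζB.1, h.sort]
    exact congrArg Node.un (hsa _)
  refine mem_cl_of_critical_gluing hF (D := D) (fun i => ha (e i)) (fun i => hma (e i)) hsort
    h.mono h.isEmb h.le (h.range_eq ▸ h.leaning) ?_ ?_ ?_ ?_ y
  · intro i x
    rw [← h.att_eq, hta, cut_val K (hma _) (Nat.lt_succ_of_le (h.le x))]
  · rw [h.age] at hD
    exact (mem_age_iff_forb_vglue (fun b => ⟨(hma _).le, hsa _, hsort _⟩) rfl).1 hD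
  · rwa [mem_gluingAge] at hDn
  · intro k g hg hk
    have h1 := Spec.restrict hζB hg
    have h2 : (essCause ch ρ 𝒜 ℬ e).restrict g ∈ Spec F (ρ ∘ e) (𝒜.pull e) := by
      by_contra hcon
      exact absurd (ch.cause_min _ _ _ h.econ _ ⟨h1, hcon⟩) (not_le.2 hk)
    exact h2.2.2.2 hD

theorem Diagonal.nbhd_subset_cl (hF : Admissible F) (hA : Diagonal ch A) {m : ℕ}
    (hm : m ∈ AC F K A) : nbhd K m ⊆ cl F K A := by
  obtain ⟨d, d₀, s, t, ρ, 𝒜, ℬ, e, φ, h⟩ := hA.exists_realised hF hm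
  rw [← h.range_eq]
  rintro _ ⟨y, rfl⟩
  exact h.mem_cl hF hm y

/-- A level missed by the closure is stable for it, hence for `A`. -/
theorem crit_subset_cl : Crit F K A ⊆ cl F K A := by
  intro m hm
  have hcl := closed_iff.1 (closed_cl F K A)
  rw [mem_crit] at hm
  rcases hm with h | h | ⟨h, -⟩
  · exact subset_cl F K A h
  · exact hcl.1 (Sp_mono (subset_cl F K A) h)
  · by_contra hm
    exact h ((hcl.2 m hm).mono (subset_cl F K A))

/-! ### The cause is determined by the ages -/

/-- The age of the next level is the set of members of the old age which respect the cause. -/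
theorem Realised.age_succ_eq (hF : Admissible F) {m d d₀ : ℕ}
    {s t : Fin d → Node L} {ρ : Fin d → Fin L.ku} {𝒜 ℬ : AgeClass L d} {e : Fin d₀ → Fin d}
    {φ : Fin (essCause ch ρ 𝒜 ℬ e).size → ℕ} (h : Realised ch A m s t ρ 𝒜 ℬ e φ)
    (hm : m ∈ AC F K A) : ℬ = 𝒜 ∩ gluingAge F ((essCause ch ρ 𝒜 ℬ e).extend ρ e) := by
  choose a ha hma hsa hta using h.vertex hm
  have hsort : ∀ i, ρ i = K.U (a i) := fun i => by
    rw [h.sort]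
    exact congrArg Node.un (hsa _)
  have hatt : ∀ i x, K.R (a i) (φ x) = ((essCause ch ρ 𝒜 ℬ e).extend ρ e).att i x := fun i x => by
    rw [← h.att, hta, cut_val K (hma _) (Nat.lt_succ_of_le (h.le x))]
  ext ⟨n, B⟩
  rw [Set.mem_inter_iff, mem_gluingAge]
  have e1 : (⟨n, B⟩ : FinLab L d) ∈ 𝒜 ↔ Forb F (vglue K m (B.toStr ρ) fun b => a (B.lab b)) := by
    nth_rewrite 1 [h.age]
    exact mem_age_iff_forb_vglue (fun b => ⟨(hma _).le, hsa _, hsort _⟩) rfl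
  have e2 : (⟨n, B⟩ : FinLab L d) ∈ ℬ ↔
      Forb F (vglue K (m + 1) (B.toStr ρ) fun b => a (B.lab b)) := by
    nth_rewrite 1 [h.age_succ]
    exact mem_age_iff_forb_vglue (fun b => ⟨hma _, hta _, hsort _⟩) rfl
  rw [e1, e2]
  have hlt : ∀ x, φ x < m + 1 := fun x => Nat.lt_succ_of_le (h.le x)
  have hγ : IsEmb (Sum.map (fun x => ⟨φ x, hlt x⟩) id)
      (join ((essCause ch ρ 𝒜 ℬ e).extend ρ e).str (B.toStr ρ)
        fun b x => ((essCause ch ρ 𝒜 ℬ e).extend ρ e).att (B.lab b) x)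
      (vglue K (m + 1) (B.toStr ρ) fun b => a (B.lab b)) := by
    refine ⟨Function.Injective.sumMap (fun x y hxy => h.mono.injective (congrArg Fin.val hxy))
      Function.injective_id, ?_, ?_⟩
    · rintro (x | b)
      · exact h.isEmb.2.1 x
      · rfl
    · rintro (x | b) (y | c)
      · exact h.isEmb.2.2 x y
      · exact congrArg L.flip (hatt _ _)
      · exact hatt _ _
      · rfl
  constructor
  · intro hB
    exact ⟨hB.of_isEmb (vglue_isEmb_left m.le_succ _ _), hB.of_isEmb hγ⟩
  · rintro ⟨h1, h2⟩
    refine forb_of_clique hF fun S hS => ?_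
    -- A clique through `m` meets the base only in `nbhd K m`, the image of the cause; any other
    -- clique lies over the first `m` vertices.
    by_cases hlast : .inl (Fin.last m) ∈ S
    · by_cases hout : ∃ x : Fin (m + 1), .inl x ∈ S ∧ (x : ℕ) ∉ nbhd K m
      · obtain ⟨x, hx, hxn⟩ := hout
        exfalso
        have hxm : (x : ℕ) ≠ m := fun hxm => hxn (.inl hxm)
        have := hS _ hlast _ hx (fun heq => hxm (by
          have := Sum.inl_injective heq
          rw [← this]
          rfl))
        exact hxn (.inr ⟨by omega, this⟩)
      · refine ⟨_, _, _, h2, Covers.of_isEmb hγ ?_⟩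
        rintro (x | b) hx
        · have : (x : ℕ) ∈ nbhd K m := by
            by_contra hcon
            exact hout ⟨x, hx, hcon⟩
          rw [← h.range_eq] at this
          obtain ⟨z, hz⟩ := this
          exact ⟨.inl z, congrArg Sum.inl (Fin.ext hz)⟩
        · exact ⟨.inr b, rfl⟩
    · refine ⟨_, _, Sum.map (Fin.castLE m.le_succ) id, h1,
        Covers.of_isEmb (vglue_isEmb_left m.le_succ _ _) ?_⟩
      rintro (x | b) hx
      · induction x using Fin.lastCases with
        | last => exact absurd hx hlast
        | cast x => exact ⟨.inl x, rfl⟩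
      · exact ⟨.inr b, rfl⟩

/-- An essential change carried by the labels in the range of `e'` cannot be caused by a gluing
which does not attach all of these labels. -/
theorem range_subset_of_econ (hF : Admissible F) {d d₀ d₁ : ℕ} {ρ : Fin d → Fin L.ku}
    {𝒜 ℬ : AgeClass L d} {ζ : Gluing L d₀} {e : Fin d₀ → Fin d} {e' : Fin d₁ → Fin d}
    (hec : ECon F K (ρ ∘ e') (𝒜.pull e') (ℬ.pull e'))
    (h𝒜 : ∃ m, ∃ s : Fin d → Node L, 𝒜 = age F K m s ∧ ρ = fun i => (s i).un)
    (hB : ℬ = 𝒜 ∩ gluingAge F (ζ.extend ρ e)) : Set.range e' ⊆ Set.range e := by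
  by_contra hnot
  obtain ⟨_, ⟨i, rfl⟩, hi⟩ := Set.not_subset.1 hnot
  -- Strictness of the change along `e'` is refuted: every member of the old class is shown to lie
  -- in the new one.
  refine hec.1.2.2.1.2 ?_
  rintro ⟨n, D⟩ hD
  change _ ∈ ℬ
  rw [hB]
  refine ⟨hD, ?_⟩
  rw [mem_gluingAge]
  obtain ⟨m, s, rfl, rfl⟩ := h𝒜
  have hD' := mem_age.1 hD
  refine forb_of_clique hF fun S hS => ?_
  by_cases hx : ∃ x, .inl x ∈ S
  · obtain ⟨x, hx⟩ := hx
    have hlab : ∀ b, .inr b ∈ S → e' (D.lab b) ∈ Set.range e := fun b hb => by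
      by_contra hcon
      refine clique_inl_of_zero hS hx hb ?_
      exact Function.extend_apply' (fun i₀ => ζ.att i₀ x) (fun _ => 0) _ hcon
    -- A clique meeting the cause contains only vertices with labels in the range of `e`. The part
    -- of `D` with these labels omits the label `i`, so by essentialness of the change it belongs to
    -- both classes, and it covers the clique.
    let X : Finset (Fin d₁) := Finset.univ.filter fun l => e' l ∈ Set.range e
    let T : Finset (Fin n) := Finset.univ.filter fun b => e' (D.lab b) ∈ Set.range e
    have hX : X.card < d₁ := by
      have : X ⊂ Finset.univ := by
        rw [Finset.ssubset_univ_iff]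
        intro hcon
        have : i ∈ X := hcon ▸ Finset.mem_univ i
        exact hi (Finset.mem_filter.1 this).2
      simpa using Finset.card_lt_card this
    let u := X.orderEmbOfFin rfl
    let v := T.orderEmbOfFin rfl
    have hlab' : ∀ b, ∃ l, u l = D.lab (v b) := fun b => by
      have h1 := (Finset.mem_filter.1 (T.orderEmbOfFin_mem rfl b)).2
      have h2 : D.lab (v b) ∈ Set.range u := by
        rw [Finset.range_orderEmbOfFin]
        simpa [X] using h1
      exact h2
    choose l hl using hlab'
    let D' : LabStr L X.card (Fin T.card) :=
      { lab := l
        R := fun b c => D.R (v b) (v c)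
        R_self := fun b => D.R_self _
        R_flip := fun b c => D.R_flip _ _ }
    have h1 : (⟨T.card, D'⟩ : FinLab L X.card) ∈ ((age F K m s).pull e').pull u := by
      refine mem_age.2 (hD'.of_isEmb (f := Sum.map id v)
        ⟨Function.injective_id.sumMap v.injective, ?_, ?_⟩)
      · rintro (x | b)
        · rfl
        · exact congrArg (fun l => (s (e' l)).un) (hl b).symm
      · rintro (x | b) (y | c)
        · rfl
        · exact congrArg (fun l => L.flip ((s (e' l)).val x)) (hl c).symm
        · exact congrArg (fun l => (s (e' l)).val y) (hl b).symm
        · rfl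
    rw [hec.2 _ u u.strictMono hX] at h1
    have h2 : (⟨T.card, (D'.relabel u).relabel e'⟩ : FinLab L d) ∈ ℬ := h1
    rw [hB] at h2
    refine ⟨_, _, Sum.map id v, mem_gluingAge.1 h2.2, ?_, ?_, ?_⟩
    · rintro (x | b) hb
      · exact ⟨.inl x, rfl⟩
      · have h3 : b ∈ Set.range v := by
          rw [Finset.range_orderEmbOfFin]
          simpa [T] using hlab b hb
        obtain ⟨c, rfl⟩ := h3
        exact ⟨.inr c, rfl⟩
    · rintro (x | b) -
      · rfl
      · exact congrArg (fun l => (s (e' l)).un) (hl b)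
    · rintro (x | b) (y | c) - - -
      · rfl
      · exact congrArg (fun l => L.flip ((ζ.extend (fun i => (s i).un) e).att (e' l) x)) (hl c)
      · exact congrArg (fun l => (ζ.extend (fun i => (s i).un) e).att (e' l) y) (hl b)
      · rfl
  · refine ⟨_, _, Sum.inr, hD'.of_isEmb (isEmb_inr _ _ _),
      Covers.of_isEmb (isEmb_inr _ _ _) ?_⟩
    rintro (x | b) hb
    · exact absurd ⟨x, hb⟩ hx
    · exact ⟨b, rfl⟩

theorem strictMono_eq_of_range {n n' : ℕ} {α : Type*} [LinearOrder α] {f : Fin n → α}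
    {g : Fin n' → α} (hf : StrictMono f) (hg : StrictMono g) (h : Set.range f = Set.range g) :
    ∃ hn : n = n', f = g ∘ Fin.cast hn := by
  have h1 : n = n' := by
    have e1 := Set.ncard_univ (Fin n)
    have e2 := Set.ncard_univ (Fin n')
    rw [← Set.ncard_image_of_injective _ hf.injective, Set.image_univ] at e1
    rw [← Set.ncard_image_of_injective _ hg.injective, Set.image_univ, ← h, e1] at e2
    simpa using e2
  subst h1
  exact ⟨rfl, (hf.range_inj hg).1 h⟩

/-- The cause of an age change depends on the two ages only. -/
theorem Realised.unique (hF : Admissible F) {B : Set ℕ}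
    {m μ d d₀ d₁ : ℕ} {s t s' t' : Fin d → Node L} {ρ : Fin d → Fin L.ku} {𝒜 ℬ : AgeClass L d}
    {e : Fin d₀ → Fin d} {e' : Fin d₁ → Fin d} {φ : Fin (essCause ch ρ 𝒜 ℬ e).size → ℕ}
    {φ' : Fin (essCause ch ρ 𝒜 ℬ e').size → ℕ} (h : Realised ch A m s t ρ 𝒜 ℬ e φ)
    (hm : m ∈ AC F K A) (h' : Realised ch B μ s' t' ρ 𝒜 ℬ e' φ') (hμ : μ ∈ AC F K B) :
    ∃ hd : d₀ = d₁, e = e' ∘ Fin.cast hd := by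
  refine strictMono_eq_of_range h.strictMono h'.strictMono (Set.Subset.antisymm ?_ ?_)
  · exact range_subset_of_econ hF h.econ ⟨m, s, h.age, h.sort⟩
      (h'.age_succ_eq hF hμ)
  · exact range_subset_of_econ hF h'.econ ⟨m, s, h.age, h.sort⟩
      (h.age_succ_eq hF hm)

end diagonal

section diagonal

variable {F : Set (FinStr L)} {K : Str L ℕ} {ch : Choices F K} {A B : Set ℕ}

/-! ### Splitting levels and ranks -/

theorem spNode_cut {m a b : ℕ} (ha : a ∈ A) (hb : b ∈ A) (hma : m < a) (hmb : m < b)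
    (h : cut K a m = cut K b m) (hne : K.R a m ≠ K.R b m) : cut K a m ∈ SpNode K A :=
  mem_spNode.2 ⟨a, ha, b, hb, m, hma, hmb, h, hne, rfl⟩

theorem WeaklyDiagonal.spNode_unique (hA : WeaklyDiagonal F K A) {s s' : Node L}
    (hs : s ∈ SpNode K A) (hs' : s' ∈ SpNode K A) (h : s.len = s'.len) : s = s' :=
  (hA.unique_split _ ⟨s, hs, rfl⟩).unique ⟨hs, rfl⟩ ⟨hs', h.symm⟩

theorem WeaklyDiagonal.exists_zero (hA : WeaklyDiagonal F K A) {m a : ℕ} (hm : m ∈ Sp K A)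
    (ha : a ∈ A) (hma : m < a) : ∃ b ∈ A, m < b ∧ cut K b m = cut K a m ∧ K.R b m = 0 := by
  obtain ⟨b, hb, hmb, h⟩ := mem_level.1 (hA.succ_zero m hm _ (cut_mem_level ha hma.le))
  rw [cut_succ K hmb, Node.succ_inj] at h
  exact ⟨b, hb, hmb, h.1.symm, h.2.symm⟩

/-- Only the splitting node has a non-zero successor. -/
theorem WeaklyDiagonal.cut_eq_of_ne_zero (hA : WeaklyDiagonal F K A) {s : Node L}
    (hs : s ∈ SpNode K A) {a : ℕ} (ha : a ∈ A) (hma : s.len < a) (hR : K.R a s.len ≠ 0) :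
    cut K a s.len = s := by
  obtain ⟨b, hb, hmb, h, h0⟩ := hA.exists_zero ⟨s, hs, rfl⟩ ha hma
  refine hA.spNode_unique (spNode_cut ha hb hma hmb h.symm ?_) hs (cut_len K hma.le)
  rwa [h0]

/-- The splitting node has exactly two successors and one of them is in direction `0`, so there is a
single nonzero direction. -/
theorem WeaklyDiagonal.R_eq_of_ne_zero (hA : WeaklyDiagonal F K A) {s : Node L}
    (hs : s ∈ SpNode K A) {a b : ℕ} (ha : a ∈ A) (hb : b ∈ A) (hma : s.len < a) (hmb : s.len < b)
    (hRa : K.R a s.len ≠ 0) (hRb : K.R b s.len ≠ 0) : K.R a s.len = K.R b s.len := by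
  obtain ⟨c, hc, hmc, h, h0⟩ := hA.exists_zero ⟨s, hs, rfl⟩ ha hma
  have hca := hA.cut_eq_of_ne_zero hs ha hma hRa
  have hcb := hA.cut_eq_of_ne_zero hs hb hmb hRb
  have hmem : ∀ x ∈ A, s.len < x → cut K x s.len = s →
      cut K x (s.len + 1) ∈ {t | t ∈ level K A (s.len + 1) ∧ s.Below t} := fun x hx hmx hxs => by
    refine ⟨cut_mem_level hx hmx, ?_⟩
    rw [cut_succ K hmx, hxs]
    exact ⟨rfl, List.prefix_append _ _⟩
  have h1 := hmem a ha hma hca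
  have h2 := hmem b hb hmb hcb
  have h3 := hmem c hc hmc (h.trans hca)
  obtain ⟨x, y, -, hxy⟩ := Set.ncard_eq_two.1 (hA.two_succ s hs)
  rw [hxy] at h1 h2 h3
  by_contra hne
  have hab : cut K a (s.len + 1) ≠ cut K b (s.len + 1) := fun h =>
    hne ((cut_succ_inj hma hmb).1 h).2
  have hac : cut K a (s.len + 1) ≠ cut K c (s.len + 1) := fun h =>
    hRa (((cut_succ_inj hma hmc).1 h).2.trans h0)
  have hbc : cut K b (s.len + 1) ≠ cut K c (s.len + 1) := fun h =>
    hRb (((cut_succ_inj hmb hmc).1 h).2.trans h0)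
  simp only [Set.mem_insert_iff, Set.mem_singleton_iff] at h1 h2 h3
  rcases h1 with h1 | h1 <;> rcases h2 with h2 | h2 <;> rcases h3 with h3 | h3 <;> simp_all

theorem exists_ne_zero_of_spNode {s : Node L} (hs : s ∈ SpNode K A) :
    ∃ a ∈ A, s.len < a ∧ cut K a s.len = s ∧ K.R a s.len ≠ 0 := by
  obtain ⟨a, ha, b, hb, m, hma, hmb, h, hne, rfl⟩ := mem_spNode.1 hs
  rw [cut_len K hma.le]
  by_cases h0 : K.R a m = 0
  · exact ⟨b, hb, hmb, h.symm, fun h' => hne (h0.trans h'.symm)⟩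
  · exact ⟨a, ha, hma, rfl, h0⟩

theorem Node.succ_injective (q : Fin L.k) : Function.Injective fun s : Node L => s.succ q :=
  fun _ _ h => (Node.succ_inj.1 h).1

/-- At a splitting level, one node is inserted. -/
theorem WeaklyDiagonal.rk_succ_of_sp (hA : WeaklyDiagonal F K A) {s : Node L}
    (hs : s ∈ SpNode K A) {m : ℕ} (hm : s.len = m) {a : ℕ} (ha : a ∈ A) (hma : m < a) :
    rk K A (m + 1) a = rk K A m a +
      if s < cut K a m ∨ cut K a m = s ∧ K.R a m ≠ 0 then 1 else 0 := by
  subst hm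
  have hsp : s.len ∈ Sp K A := ⟨s, hs, rfl⟩
  have hmA : s.len ∉ A := fun h => hA.not_mem_sp h hsp
  obtain ⟨c, hc, hmc, hcs, hc0⟩ := exists_ne_zero_of_spNode hs
  -- The next level consists of the zero successors of all nodes and one further node, the nonzero
  -- successor of `s`.
  have hlevel : level K A (s.len + 1) =
      insert (cut K c (s.len + 1)) ((level K A s.len).image fun u => u.succ 0) := by
    ext t
    simp only [Finset.mem_insert, Finset.mem_image]
    constructor
    · intro ht
      obtain ⟨b, hb, hmb, rfl⟩ := mem_level.1 ht
      by_cases h0 : K.R b s.len = 0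
      · right
        exact ⟨cut K b s.len, cut_mem_level hb (by omega), by rw [cut_succ K hmb, h0]⟩
      · left
        rw [cut_succ_inj hmb hmc, hcs, hA.cut_eq_of_ne_zero hs hb hmb h0]
        exact ⟨rfl, hA.R_eq_of_ne_zero hs hb hc hmb hmc h0 hc0⟩
    · rintro (rfl | ⟨u, hu, rfl⟩)
      · exact cut_mem_level hc hmc
      · exact hA.succ_zero _ hsp u hu
  have hnot : cut K c (s.len + 1) ∉
      ((level K A s.len).image fun u => u.succ 0).filter (· < cut K a (s.len + 1)) := by
    simp only [Finset.mem_filter, Finset.mem_image, not_and]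
    rintro ⟨u, hu, h⟩
    rw [cut_succ K hmc, Node.succ_inj] at h
    exact absurd h.2.symm hc0
  have hfilter : (((level K A s.len).image fun u => u.succ 0).filter
      (· < cut K a (s.len + 1))).card = ((level K A s.len).filter fun u =>
        u < cut K a s.len ∨ u = cut K a s.len ∧ 0 < K.R a s.len).card := by
    rw [Finset.filter_image, Finset.card_image_of_injective _ (Node.succ_injective 0)]
    refine congrArg Finset.card (Finset.filter_congr fun u hu => ?_)
    obtain ⟨b, hb, hmb, rfl⟩ := mem_level.1 hu
    rw [cut_succ K hma, Node.succ_lt_succ ((cut_len K hmb).trans (cut_len K hma.le).symm)]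
  rw [rk, rank, hlevel, Finset.filter_insert]
  by_cases h0 : K.R a s.len = 0
  · have h1 : ((level K A s.len).filter fun u =>
        u < cut K a s.len ∨ u = cut K a s.len ∧ 0 < K.R a s.len).card = rk K A s.len a := by
      simp [h0, rk, rank]
    have h2 : cut K c (s.len + 1) < cut K a (s.len + 1) ↔ s < cut K a s.len := by
      rw [cut_succ_lt hmc hma, hcs, h0]
      simp
    by_cases h3 : s < cut K a s.len
    · rw [if_pos (h2.2 h3), Finset.card_insert_of_notMem hnot, hfilter, h1, if_pos (.inl h3)]
    · rw [if_neg (mt h2.1 h3), hfilter, h1, if_neg (by simp [h3, h0])]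
      rfl
  · have h3 := hA.cut_eq_of_ne_zero hs ha hma h0
    have h4 : cut K c (s.len + 1) = cut K a (s.len + 1) := by
      rw [cut_succ_inj hmc hma, hcs, h3]
      exact ⟨rfl, hA.R_eq_of_ne_zero hs hc ha hmc hma hc0 h0⟩
    have h1 : ((level K A s.len).filter fun u =>
        u < cut K a s.len ∨ u = cut K a s.len ∧ 0 < K.R a s.len) =
        insert (cut K a s.len) ((level K A s.len).filter (· < cut K a s.len)) := by
      ext u
      have := cut_mem_level (K := K) ha hma.le
      simp only [Finset.mem_filter, Finset.mem_insert, Fin.pos_iff_ne_zero]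
      constructor
      · rintro ⟨h, h' | h'⟩
        · exact .inr ⟨h, h'⟩
        · exact .inl h'.1
      · rintro (rfl | h)
        · exact ⟨this, .inr ⟨rfl, h0⟩⟩
        · exact ⟨h.1, .inl h.2⟩
    rw [if_neg (by simp [h4]), hfilter, h1, Finset.card_insert_of_notMem (by simp),
      if_pos (.inr ⟨h3, h0⟩)]
    rfl

/-- Inverts `rk_succ_of_sp`, since ranks will be computed downwards from coding levels. The zero
successor of `s` keeps its rank and the nonzero one comes immediately after it, so the two ranks
reveal whether the relation vanishes. -/
theorem WeaklyDiagonal.rk_of_sp (hA : WeaklyDiagonal F K A) {s : Node L}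
    (hs : s ∈ SpNode K A) {m : ℕ} (hm : s.len = m) {a : ℕ} (ha : a ∈ A) (hma : m < a) :
    rk K A m a = rk K A (m + 1) a -
        (if rank (level K A m) s < rk K A (m + 1) a then 1 else 0) ∧
      (K.R a m ≠ 0 ↔
        rk K A m a = rank (level K A m) s ∧ rk K A (m + 1) a = rank (level K A m) s + 1) := by
  have h1 := hA.rk_succ_of_sp hs hm ha hma
  have hsmem : s ∈ level K A m := by
    obtain ⟨b, hb, hmb, h, -⟩ := exists_ne_zero_of_spNode hs
    rw [← h, hm]
    exact cut_mem_level hb (hm ▸ hmb.le)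
  have hne : K.R a m ≠ 0 → cut K a m = s := fun h => by
    subst hm; exact hA.cut_eq_of_ne_zero hs ha hma h
  rcases lt_trichotomy s (cut K a m) with h | h | h
  · have h2 : rank (level K A m) s < rk K A m a := rank_lt_rank hsmem h
    rw [if_pos (.inl h)] at h1
    rw [if_pos (by omega)]
    refine ⟨by omega, fun h' => absurd (hne h').symm h.ne, fun h' => by omega⟩
  · have h2 : rk K A m a = rank (level K A m) s := by rw [rk, ← h]
    by_cases h0 : K.R a m = 0
    · rw [if_neg (by simp [← h, h0])] at h1
      rw [if_neg (by omega)]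
      exact ⟨by omega, fun h' => absurd h0 h', fun h' => by omega⟩
    · rw [if_pos (.inr ⟨h.symm, h0⟩)] at h1
      rw [if_pos (by omega)]
      exact ⟨by omega, fun _ => by omega, fun _ => h0⟩
  · have h2 : rk K A m a < rank (level K A m) s := rank_lt_rank (cut_mem_level ha hma.le) h
    have h3 : ¬ (s < cut K a m ∨ cut K a m = s ∧ K.R a m ≠ 0) := by
      rintro (h' | h')
      · exact h.not_gt h'
      · exact h.ne h'.1
    rw [if_neg h3] at h1
    rw [if_neg (by omega)]
    exact ⟨by omega, fun h' => absurd (hne h') h.ne, fun h' => by omega⟩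

/-! ### Consecutive critical levels -/

/-- There is no critical level strictly between `m` and `m'`. -/
def NoCrit (F : Set (FinStr L)) (K : Str L ℕ) (A : Set ℕ) (m m' : ℕ) : Prop :=
  ∀ x ∈ Crit F K A, m < x → m' ≤ x

theorem exists_next {m a : ℕ} (ha : a ∈ Crit F K A) (hma : m < a) :
    ∃ m' ∈ Crit F K A, m < m' ∧ m' ≤ a ∧ NoCrit F K A m m' := by
  have hex : ∃ x, x ∈ Crit F K A ∧ m < x := ⟨a, ha, hma⟩
  exact ⟨Nat.find hex, (Nat.find_spec hex).1, (Nat.find_spec hex).2, Nat.find_min' hex ⟨ha, hma⟩,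
    fun x hx hmx => Nat.find_min' hex ⟨hx, hmx⟩⟩

theorem NoCrit.not_mem {m m' x : ℕ} (h : NoCrit F K A m m') (hmx : m < x) (hx : x < m') :
    x ∉ Crit F K A := fun hxc => absurd (h x hxc hmx) (not_le.2 hx)

theorem rk_of_noCrit {m m' a : ℕ} (ha : a ∈ A) (hmm : m < m') (hma : m' ≤ a)
    (h : NoCrit F K A m m') : rk K A m' a = rk K A (m + 1) a := by
  have key : ∀ x, m + 1 ≤ x → x ≤ m' → rk K A x a = rk K A (m + 1) a := by
    intro x hx
    induction x, hx using Nat.le_induction with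
    | base => intro; rfl
    | succ x hx ih =>
      intro hxm
      have hnot := h.not_mem (x := x) (by omega) (by omega)
      rw [rk_succ_of_noncritical (fun hc => hnot (mem_crit_of_mem hc))
        (fun hc => hnot (mem_sp_crit hc)) ha (by omega), ih (by omega)]
  exact key m' hmm le_rfl

theorem levelAge_of_noCrit {m m' : ℕ} (hmm : m < m') (h : NoCrit F K A m m') :
    levelAge F K A m' = levelAge F K A (m + 1) := by
  have key : ∀ x, m + 1 ≤ x → x ≤ m' → levelAge F K A x = levelAge F K A (m + 1) := by
    intro x hx
    induction x, hx using Nat.le_induction with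
    | base => intro; rfl
    | succ x hx ih =>
      intro hxm
      have hnot := h.not_mem (x := x) (by omega) (by omega)
      rw [← (levelAge_eq_iff_stable (F := F) (fun hc => hnot (mem_crit_of_mem hc))
        (fun hc => hnot (mem_sp_crit hc))).2 (stable_of_not_mem_crit hnot), ih (by omega)]
  exact key m' hmm le_rfl

theorem nodeAge_of_noCrit {m m' a : ℕ} (ha : a ∈ A) (hmm : m ≤ m') (hma : m' ≤ a)
    (h : ∀ x ∈ Crit F K A, m ≤ x → m' ≤ x) :
    nodeAge F K (cut K a m') = nodeAge F K (cut K a m) := by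
  have key : ∀ x, m ≤ x → x ≤ m' → nodeAge F K (cut K a x) = nodeAge F K (cut K a m) := by
    intro x hx
    induction x, hx using Nat.le_induction with
    | base => intro; rfl
    | succ x hx ih =>
      intro hxm
      rw [(stable_of_not_mem_crit fun hc => absurd (h x hc hx) (by omega)).nodeAge_eq ha (by omega),
        ih (by omega)]
  exact key m' hmm le_rfl

/-- The path of a vertex of `A` only has to be computed at critical levels. -/
theorem path_snd_eq {a : ℕ} (ha : a ∈ A) :
    (path F K a).2 = {C | ∃ m ∈ Crit F K A, m ≤ a ∧ C = nodeAge F K (cut K a m)} := by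
  ext C
  constructor
  · rintro ⟨m, hma, rfl⟩
    have hex : ∃ x, x ∈ Crit F K A ∧ m ≤ x := ⟨a, mem_crit_of_mem ha, hma⟩
    have h1 := Nat.find_spec hex
    have h2 : Nat.find hex ≤ a := Nat.find_min' hex ⟨mem_crit_of_mem ha, hma⟩
    exact ⟨Nat.find hex, h1.1, h2, (nodeAge_of_noCrit ha h1.2 h2
      fun x hx hmx => Nat.find_min' hex ⟨hx, hmx⟩).symm⟩
  · rintro ⟨m, -, hma, rfl⟩
    exact ⟨m, hma, rfl⟩

/-! ### Diary entries -/

namespace Entry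

/-- The age of the node at position `p`. -/
def nodeCls (E : Entry L) (p : ℕ) : AgeClass L 1 :=
  if h : p < E.size then E.cls.pull (fun _ => ⟨p, h⟩) else ∅

/-- The unary predicate of the node at position `p`. -/
def sortAt (E : Entry L) (p : ℕ) : Option (Fin L.ku) :=
  if h : p < E.size then some (E.sort ⟨p, h⟩) else none

/-- The `p`-th passing number. -/
def passAt (E : Entry L) (p : ℕ) : Option (Fin L.k) :=
  if h : p < E.size - 1 then some (E.pass ⟨p, h⟩) else none

end Entry

theorem vec_rk {m a : ℕ} (ha : a ∈ A) (hma : m ≤ a) :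
    ∃ h : rk K A m a < (level K A m).card, vec (level K A m) ⟨rk K A m a, h⟩ = cut K a m := by
  obtain ⟨i, hi, hi'⟩ := (lists_vec (level K A m)).exists_index ha hma
  refine ⟨hi' ▸ i.2, ?_⟩
  rw [← hi]
  congr 1
  exact Fin.ext hi'.symm

/-- Reading entries at natural-number positions, here and in the next two lemmas, makes equal
entries interchangeable without transport along an equality of their sizes. -/
theorem entry_nodeCls {m a : ℕ} (ha : a ∈ A) (hma : m ≤ a) :
    (entry F K A m).nodeCls (rk K A m a) = nodeAge F K (cut K a m) := by
  obtain ⟨h, h'⟩ := vec_rk (K := K) ha hma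
  have hlt : rk K A m a < (entry F K A m).size := h
  rw [nodeAge_cut hma, ← h', Entry.nodeCls, dif_pos hlt]
  ext ⟨n, D⟩
  exact (mem_age (B := D.relabel _)).trans (mem_age (B := D)
    (s := fun _ : Fin 1 => vec (level K A m) ⟨rk K A m a, h⟩)).symm

theorem entry_sortAt {m a : ℕ} (ha : a ∈ A) (hma : m ≤ a) :
    (entry F K A m).sortAt (rk K A m a) = some (K.U a) := by
  obtain ⟨h, h'⟩ := vec_rk (K := K) ha hma
  rw [← cut_un K a m, ← h']
  exact dif_pos h

theorem entry_passAt (hA : WeaklyDiagonal F K A) {m a : ℕ} (hm : m ∈ A) (ha : a ∈ A) (hma : m < a) :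
    (entry F K A m).passAt (rk K A (m + 1) a) = some (K.R a m) := by
  obtain ⟨h, h'⟩ := vec_rk (K := K) (m := m + 1) ha hma
  have hcard := card_level_of_coding hm (hA.not_mem_sp hm) (hA.cut_ne hm)
  -- One node disappears at a coding level, so `size - 1` is the number of nodes above it, and the
  -- default value in `entry` is not the one read.
  have hlt : rk K A (m + 1) a < (entry F K A m).size - 1 := by
    change _ < (level K A m).card - 1
    omega
  rw [Entry.passAt, dif_pos hlt, ← cut_val K hma m.lt_succ_self, ← h']
  simp only [entry, if_pos hm, dif_pos h]

theorem entry_pos_of_mem {m : ℕ} (hm : m ∈ A) :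
    (entry F K A m).pos = rank (level K A m) (code K m) := by
  simp only [entry, if_pos hm]
  rfl

theorem WeaklyDiagonal.entry_pos_of_spNode (hA : WeaklyDiagonal F K A) {s : Node L} {m : ℕ}
    (hs : s ∈ SpNode K A) (hm : s.len = m) : (entry F K A m).pos = rank (level K A m) s := by
  have hsp : m ∈ Sp K A := ⟨s, hs, hm⟩
  have hmA : m ∉ A := fun h => hA.not_mem_sp h hsp
  simp only [entry, if_neg hmA, if_pos hsp, rank]
  refine congrArg Finset.card (Finset.filter_congr fun u _ => ?_)
  constructor
  · exact fun h => h s hs hm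
  · intro h x hx hxm
    rwa [hA.spNode_unique hx hs (hxm.trans hm.symm)]

theorem entry_label_mem {m : ℕ} : (entry F K A m).label = .Cd ↔ m ∈ A := by
  simp only [entry]
  split_ifs <;> simp_all

theorem entry_label_sp (hA : WeaklyDiagonal F K A) {m : ℕ} :
    (entry F K A m).label = .sp ↔ m ∈ Sp K A := by
  have := hA.not_mem_sp (m := m)
  simp only [entry]
  split_ifs <;> simp_all

theorem Lists.entry_eq {m d : ℕ} {s : Fin d → Node L} (hs : Lists s (level K A m)) :
    (⟨(entry F K A m).size, (entry F K A m).sort, (entry F K A m).cls⟩ :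
      Σ d, (Fin d → Fin L.ku) × AgeClass L d) = ⟨d, fun i => (s i).un, age F K m s⟩ := by
  obtain rfl := hs.card_eq
  rw [hs.unique (lists_vec _)]
  rfl

theorem entry_levelAge {m : ℕ} :
    (⟨(entry F K A m).size, (entry F K A m).cls⟩ : Σ d, AgeClass L d) = levelAge F K A m := rfl

end diagonal

/-! ### Matchings of critical levels -/

/-- `T` is an increasing bijection between the critical levels of `A` and `B` under which the diary
entries agree. -/
structure Matching (F : Set (FinStr L)) (K : Str L ℕ) (A B : Set ℕ) (T : ℕ → ℕ → Prop) : Prop where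
  left : ∀ {x y}, T x y → x ∈ Crit F K A
  right : ∀ {x y}, T x y → y ∈ Crit F K B
  exists_right : ∀ x ∈ Crit F K A, ∃ y, T x y
  exists_left : ∀ y ∈ Crit F K B, ∃ x, T x y
  lt_iff : ∀ {x y x' y'}, T x y → T x' y' → (x < x' ↔ y < y')
  entry_eq : ∀ {x y}, T x y → entry F K A x = entry F K B y

section matching

variable {F : Set (FinStr L)} {K : Str L ℕ} {ch : Choices F K} {A B : Set ℕ} {T : ℕ → ℕ → Prop}

namespace Matching

theorem symm (hM : Matching F K A B T) : Matching F K B A fun y x => T x y where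
  left := hM.right
  right := hM.left
  exists_right := hM.exists_left
  exists_left := hM.exists_right
  lt_iff h h' := (hM.lt_iff h h').symm
  entry_eq h := (hM.entry_eq h).symm

theorem le_iff (hM : Matching F K A B T) {x y x' y' : ℕ} (h : T x y) (h' : T x' y') :
    x ≤ x' ↔ y ≤ y' := by
  rw [← not_lt, ← not_lt, hM.lt_iff h' h]

theorem right_unique (hM : Matching F K A B T) {x y y' : ℕ} (h : T x y) (h' : T x y') : y = y' :=
  le_antisymm ((hM.le_iff h h').1 le_rfl) ((hM.le_iff h' h).1 le_rfl)

theorem mem_iff (hM : Matching F K A B T) {x y : ℕ} (h : T x y) : x ∈ A ↔ y ∈ B := by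
  rw [← entry_label_mem (F := F) (K := K), hM.entry_eq h, entry_label_mem]

theorem sp_iff (hM : Matching F K A B T) (hA : WeaklyDiagonal F K A) (hB : WeaklyDiagonal F K B)
    {x y : ℕ} (h : T x y) : x ∈ Sp K A ↔ y ∈ Sp K B := by
  rw [← entry_label_sp hA, hM.entry_eq h, entry_label_sp hB]

theorem ac_of_ac (hM : Matching F K A B T) (hA : WeaklyDiagonal F K A) (hB : WeaklyDiagonal F K B)
    {x y : ℕ} (h : T x y) (hx : x ∈ AC F K A) : y ∈ AC F K B := by
  rcases mem_or_mem_sp_or_mem_AC (hM.right h) with hy | hy | hy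
  · exact absurd ((hM.mem_iff h).2 hy) (mem_AC_not_mem hx)
  · exact absurd ((hM.sp_iff hA hB h).2 hy) (mem_AC_not_mem_sp hx)
  · exact hy

theorem exists_right_of_mem (hM : Matching F K A B T) {a : ℕ} (ha : a ∈ A) :
    ∃ α ∈ B, T a α := by
  obtain ⟨α, h⟩ := hM.exists_right a (mem_crit_of_mem ha)
  exact ⟨α, (hM.mem_iff h).1 ha, h⟩

theorem exists_next (hM : Matching F K A B T) {m m' μ : ℕ} (h : T m μ) (hm' : m' ∈ Crit F K A)
    (hmm : m < m') (hno : NoCrit F K A m m') : ∃ μ', T m' μ' ∧ μ < μ' ∧ NoCrit F K B μ μ' := by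
  obtain ⟨μ', h'⟩ := hM.exists_right m' hm'
  refine ⟨μ', h', (hM.lt_iff h h').1 hmm, fun y hy hμy => ?_⟩
  obtain ⟨x, hx⟩ := hM.exists_left y hy
  exact (hM.le_iff h' hx).1 (hno x (hM.left hx) ((hM.lt_iff h hx).2 hμy))

/-- Downward induction along critical levels from `a`, where the diary records the position of the
code. At each critical level the rank is recovered from the rank one level higher and the recorded
position. -/
theorem rk_eq_aux (hM : Matching F K A B T) (hA : WeaklyDiagonal F K A)
    (hB : WeaklyDiagonal F K B) {a α : ℕ} (haα : T a α) (ha : a ∈ A) (k : ℕ) :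
    ∀ m μ, a - m = k → m ≤ a → T m μ →
      rk K A m a = rk K B μ α ∧ (m < a → rk K A (m + 1) a = rk K B (μ + 1) α) := by
  have hα := (hM.mem_iff haα).1 ha
  induction k using Nat.strong_induction_on with
  | _ k ih =>
  intro m μ hk hma h
  rcases hma.eq_or_lt with rfl | hma
  · obtain rfl := hM.right_unique h haα
    refine ⟨?_, fun h => absurd h (lt_irrefl _)⟩
    rw [rk, rk, cut_self, cut_self, ← entry_pos_of_mem (F := F) ha, ← entry_pos_of_mem (F := F) hα,
      hM.entry_eq h]
  · obtain ⟨m', hm', hmm, hm'a, hno⟩ := DiaryEnvelope.exists_next (mem_crit_of_mem ha) hma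
    obtain ⟨μ', h', hμμ, hno'⟩ := hM.exists_next h hm' hmm hno
    have hμα : μ < α := (hM.lt_iff h haα).1 hma
    -- Ranks do not change between `m + 1` and the next critical level, where the induction
    -- hypothesis applies.
    have e1 : rk K A (m + 1) a = rk K B (μ + 1) α := by
      rw [← rk_of_noCrit ha hmm hm'a hno,
        ← rk_of_noCrit hα hμμ ((hM.le_iff h' haα).1 hm'a) hno']
      exact (ih (a - m') (by omega) m' μ' rfl hm'a h').1
    refine ⟨?_, fun _ => e1⟩
    rcases mem_or_mem_sp_or_mem_AC (hM.left h) with hm | hm | hm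
    · have hμ := (hM.mem_iff h).1 hm
      rw [rk_of_coding hm (hA.not_mem_sp hm) (hA.cut_ne hm) ha hma,
        rk_of_coding hμ (hB.not_mem_sp hμ) (hB.cut_ne hμ) hα hμα, e1,
        ← entry_pos_of_mem (F := F) hm, ← entry_pos_of_mem (F := F) hμ, hM.entry_eq h]
    · obtain ⟨s, hs, hsm⟩ := hm
      obtain ⟨s', hs', hsm'⟩ := (hM.sp_iff hA hB h).1 ⟨s, hs, hsm⟩
      rw [(hA.rk_of_sp hs hsm ha hma).1, (hB.rk_of_sp hs' hsm' hα hμα).1, e1,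
        ← hA.entry_pos_of_spNode hs hsm, ← hB.entry_pos_of_spNode hs' hsm', hM.entry_eq h]
    · have hμ := hM.ac_of_ac hA hB h hm
      rw [← rk_succ_of_noncritical (mem_AC_not_mem hm) (mem_AC_not_mem_sp hm) ha hma,
        ← rk_succ_of_noncritical (mem_AC_not_mem hμ) (mem_AC_not_mem_sp hμ) hα hμα, e1]

theorem rk_eq (hM : Matching F K A B T) (hA : WeaklyDiagonal F K A)
    (hB : WeaklyDiagonal F K B) {a α m μ : ℕ} (haα : T a α) (ha : a ∈ A) (h : T m μ)
    (hma : m ≤ a) : rk K A m a = rk K B μ α :=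
  (hM.rk_eq_aux hA hB haα ha _ m μ rfl hma h).1

theorem rk_succ_eq (hM : Matching F K A B T) (hA : WeaklyDiagonal F K A)
    (hB : WeaklyDiagonal F K B) {a α m μ : ℕ} (haα : T a α) (ha : a ∈ A) (h : T m μ)
    (hma : m < a) : rk K A (m + 1) a = rk K B (μ + 1) α :=
  (hM.rk_eq_aux hA hB haα ha _ m μ rfl hma.le h).2 hma

theorem U_eq (hM : Matching F K A B T) (hA : WeaklyDiagonal F K A)
    (hB : WeaklyDiagonal F K B) {a α : ℕ} (haα : T a α) (ha : a ∈ A) : K.U a = K.U α := by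
  have h1 := entry_sortAt (F := F) (K := K) ha le_rfl
  rw [hM.rk_eq hA hB haα ha haα le_rfl, hM.entry_eq haα,
    entry_sortAt ((hM.mem_iff haα).1 ha) le_rfl] at h1
  exact (Option.some_injective _ h1).symm

theorem nodeAge_eq (hM : Matching F K A B T) (hA : WeaklyDiagonal F K A)
    (hB : WeaklyDiagonal F K B) {a α m μ : ℕ} (haα : T a α) (ha : a ∈ A) (h : T m μ)
    (hma : m ≤ a) : nodeAge F K (cut K a m) = nodeAge F K (cut K α μ) := by
  rw [← entry_nodeCls ha hma, hM.rk_eq hA hB haα ha h hma, hM.entry_eq h,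
    entry_nodeCls ((hM.mem_iff haα).1 ha) ((hM.le_iff h haα).1 hma)]

/-- The level `m + 1` need not be critical, but the age of the node is constant from there to the
next critical level. -/
theorem nodeAge_succ_eq (hM : Matching F K A B T) (hA : WeaklyDiagonal F K A)
    (hB : WeaklyDiagonal F K B) {a α m μ : ℕ} (haα : T a α) (ha : a ∈ A) (h : T m μ)
    (hma : m < a) : nodeAge F K (cut K a (m + 1)) = nodeAge F K (cut K α (μ + 1)) := by
  obtain ⟨m', hm', hmm, hm'a, hno⟩ := DiaryEnvelope.exists_next (mem_crit_of_mem ha) hma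
  obtain ⟨μ', h', hμμ, hno'⟩ := hM.exists_next h hm' hmm hno
  rw [← nodeAge_of_noCrit ha hmm hm'a fun x hx hmx => hno x hx hmx,
    ← nodeAge_of_noCrit ((hM.mem_iff haα).1 ha) hμμ ((hM.le_iff h' haα).1 hm'a)
      fun x hx hmx => hno' x hx hmx]
  exact hM.nodeAge_eq hA hB haα ha h' hm'a

theorem path_eq (hM : Matching F K A B T) (hA : WeaklyDiagonal F K A)
    (hB : WeaklyDiagonal F K B) {a α : ℕ} (haα : T a α) (ha : a ∈ A) :
    path F K a = path F K α := by
  refine Prod.ext (hM.U_eq hA hB haα ha) ?_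
  rw [path_snd_eq ha, path_snd_eq ((hM.mem_iff haα).1 ha)]
  ext C
  constructor
  · rintro ⟨m, hm, hma, rfl⟩
    obtain ⟨μ, h⟩ := hM.exists_right m hm
    exact ⟨μ, hM.right h, (hM.le_iff h haα).1 hma, hM.nodeAge_eq hA hB haα ha h hma⟩
  · rintro ⟨μ, hμ, hμα, rfl⟩
    obtain ⟨m, h⟩ := hM.exists_left μ hμ
    have hma := (hM.le_iff h haα).2 hμα
    exact ⟨m, hM.left h, hma, (hM.nodeAge_eq hA hB haα ha h hma).symm⟩

theorem R_eq_of_mem (hM : Matching F K A B T) (hA : WeaklyDiagonal F K A)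
    (hB : WeaklyDiagonal F K B) {a α m μ : ℕ} (haα : T a α) (ha : a ∈ A) (h : T m μ) (hm : m ∈ A)
    (hma : m < a) : K.R a m = K.R α μ := by
  have h1 := entry_passAt hA hm ha hma
  rw [hM.rk_succ_eq hA hB haα ha h hma, hM.entry_eq h, entry_passAt hB ((hM.mem_iff h).1 hm)
    ((hM.mem_iff haα).1 ha) ((hM.lt_iff h haα).1 hma)] at h1
  exact (Option.some_injective _ h1).symm

theorem R_ne_zero_iff_of_sp (hM : Matching F K A B T) (hA : WeaklyDiagonal F K A)
    (hB : WeaklyDiagonal F K B) {a α m μ : ℕ} (haα : T a α) (ha : a ∈ A) (h : T m μ)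
    (hm : m ∈ Sp K A) (hma : m < a) : K.R a m ≠ 0 ↔ K.R α μ ≠ 0 := by
  obtain ⟨s', hs', hsm'⟩ := (hM.sp_iff hA hB h).1 hm
  obtain ⟨s, hs, hsm⟩ := hm
  rw [(hA.rk_of_sp hs hsm ha hma).2,
    (hB.rk_of_sp hs' hsm' ((hM.mem_iff haα).1 ha) ((hM.lt_iff h haα).1 hma)).2,
    ← hA.entry_pos_of_spNode hs hsm, ← hB.entry_pos_of_spNode hs' hsm', hM.entry_eq h,
    hM.rk_eq hA hB haα ha h hma.le, hM.rk_succ_eq hA hB haα ha h hma]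

end Matching

/-! ### Matching start levels -/

/-- The order of free starts is expressed through predicates and paths, both of which the diary
determines. -/
theorem Diagonal.start_lt_iff (hA : Diagonal ch A) {a b m n : ℕ} (ha : a ∈ A) (hb : b ∈ A)
    (hfa : HasFree F K (K.U a)) (hfb : HasFree F K (K.U b)) (hm : IsStart K a m)
    (hn : IsStart K b n) :
    m < n ↔ K.U a < K.U b ∨ K.U a = K.U b ∧ ¬ ch.pathLE (path F K b) (path F K a) := by
  rcases lt_trichotomy (K.U a) (K.U b) with h | h | h
  · simp only [h, true_or, iff_true]
    exact hA.paths.free_sep a ha b hb hfa hfb h m n hm hn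
  · simp only [h, lt_irrefl, false_or, true_and]
    rw [← hA.paths.free_order b hb a ha h.symm hfb n m hn hm, not_le]
  · have := hA.paths.free_sep b hb a ha hfb hfa h n m hn hm
    simp only [h.not_gt, h.ne', false_or, false_and, iff_false, not_lt]
    exact this.le

/-- Without a free relation, the start is the last level at which the node still has full age. This
makes it visible in the diary. -/
theorem nodeAge_eq_left_iff (hF : Admissible F) (hK : IsFraisseLimit F K) {a r m : ℕ}
    (hr : IsStart K a r) (hfree : ¬ HasFree F K (K.U a)) (hm : m ≤ a) :
    nodeAge F K (cut K a m) = nodeAge F K (Node.left (K.U a) 0) ↔ m ≤ r := by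
  have hr' := (isStart_iff K).1 hr
  constructor
  · intro h
    by_contra! hlt
    refine nodeAge_start_ne hF hK hr hfree (Set.Subset.antisymm ?_ ?_)
    · rw [← nodeAge_of_zero hF hK hr'.1.le hr'.2.2]
      exact nodeAge_cut_anti r.le_succ hr'.1
    · rw [← h]
      exact nodeAge_cut_anti hlt hm
  · intro h
    exact nodeAge_of_zero hF hK hm fun x hx => hr'.2.2 x (by omega)

theorem Diagonal.freeStart_of_lt (hA : Diagonal ch A) {x y : ℕ} (hx : x ∈ CritPlus F K A)
    (hy : y ∈ FreeStart F K A) (h : x < y) : x ∈ FreeStart F K A :=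
  hA.weak.freeStart_initial x hx y hy h

namespace Matching

/-- The start is critical, and it is the last critical level at which the node has full age; since
matched nodes have equal ages, the two starts bound each other. -/
theorem start_nonfree (hM : Matching F K A B T) (hF : Admissible F) (hK : IsFraisseLimit F K)
    (hA : Diagonal ch A) (hB : Diagonal ch B) {a α r : ℕ} (haα : T a α) (ha : a ∈ A)
    (hfree : ¬ HasFree F K (K.U a)) (hr : IsStart K a r) : ∃ ρ, T r ρ ∧ IsStart K α ρ := by
  have hα := (hM.mem_iff haα).1 ha
  have hU := hM.U_eq hA.weak hB.weak haα ha
  have hfree' : ¬ HasFree F K (K.U α) := hU ▸ hfree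
  obtain ⟨ρ, h⟩ := hM.exists_right r (start_mem_crit hF hK ha hr hfree)
  obtain ⟨ρ', hρ'⟩ := hB.exists_isStart hα
  obtain ⟨r', h'⟩ := hM.exists_left ρ' (start_mem_crit hF hK hα hρ' hfree')
  have hra : r < a := ((isStart_iff K).1 hr).1
  have hρα : ρ' < α := ((isStart_iff K).1 hρ').1
  have hr'a : r' < a := (hM.lt_iff h' haα).2 hρα
  have h1 : ρ ≤ ρ' := by
    rw [← nodeAge_eq_left_iff hF hK hρ' hfree' ((hM.lt_iff h haα).1 hra).le,
      ← hM.nodeAge_eq hA.weak hB.weak haα ha h hra.le, ← hU]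
    exact (nodeAge_eq_left_iff hF hK hr hfree hra.le).2 le_rfl
  have h2 : r' ≤ r := by
    rw [← nodeAge_eq_left_iff hF hK hr hfree hr'a.le,
      hM.nodeAge_eq hA.weak hB.weak haα ha h' hr'a.le, hU]
    exact (nodeAge_eq_left_iff hF hK hρ' hfree' hρα.le).2 le_rfl
  have h3 := (hM.le_iff h' h).1 h2
  obtain rfl := le_antisymm h1 h3
  exact ⟨ρ, h, hρ'⟩

theorem start_lt_iff (hM : Matching F K A B T) (hA : Diagonal ch A) (hB : Diagonal ch B)
    {a α b β m n m' n' : ℕ} (haα : T a α) (hbβ : T b β) (ha : a ∈ A) (hb : b ∈ A)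
    (hfa : HasFree F K (K.U a)) (hfb : HasFree F K (K.U b)) (hm : IsStart K a m)
    (hn : IsStart K b n) (hm' : IsStart K α m') (hn' : IsStart K β n') : m < n ↔ m' < n' := by
  have hUa := hM.U_eq hA.weak hB.weak haα ha
  have hUb := hM.U_eq hA.weak hB.weak hbβ hb
  rw [hA.start_lt_iff ha hb hfa hfb hm hn, hB.start_lt_iff ((hM.mem_iff haα).1 ha)
    ((hM.mem_iff hbβ).1 hb) (hUa ▸ hfa) (hUb ▸ hfb) hm' hn', hUa, hUb,
    hM.path_eq hA.weak hB.weak haα ha, hM.path_eq hA.weak hB.weak hbβ hb]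

/-- Critical free start levels are matched with free start levels. -/
theorem start_free (hM : Matching F K A B T) (hF : Admissible F) (hK : IsFraisseLimit F K)
    (hA : Diagonal ch A) (hB : Diagonal ch B) (m : ℕ) : ∀ b β μ, m ∈ Crit F K A → b ∈ A →
      HasFree F K (K.U b) → IsStart K b m → T m μ → T b β → IsStart K β μ := by
  induction m using Nat.strong_induction_on with
  | _ m ih =>
  intro b β μ hm hb hfb hs h hbβ
  have hβ := (hM.mem_iff hbβ).1 hb
  have hU := hM.U_eq hA.weak hB.weak hbβ hb
  have hmF : m ∈ FreeStart F K A := ⟨b, hb, hfb, hs⟩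
  have hsp := hA.mem_sp_of_free_start hF hK hmF hm
  have hs' := (isStart_iff K).1 hs
  have hβμ : K.R β μ ≠ 0 :=
    (hM.R_ne_zero_iff_of_sp hA.weak hB.weak hbβ hb h hsp hs'.1).1 hs'.2.1
  obtain ⟨k, hk⟩ := hB.exists_isStart hβ
  have hk' := (isStart_iff K).1 hk
  have hkμ : k ≤ μ := by
    by_contra! hlt
    exact hβμ (hk'.2.2 μ hlt)
  rcases hkμ.eq_or_lt with rfl | hlt
  · exact hk
  exfalso
  -- Suppose `β` starts at some `k < μ`. If `k` is critical, its match `x < m` is a free start of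
  -- some `c` because free starts form an initial segment. By induction the match of `c` starts at
  -- `k` as well, although `c` starts before `b`.
  by_cases hkc : k ∈ Crit F K B
  · obtain ⟨x, hx⟩ := hM.exists_left k hkc
    have hxm : x < m := (hM.lt_iff hx h).2 hlt
    obtain ⟨c, hc, hfc, hcs⟩ :=
      hA.freeStart_of_lt (mem_critPlus_of_crit (hM.left hx)) hmF hxm
    obtain ⟨γ, -, hcγ⟩ := hM.exists_right_of_mem hc
    have h1 := ih x hxm c γ k (hM.left hx) hc hfc hcs hx hcγ
    exact lt_irrefl _ ((hM.start_lt_iff hA hB hcγ hbβ hc hb hfc hfb hcs hs h1 hk).1 hxm)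
  -- Otherwise take `c` sharing the node of `b` at `m` but continuing by `0`. It starts later than
  -- `b`, so its match starts after `k`, and `β` splits from that match at `k`; then `k` is critical
  -- after all.
  · obtain ⟨c, hc, hmc, hcut, hc0⟩ := hA.weak.exists_zero hsp hb hs'.1
    have hag := (cut_eq_cut K hmc.le hs'.1.le).1 hcut
    obtain ⟨n, hn⟩ := hA.exists_isStart hc
    have hn' := (isStart_iff K).1 hn
    have hmn : m < n := by
      by_contra! hle
      rcases hle.eq_or_lt with rfl | hle
      · exact hn'.2.1 hc0
      · exact hn'.2.1 ((hag.2 n hle).trans (hs'.2.2 n hle))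
    obtain ⟨γ, hγ, hcγ⟩ := hM.exists_right_of_mem hc
    obtain ⟨l, hl⟩ := hB.exists_isStart hγ
    have hl' := (isStart_iff K).1 hl
    have hkl : k < l :=
      (hM.start_lt_iff hA hB hbβ hcγ hb hc hfb (hag.1 ▸ hfb) hs hn hk hl).1 hmn
    refine hkc (mem_sp_crit (mem_sp.2 ⟨β, hβ, γ, hγ, hk'.1, by omega, ?_, ?_⟩))
    · rw [cut_eq_cut K hk'.1.le (by omega), ← hU, ← hM.U_eq hA.weak hB.weak hcγ hc]
      exact ⟨hag.1.symm, fun r hr => (hk'.2.2 r hr).trans (hl'.2.2 r (by omega)).symm⟩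
    · rw [hl'.2.2 k hkl]
      exact hk'.2.1

end Matching

/-! ### Matching age-change levels -/

/-- With no vertex of `A` above `m` there is nothing to attach. The vertex found here guarantees a
later critical level, from which the age at `m + 1` can be read. -/
theorem exists_above_of_AC (hF : Admissible F) (hK : IsFraisseLimit F K) {m : ℕ}
    (hm : m ∈ AC F K A) : ∃ a ∈ A, m < a := by
  by_contra! hcon
  refine (mem_AC.1 hm).2.2 fun V _ M f hf _ => forb_of_clique hF fun S _ =>
    ⟨_, _, Sum.inl, forb_initial hK (m + 1), Covers.of_isEmb (isEmb_inl _ _ _) ?_⟩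
  rintro (x | b) -
  · exact ⟨x, rfl⟩
  · exact absurd (hf b).2.1 (not_lt.2 (hcon _ (hf b).1))

theorem Matching.levelAge_succ_eq (hM : Matching F K A B T) {m μ a : ℕ} (ha : a ∈ A) (hma : m < a)
    (h : T m μ) : levelAge F K A (m + 1) = levelAge F K B (μ + 1) := by
  obtain ⟨m', hm', hmm, hm'a, hno⟩ := DiaryEnvelope.exists_next (mem_crit_of_mem ha) hma
  obtain ⟨μ', hnext, hμμ, hno'⟩ := hM.exists_next h hm' hmm hno
  rw [← levelAge_of_noCrit hmm hno, ← levelAge_of_noCrit hμμ hno', ← entry_levelAge,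
    ← entry_levelAge, hM.entry_eq hnext]

/-- At matched age-change levels, the same cause is realised. -/
theorem Matching.exists_realised (hM : Matching F K A B T) (hF : Admissible F)
    (hK : IsFraisseLimit F K) (hA : Diagonal ch A) (hB : Diagonal ch B) {m μ : ℕ} (h : T m μ)
    (hm : m ∈ AC F K A) : ∃ (d d₀ : ℕ) (s t s' t' : Fin d → Node L) (ρ : Fin d → Fin L.ku)
      (𝒜 ℬ : AgeClass L d) (e : Fin d₀ → Fin d) (φ φ' : Fin (essCause ch ρ 𝒜 ℬ e).size → ℕ),
      Realised ch A m s t ρ 𝒜 ℬ e φ ∧ Realised ch B μ s' t' ρ 𝒜 ℬ e φ' := by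
  have hμ := hM.ac_of_ac hA.weak hB.weak h hm
  obtain ⟨d, d₀, s, t, ρ, 𝒜, ℬ, e, φ, hr⟩ := hA.exists_realised hF hm
  obtain ⟨d', d₁, s', t', ρ', 𝒜', ℬ', e', φ', hr'⟩ := hB.exists_realised hF hμ
  obtain ⟨a, ha, hma⟩ := exists_above_of_AC hF hK hm
  have h1 : (⟨d, ρ, 𝒜⟩ : Σ d, (Fin d → Fin L.ku) × AgeClass L d) = ⟨d', ρ', 𝒜'⟩ := by
    rw [hr.sort, hr.age, hr'.sort, hr'.age, ← hr.lists.entry_eq, ← hr'.lists.entry_eq,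
      hM.entry_eq h]
  have h2 : (⟨d, ℬ⟩ : Σ d, AgeClass L d) = ⟨d', ℬ'⟩ := by
    rw [hr.age_succ, hr'.age_succ, ← hr.lists_succ.levelAge_eq, ← hr'.lists_succ.levelAge_eq,
      hM.levelAge_succ_eq ha hma h]
  cases h1
  cases h2
  obtain ⟨rfl, he⟩ := hr.unique hF hm hr' hμ
  have he' : e = e' := he
  subst he'
  exact ⟨_, _, s, t, s', t', ρ, 𝒜, ℬ, e, φ, φ', hr, hr'⟩

/-- What is needed later about a common cause: both neighbourhoods realise one structure `I`, and
matched vertices, having equal ranks just above the two levels, are attached to it in the same way.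
-/
theorem Matching.exists_nbhd (hM : Matching F K A B T) (hF : Admissible F)
    (hK : IsFraisseLimit F K) (hA : Diagonal ch A) (hB : Diagonal ch B) {m μ : ℕ} (h : T m μ)
    (hm : m ∈ AC F K A) : ∃ (n : ℕ) (I : Str L (Fin n)) (φ φ' : Fin n → ℕ), StrictMono φ ∧
      StrictMono φ' ∧ Set.range φ = nbhd K m ∧ Set.range φ' = nbhd K μ ∧ IsEmb φ I K ∧
      IsEmb φ' I K ∧ ∀ a ∈ A, ∀ α, T a α → m < a → ∀ x, K.R a (φ x) = K.R α (φ' x) := by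
  obtain ⟨d, d₀, s, t, s', t', ρ, 𝒜, ℬ, e, φ, φ', hr, hr'⟩ :=
    hM.exists_realised hF hK hA hB h hm
  refine ⟨_, _, φ, φ', hr.mono, hr'.mono, hr.range_eq, hr'.range_eq, hr.isEmb, hr'.isEmb, ?_⟩
  intro a ha α haα hma x
  have hα := (hM.mem_iff haα).1 ha
  have hμα := (hM.lt_iff h haα).1 hma
  obtain ⟨j, hj, hj'⟩ := hr.lists_succ.exists_index ha hma
  obtain ⟨i, hi, hi'⟩ := hr'.lists_succ.exists_index hα hμα
  obtain rfl : i = j := Fin.ext (by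
    rw [hi', hj']
    exact (hM.rk_succ_eq hA.weak hB.weak haα ha h hma).symm)
  rw [← cut_val K hma (Nat.lt_succ_of_le (hr.le x)), ← hj, hr.att,
    ← cut_val K hμα (Nat.lt_succ_of_le (hr'.le x)), ← hi, hr'.att]

/-! ### Matching splitting levels -/

theorem pointGluing_inj {i : Fin L.ku} {q q' : Fin L.k} {j j' : Fin L.ku}
    (h : pointGluing i q j = pointGluing i q' j') : q = q' ∧ j = j' := by
  simp only [pointGluing, Gluing.mk.injEq, heq_eq_eq, true_and, Str.mk.injEq, and_true] at h
  exact ⟨congrFun (congrFun h.1 0) 0, congrFun h.2 0⟩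

/-- The relation to the vertex coded at a splitting level is determined by earlier data. -/
theorem Diagonal.sp_cases (hA : Diagonal ch A) {m a : ℕ} (hm : m ∈ Sp K A)
    (ha : a ∈ A) (hma : m < a) (hR : K.R a m ≠ 0) :
    (HasFree F K (K.U a) → K.U m = (ch.free (K.U a)).2 ∧ K.R a m = (ch.free (K.U a)).1) ∧
    (¬ HasFree F K (K.U a) → ∀ r, IsStart K a r → r < m → K.U m = K.U r ∧ K.R a m = K.R a r) ∧
    (¬ HasFree F K (K.U a) → IsStart K a m →
      ch.cause (sort1 (K.U a)) (nodeAge F K (cut K a m)) (nodeAge F K (cut K a (m + 1))) =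
        pointGluing (K.U a) (K.R a m) (K.U m)) := by
  obtain ⟨d, s, t, hs, ht, α, hα, h1, h2, h3⟩ := hA.splitting m hm
  have hlen : (s α).len = m := by
    obtain ⟨b, -, hb, h⟩ := mem_level.1 (hs.mem α)
    rw [h, cut_len K hb]
  have hcut : s α = cut K a m := by
    have := hA.weak.cut_eq_of_ne_zero hα ha (by rwa [hlen]) (by rwa [hlen])
    rw [hlen] at this
    exact this.symm
  -- A nonzero successor of the splitting node is the only one, so the direction prescribed for the
  -- larger successor is the relation of `a` to `m`.
  have key : ∀ q, q ≠ 0 → t α.succ = (s α).succ q → K.R a m = q := by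
    intro q hq htq
    obtain ⟨b, hb, hmb, h⟩ := mem_level.1 (ht.mem α.succ)
    rw [htq, cut_succ K hmb, Node.succ_inj] at h
    rw [h.2] at hq ⊢
    have := hA.weak.R_eq_of_ne_zero hα ha hb (by rwa [hlen]) (by rw [hlen]; exact hmb)
      (by rwa [hlen]) (by rwa [hlen])
    rwa [hlen] at this
  have hun : (s α).un = K.U a := by rw [hcut]; rfl
  rw [hun] at h1 h2 h3
  refine ⟨fun hfree => ?_, fun hfree r hr hrm => ?_, fun hfree hst => ?_⟩
  · obtain ⟨h4, h5⟩ := h1 hfree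
    exact ⟨((code_eq_left K _).1 h4).1, key _ (ch.free_spec _ hfree).1 h5⟩
  · have hr' := (isStart_iff K).1 hr
    have hne : s α ≠ Node.left (K.U a) m := by
      rw [hcut, Ne, cut_eq_left K hma.le]
      exact fun h => hr'.2.1 (h.2 r hrm)
    obtain ⟨r', hst, h4, h5⟩ := h2 hfree hne
    rw [hcut] at hst h5
    have hr'm : r' < m := by
      have := hst.1
      rwa [cut_len K hma.le] at this
    have hrr : r = r' := by
      refine hr.unique ((isStart_iff K).2 ⟨by omega, ?_, fun x hx => ?_⟩)
      · rw [← cut_val K hma.le hr'm]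
        exact hst.2.1
      · rw [← cut_val K hma.le (by omega : x < m)]
        exact hst.2.2 x hx
    subst hrr
    have h6 := key _ hst.2.1 (by rw [h5, hcut])
    rw [cut_val K hma.le hr'm] at h6
    exact ⟨((code_eq_left K _).1 h4).1, h6⟩
  · have hst' := (isStart_iff K).1 hst
    have hleft : s α = Node.left (K.U a) m := by
      rw [hcut, cut_eq_left K hma.le]
      exact ⟨rfl, hst'.2.2⟩
    obtain ⟨-, q, j, hq, h4, h5, h6⟩ := h3 hfree hleft
    have h7 := key q hq h4
    rw [hcut, ← h7, ← cut_succ K hma] at h5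
    rw [h5, ((code_eq_left K _).1 h6).1]

namespace Matching

/-- The vertices coded at matched critical levels outside `A` and `B` have the same predicate, and
the same relations to matched vertices. -/
theorem R_eq_aux (hM : Matching F K A B T) (hF : Admissible F) (hK : IsFraisseLimit F K)
    (hA : Diagonal ch A) (hB : Diagonal ch B) (m : ℕ) : ∀ μ, T m μ → m ∉ A →
      K.U m = K.U μ ∧ ∀ a ∈ A, ∀ α, T a α → m < a → K.R a m = K.R α μ := by
  induction m using Nat.strong_induction_on with
  | _ m ih =>
  intro μ h hmA
  rcases mem_or_mem_sp_or_mem_AC (hM.left h) with hm | hm | hm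
  · exact absurd hm hmA
  · have hμ := (hM.sp_iff hA.weak hB.weak h).1 hm
    have key : ∀ a ∈ A, ∀ α, T a α → m < a → K.R a m ≠ 0 → K.U m = K.U μ ∧ K.R a m = K.R α μ := by
      intro a ha α haα hma hR
      have hα := (hM.mem_iff haα).1 ha
      have hμα := (hM.lt_iff h haα).1 hma
      have hU := hM.U_eq hA.weak hB.weak haα ha
      have hR' := (hM.R_ne_zero_iff_of_sp hA.weak hB.weak haα ha h hm hma).1 hR
      obtain ⟨a1, a2, a3⟩ := hA.sp_cases hm ha hma hR
      obtain ⟨b1, b2, b3⟩ := hB.sp_cases hμ hα hμα hR'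
      rw [← hU] at b1 b2 b3
      by_cases hfree : HasFree F K (K.U a)
      · have a1 := a1 hfree
        have b1 := b1 hfree
        exact ⟨a1.1.trans b1.1.symm, a1.2.trans b1.2.symm⟩
      · obtain ⟨r, hr⟩ := hA.exists_isStart ha
        obtain ⟨ρ, hrρ, hρ⟩ := hM.start_nonfree hF hK hA hB haα ha hfree hr
        have hr' := (isStart_iff K).1 hr
        have hrm : r ≤ m := by
          by_contra! hlt
          exact hR (hr'.2.2 m hlt)
        -- If the start is the splitting level itself, the relation is read off the cause, which
        -- depends on two node ages shared by `a` and `α`. If it is earlier, the relation repeats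
        -- the one at the start, which is covered by induction.
        rcases hrm.eq_or_lt with rfl | hrm
        · obtain rfl := hM.right_unique h hrρ
          have a3 := a3 hfree hr
          rw [hM.nodeAge_eq hA.weak hB.weak haα ha h hma.le,
            hM.nodeAge_succ_eq hA.weak hB.weak haα ha h hma, b3 hfree hρ] at a3
          exact (pointGluing_inj a3).symm.imp Eq.symm Eq.symm
        · have a2 := a2 hfree r hr hrm
          have b2 := b2 hfree ρ hρ ((hM.lt_iff hrρ h).1 hrm)
          obtain ⟨h1, h2⟩ := ih r hrm ρ hrρ (hA.start_not_mem hF hK ha hr hfree)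
          exact ⟨a2.1.trans (h1.trans b2.1.symm),
            a2.2.trans ((h2 a ha α haα hr'.1).trans b2.2.symm)⟩
    constructor
    · obtain ⟨s, hs, rfl⟩ := hm
      obtain ⟨a, ha, hma, -, hR⟩ := exists_ne_zero_of_spNode hs
      obtain ⟨α, -, haα⟩ := hM.exists_right_of_mem ha
      exact (key a ha α haα hma hR).1
    · intro a ha α haα hma
      by_cases hR : K.R a m = 0
      · have := mt (hM.R_ne_zero_iff_of_sp hA.weak hB.weak haα ha h hm hma).2 (not_not.2 hR)
        rw [hR, not_not.1 this]
      · exact (key a ha α haα hma hR).2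
  -- An age-change level is the greatest element of its neighbourhood, so both enumerations reach it
  -- at the same index.
  · obtain ⟨n, I, φ, φ', hφ, hφ', hr, hr', he, he', hR⟩ := hM.exists_nbhd hF hK hA hB h hm
    have hmax : ∀ {p : ℕ} {ψ : Fin n → ℕ}, Set.range ψ = nbhd K p → ∃ z, ψ z = p := fun hψ => by
      have : _ ∈ Set.range _ := hψ.symm.subset (.inl rfl)
      exact this
    obtain ⟨z, hz⟩ := hmax hr
    obtain ⟨z', hz'⟩ := hmax hr'
    have hzz : z = z' := by
      apply le_antisymm
      · rw [← hφ'.le_iff_le, hz']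
        exact le_of_mem_nbhd (hr'.subset ⟨z, rfl⟩)
      · rw [← hφ.le_iff_le, hz]
        exact le_of_mem_nbhd (hr.subset ⟨z', rfl⟩)
    subst hzz
    subst hz
    subst hz'
    exact ⟨(he.2.1 z).trans (he'.2.1 z).symm, fun a ha α haα hma => hR a ha α haα hma z⟩

end Matching

end matching

section matching

variable {F : Set (FinStr L)} {K : Str L ℕ} {ch : Choices F K} {A B : Set ℕ} {T : ℕ → ℕ → Prop}

/-! ### Matching the hulls -/

/-- The extension of a matching to the free start levels. -/
def Host (F : Set (FinStr L)) (K : Str L ℕ) (A : Set ℕ) (T : ℕ → ℕ → Prop) (h η : ℕ) : Prop :=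
  T h η ∨ ∃ a α, T a α ∧ a ∈ A ∧ HasFree F K (K.U a) ∧ IsStart K a h ∧ IsStart K α η

/-- The vertices of the hull which come with the level `h`. -/
def block (F : Set (FinStr L)) (K : Str L ℕ) (A : Set ℕ) (h : ℕ) : Set ℕ :=
  if h ∈ AC F K A then nbhd K h else {h}

/-- The extension of a matching to the hulls. -/
def HullRel (F : Set (FinStr L)) (K : Str L ℕ) (A B : Set ℕ) (T : ℕ → ℕ → Prop) (x y : ℕ) : Prop :=
  ∃ h η, Host F K A T h η ∧ x ∈ block F K A h ∧ y ∈ block F K B η ∧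
    Nat.count (· ∈ block F K A h) x = Nat.count (· ∈ block F K B η) y

theorem count_of_range {n : ℕ} {φ : Fin n → ℕ} (hφ : StrictMono φ) {Y : Set ℕ}
    (h : Set.range φ = Y) (z : Fin n) : Nat.count (· ∈ Y) (φ z) = z := by
  subst h
  rw [Nat.count_eq_card_filter_range]
  refine (congrArg Finset.card (?_ : _ = (Finset.Iio z).image φ)).trans ?_
  · ext x
    simp only [Finset.mem_filter, Finset.mem_range, Set.mem_range, Finset.mem_image,
      Finset.mem_Iio]
    constructor
    · rintro ⟨hx, y, rfl⟩
      exact ⟨y, hφ.lt_iff_lt.1 hx, rfl⟩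
    · rintro ⟨y, hy, rfl⟩
      exact ⟨hφ hy, y, rfl⟩
  · rw [Finset.card_image_of_injective _ hφ.injective, Fin.card_Iio]

theorem block_of_AC {h : ℕ} (hh : h ∈ AC F K A) : block F K A h = nbhd K h := if_pos hh

theorem block_of_not_AC {h : ℕ} (hh : h ∉ AC F K A) : block F K A h = {h} := if_neg hh

theorem le_of_mem_block {h x : ℕ} (hx : x ∈ block F K A h) : x ≤ h := by
  by_cases hh : h ∈ AC F K A
  · rw [block_of_AC hh] at hx
    exact le_of_mem_nbhd hx
  · rw [block_of_not_AC hh] at hx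
    exact (Set.mem_singleton_iff.1 hx).le

theorem Diagonal.block_critPlus (hF : Admissible F) (hA : Diagonal ch A) {h x c : ℕ}
    (hx : x ∈ block F K A h) (hc : c ∈ CritPlus F K A) (hxc : x ≤ c) (hch : c ≤ h) : c = h := by
  by_cases hh : h ∈ AC F K A
  · rw [block_of_AC hh] at hx
    exact hA.nbhd_critPlus hF hh hx hc hxc hch
  · rw [block_of_not_AC hh] at hx
    exact le_antisymm hch (Set.mem_singleton_iff.1 hx ▸ hxc)

theorem Diagonal.free_start_not_mem_AC (hF : Admissible F) (hK : IsFraisseLimit F K)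
    (hA : Diagonal ch A) {m : ℕ} (hm : m ∈ FreeStart F K A) : m ∉ AC F K A :=
  fun h => (mem_AC.1 h).2.2 (hA.free_start_stable hF hK hm)

/-- Diagonal sets, with a matching of their critical levels. -/
structure Matched (ch : Choices F K) (A B : Set ℕ) (T : ℕ → ℕ → Prop) : Prop where
  admissible : Admissible F
  limit : IsFraisseLimit F K
  fst : Diagonal ch A
  snd : Diagonal ch B
  matching : Matching F K A B T

/-! ### The extended matching is an isomorphism of hulls -/

namespace Matched

theorem symm (H : Matched ch A B T) : Matched ch B A fun y x => T x y :=
  ⟨H.1, H.2, H.4, H.3, H.5.symm⟩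

theorem U_eq (H : Matched ch A B T) {a α : ℕ} (h : T a α) (ha : a ∈ A) : K.U a = K.U α :=
  H.matching.U_eq H.fst.weak H.snd.weak h ha

theorem host_symm (H : Matched ch A B T) {h η : ℕ} (hh : Host F K A T h η) :
    Host F K B (fun y x => T x y) η h := by
  rcases hh with hh | ⟨a, α, haα, ha, hfree, hs, hs'⟩
  · exact .inl hh
  · exact .inr ⟨α, a, haα, (H.matching.mem_iff haα).1 ha, H.U_eq haα ha ▸ hfree, hs', hs⟩

theorem host_critPlus (H : Matched ch A B T) {h η : ℕ} (hh : Host F K A T h η) :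
    h ∈ CritPlus F K A := by
  rcases hh with hh | ⟨a, α, haα, ha, hfree, hs, hs'⟩
  · exact mem_critPlus_of_crit (H.matching.left hh)
  · exact start_critPlus ha hs

theorem host_AC (H : Matched ch A B T) {h η : ℕ} (hh : Host F K A T h η) (hAC : h ∈ AC F K A) :
    T h η ∧ η ∈ AC F K B := by
  rcases hh with hh | ⟨a, α, haα, ha, hfree, hs, hs'⟩
  · exact ⟨hh, H.matching.ac_of_ac H.fst.weak H.snd.weak hh hAC⟩
  · exact absurd hAC (H.fst.free_start_not_mem_AC H.admissible H.limit ⟨a, ha, hfree, hs⟩)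

/-- A critical level below a free start is itself a free start, so by `start_free` its match is a
start too, and the order of starts can be compared. -/
theorem free_of_lt (H : Matched ch A B T) {h η a α m μ : ℕ} (hh : T h η) (haα : T a α) (ha : a ∈ A)
    (hfree : HasFree F K (K.U a)) (hs : IsStart K a m) (hs' : IsStart K α μ) (hlt : h < m) :
    η < μ := by
  obtain ⟨b, hb, hfb, hbs⟩ := H.fst.freeStart_of_lt (mem_critPlus_of_crit (H.matching.left hh))
    ⟨a, ha, hfree, hs⟩ hlt
  obtain ⟨β, -, hbβ⟩ := H.matching.exists_right_of_mem hb
  have h1 := H.matching.start_free H.admissible H.limit H.fst H.snd h b β η (H.matching.left hh) hb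
    hfb hbs hh hbβ
  exact (H.matching.start_lt_iff H.fst H.snd hbβ haα hb ha hfb hfree hbs hs h1 hs').1 hlt

theorem host_lt (H : Matched ch A B T) {h η h' η' : ℕ} (hh : Host F K A T h η)
    (hh' : Host F K A T h' η') (hlt : h < h') : η < η' := by
  rcases hh with hh | ⟨a, α, haα, ha, hfree, hs, hs'⟩
  · rcases hh' with hh' | ⟨b, β, hbβ, hb, hfb, hbs, hbs'⟩
    · exact (H.matching.lt_iff hh hh').1 hlt
    · exact H.free_of_lt hh hbβ hb hfb hbs hbs' hlt
  · rcases hh' with hh' | ⟨b, β, hbβ, hb, hfb, hbs, hbs'⟩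
    -- A free start against a critical level: if the order were reversed, `start_free` or
    -- `free_of_lt`, applied from `B` to `A`, would contradict `h < h'`.
    · by_contra! hle
      have hα := (H.matching.mem_iff haα).1 ha
      have hfree' := H.U_eq haα ha ▸ hfree
      rcases hle.eq_or_lt with rfl | hle
      · have := H.symm.matching.start_free H.admissible H.limit H.snd H.fst η' α a h'
          (H.matching.right hh') hα hfree' hs' hh' haα
        exact hlt.ne (hs.unique this)
      · exact hlt.not_gt (H.symm.free_of_lt hh' haα hα hfree' hs' hs hle)
    · exact (H.matching.start_lt_iff H.fst H.snd haα hbβ ha hb hfree hfb hs hbs hs' hbs').1 hlt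

theorem host_unique (H : Matched ch A B T) {h η η' : ℕ} (hh : Host F K A T h η)
    (hh' : Host F K A T h η') : η = η' := by
  rcases lt_trichotomy η η' with hlt | rfl | hlt
  · exact absurd (H.symm.host_lt (H.host_symm hh) (H.host_symm hh') hlt) (lt_irrefl _)
  · rfl
  · exact absurd (H.symm.host_lt (H.host_symm hh') (H.host_symm hh) hlt) (lt_irrefl _)

theorem hullRel_symm (H : Matched ch A B T) {x y : ℕ} (hxy : HullRel F K A B T x y) :
    HullRel F K B A (fun y x => T x y) y x := by
  obtain ⟨h, η, hh, hx, hy, hc⟩ := hxy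
  exact ⟨η, h, H.host_symm hh, hy, hx, hc.symm⟩

/-- Blocks do not interleave, since no earlier level lies between a member of a block and the level
of that block. So vertices are ordered first by their levels and then by their positions in a block.
-/
theorem hullRel_lt (H : Matched ch A B T) {x y x' y' : ℕ} (hxy : HullRel F K A B T x y)
    (hxy' : HullRel F K A B T x' y') (hlt : x < x') : y < y' := by
  obtain ⟨h, η, hh, hx, hy, hc⟩ := hxy
  obtain ⟨h', η', hh', hx', hy', hc'⟩ := hxy'
  rcases lt_trichotomy h h' with hl | rfl | hl
  · have h1 := H.host_lt hh hh' hl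
    by_contra! hle
    have h2 := H.snd.block_critPlus H.admissible hy' (H.symm.host_critPlus (H.host_symm hh))
      (hle.trans (le_of_mem_block hy)) h1.le
    omega
  · obtain rfl := H.host_unique hh hh'
    have h1 : Nat.count (· ∈ block F K A h) x < Nat.count (· ∈ block F K A h) x' :=
      Nat.count_strict_mono hx hlt
    rw [hc, hc'] at h1
    exact Nat.lt_of_count_lt_count h1
  · have h2 := H.fst.block_critPlus H.admissible hx (H.host_critPlus hh')
      (hlt.le.trans (le_of_mem_block hx')) hl.le
    omega

theorem hullRel_lt_iff (H : Matched ch A B T) {x y x' y' : ℕ} (hxy : HullRel F K A B T x y)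
    (hxy' : HullRel F K A B T x' y') : x < x' ↔ y < y' :=
  ⟨H.hullRel_lt hxy hxy', H.symm.hullRel_lt (H.hullRel_symm hxy) (H.hullRel_symm hxy')⟩

theorem hullRel_unique (H : Matched ch A B T) {x y y' : ℕ} (hxy : HullRel F K A B T x y)
    (hxy' : HullRel F K A B T x y') : y = y' := by
  rcases lt_trichotomy y y' with hlt | rfl | hlt
  · exact absurd ((H.hullRel_lt_iff hxy hxy').2 hlt) (lt_irrefl _)
  · rfl
  · exact absurd ((H.hullRel_lt_iff hxy' hxy).2 hlt) (lt_irrefl _)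

theorem hullRel_of_not_AC (H : Matched ch A B T) {h η : ℕ} (hh : Host F K A T h η)
    (hAC : h ∉ AC F K A) : HullRel F K A B T h η := by
  have hAC' : η ∉ AC F K B := fun h' => hAC (H.symm.host_AC (H.host_symm hh) h').2
  have key : ∀ (Y : Set ℕ) (n : ℕ), Y = {n} → Nat.count (· ∈ Y) n = 0 := fun Y n hY =>
    count_of_range (n := 1) (φ := fun _ => n) (Subsingleton.strictMono _) (by simp [hY]) 0
  refine ⟨h, η, hh, ?_, ?_, ?_⟩
  · rw [block_of_not_AC hAC]; rfl
  · rw [block_of_not_AC hAC']; rfl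
  · rw [key _ _ (block_of_not_AC hAC), key _ _ (block_of_not_AC hAC')]

theorem hullRel_of_AC (H : Matched ch A B T) {h η n : ℕ} (hh : T h η)
    (hAC : h ∈ AC F K A) {φ φ' : Fin n → ℕ} (hφ : StrictMono φ) (hφ' : StrictMono φ')
    (hr : Set.range φ = nbhd K h) (hr' : Set.range φ' = nbhd K η) (z : Fin n) :
    HullRel F K A B T (φ z) (φ' z) := by
  have hAC' := (H.host_AC (.inl hh) hAC).2
  refine ⟨h, η, .inl hh, ?_, ?_, ?_⟩
  · rw [block_of_AC hAC]; exact hr.subset ⟨z, rfl⟩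
  · rw [block_of_AC hAC']; exact hr'.subset ⟨z, rfl⟩
  · rw [block_of_AC hAC, block_of_AC hAC', count_of_range hφ' hr', count_of_range hφ hr]

/-- Vertices of the hull which do not belong to a free start level outside the critical levels
correspond to vertices of the closure. -/
theorem exists_hullRel_cl (H : Matched ch A B T) {x : ℕ}
    (hx : x ∈ Crit F K A ∨ ∃ m ∈ AC F K A, x ∈ nbhd K m) :
    ∃ y ∈ cl F K B, HullRel F K A B T x y := by
  have hx' : (x ∈ Crit F K A ∧ x ∉ AC F K A) ∨ ∃ m ∈ AC F K A, x ∈ nbhd K m := by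
    rcases hx with hx | hx
    · by_cases h : x ∈ AC F K A
      · exact .inr ⟨x, h, .inl rfl⟩
      · exact .inl ⟨hx, h⟩
    · exact .inr hx
  rcases hx' with ⟨hx, hAC⟩ | ⟨m, hm, hx⟩
  · obtain ⟨y, h⟩ := H.matching.exists_right x hx
    exact ⟨y, crit_subset_cl (H.matching.right h), H.hullRel_of_not_AC (.inl h) hAC⟩
  · obtain ⟨μ, h⟩ := H.matching.exists_right m (mem_AC_crit hm)
    obtain ⟨n, I, φ, φ', hφ, hφ', hr, hr', -⟩ :=
      H.matching.exists_nbhd H.admissible H.limit H.fst H.snd h hm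
    rw [← hr] at hx
    obtain ⟨z, rfl⟩ := hx
    exact ⟨φ' z, H.snd.nbhd_subset_cl H.admissible (H.host_AC (.inl h) hm).2
      (hr'.subset ⟨z, rfl⟩), H.hullRel_of_AC h hm hφ hφ' hr hr' z⟩

theorem exists_hullRel (H : Matched ch A B T) {x : ℕ} (hx : x ∈ hull F K A) :
    ∃ y ∈ hull F K B, HullRel F K A B T x y := by
  have key : (x ∈ Crit F K A ∨ ∃ m ∈ AC F K A, x ∈ nbhd K m) ∨ x ∈ FreeStart F K A := by
    rcases hx with h | h | h <;> simp [h]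
  rcases key with h | h
  · obtain ⟨y, hy, hxy⟩ := H.exists_hullRel_cl h
    exact ⟨y, H.snd.cl_subset_hull H.admissible H.limit hy, hxy⟩
  · have hAC := H.fst.free_start_not_mem_AC H.admissible H.limit h
    obtain ⟨a, ha, hfree, hs⟩ := h
    obtain ⟨α, hα, haα⟩ := H.matching.exists_right_of_mem ha
    obtain ⟨y, hy⟩ := H.snd.exists_isStart hα
    exact ⟨y, start_mem_hull H.admissible H.limit hα hy,
      H.hullRel_of_not_AC (.inr ⟨a, α, haα, ha, hfree, hs, hy⟩) hAC⟩

/-- Related vertices either belong to a matched age-change level or are matched themselves. -/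
theorem hullRel_cases (H : Matched ch A B T) {x y : ℕ} (hxy : HullRel F K A B T x y) :
    (∃ m μ, m ∈ AC F K A ∧ T m μ ∧ x ∈ nbhd K m) ∨ Host F K A T x y := by
  obtain ⟨h, η, hh, hx, hy, hc⟩ := hxy
  by_cases hAC : h ∈ AC F K A
  · rw [block_of_AC hAC] at hx
    exact .inl ⟨h, η, hAC, (H.host_AC hh hAC).1, hx⟩
  · have hAC' : η ∉ AC F K B := fun h' => hAC (H.symm.host_AC (H.host_symm hh) h').2
    rw [block_of_not_AC hAC, Set.mem_singleton_iff] at hx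
    rw [block_of_not_AC hAC', Set.mem_singleton_iff] at hy
    exact .inr (by rwa [hx, hy])

theorem hullRel_mem_hull (H : Matched ch A B T) {x y : ℕ} (hxy : HullRel F K A B T x y) :
    x ∈ hull F K A := by
  rcases H.hullRel_cases hxy with ⟨m, μ, hm, -, hx⟩ | h | ⟨a, α, haα, ha, hfree, hs, hs'⟩
  · exact .inr (.inr ⟨m, hm, hx⟩)
  · exact .inl (H.matching.left h)
  · exact .inr (.inl ⟨a, ha, hfree, hs⟩)

theorem hullRel_of_mem (H : Matched ch A B T) {x y : ℕ} (hxy : HullRel F K A B T x y)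
    (hx : x ∈ A) : T x y := by
  rcases H.hullRel_cases hxy with ⟨m, μ, hm, -, hxm⟩ | h | ⟨a, α, haα, ha, hfree, hs, hs'⟩
  · obtain rfl := H.fst.nbhd_critPlus H.admissible hm hxm
      (mem_critPlus_of_crit (mem_crit_of_mem hx)) le_rfl (le_of_mem_nbhd hxm)
    exact absurd hx (mem_AC_not_mem hm)
  · exact h
  · exact absurd hx (H.fst.free_start_not_mem ⟨a, ha, hfree, hs⟩)

theorem hullRel_U (H : Matched ch A B T) {x y : ℕ} (hxy : HullRel F K A B T x y) :
    K.U x = K.U y := by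
  rcases H.hullRel_cases hxy with ⟨m, μ, hm, h, hx⟩ | h | ⟨a, α, haα, ha, hfree, hs, hs'⟩
  · obtain ⟨n, I, φ, φ', hφ, hφ', hr, hr', he, he', -⟩ :=
      H.matching.exists_nbhd H.admissible H.limit H.fst H.snd h hm
    rw [← hr] at hx
    obtain ⟨z, rfl⟩ := hx
    rw [H.hullRel_unique hxy (H.hullRel_of_AC h hm hφ hφ' hr hr' z), he.2.1, he'.2.1]
  · by_cases hx : x ∈ A
    · exact H.U_eq h hx
    · exact (H.matching.R_eq_aux H.admissible H.limit H.fst H.snd x y h hx).1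
  · have hU := H.U_eq haα ha
    rw [H.fst.free_start_U ha hfree hs,
      H.snd.free_start_U ((H.matching.mem_iff haα).1 ha) (hU ▸ hfree) hs', hU]

/-- A nonzero relation to the start of `c` forces `a` to have the path of `c`, hence its start,
where the relation is the chosen free one. Matching preserves paths, so the same holds for `α`. -/
theorem R_eq_of_free_start (H : Matched ch A B T) {a α c γ x y : ℕ} (haα : T a α) (ha : a ∈ A)
    (hcγ : T c γ) (hc : c ∈ A) (hfree : HasFree F K (K.U c)) (hx : IsStart K c x)
    (hy : IsStart K γ y) (hxa : x < a) (hR : K.R a x ≠ 0) : K.R a x = K.R α y := by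
  have hα := (H.matching.mem_iff haα).1 ha
  have hγ := (H.matching.mem_iff hcγ).1 hc
  have hUc := H.U_eq hcγ hc
  have hpath := H.fst.path_eq_of_free_start hc hfree hx ha hxa hR
  have h1 := H.fst.isStart_of_path_eq hc ha hfree hx hpath
  have hpath' : path F K γ = path F K α := by
    rw [← H.matching.path_eq H.fst.weak H.snd.weak hcγ hc,
      ← H.matching.path_eq H.fst.weak H.snd.weak haα ha, hpath]
  have h2 := H.snd.isStart_of_path_eq hγ hα (hUc ▸ hfree) hy hpath'
  rw [H.fst.free_start_R ha (path_fst hpath ▸ hfree) h1,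
    H.snd.free_start_R hα (path_fst hpath' ▸ hUc ▸ hfree) h2, H.U_eq haα ha]

/-- By symmetry of the matching nonzero relations suffice, and these are restrictive: if `x` is
outside `A`, both vertices lie in one neighbourhood, where the relation is copied from the cause. -/
theorem hullRel_R_of_ne_zero (H : Matched ch A B T) {x y x' y' : ℕ} (hxy : HullRel F K A B T x y)
    (hxy' : HullRel F K A B T x' y') (hlt : x' < x) (hR : K.R x x' ≠ 0) :
    K.R x x' = K.R y y' := by
  by_cases hx : x ∈ A
  · have h := H.hullRel_of_mem hxy hx
    rcases H.hullRel_cases hxy' with ⟨m, μ, hm, hmμ, hx'⟩ | h' | ⟨c, γ, hcγ, hc, hfree, hs, hs'⟩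
    · obtain ⟨n, I, φ, φ', hφ, hφ', hr, hr', -, -, hatt⟩ :=
        H.matching.exists_nbhd H.admissible H.limit H.fst H.snd hmμ hm
      have hmx : m < x := by
        by_contra! hle
        obtain rfl := H.fst.nbhd_critPlus H.admissible hm hx'
          (mem_critPlus_of_crit (mem_crit_of_mem hx)) hlt.le hle
        exact mem_AC_not_mem hm hx
      rw [← hr] at hx'
      obtain ⟨z, rfl⟩ := hx'
      rw [H.hullRel_unique hxy' (H.hullRel_of_AC hmμ hm hφ hφ' hr hr' z)]
      exact hatt x hx y h hmx z
    · by_cases hx' : x' ∈ A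
      · exact H.matching.R_eq_of_mem H.fst.weak H.snd.weak h hx h' hx' hlt
      · exact (H.matching.R_eq_aux H.admissible H.limit H.fst H.snd x' y' h' hx').2 x hx y h hlt
    · exact H.R_eq_of_free_start h hx hcγ hc hfree hs hs' hlt hR
  · obtain ⟨m, hm, hxm, hx'm⟩ :=
      H.fst.exists_nbhd_of_ne_zero H.admissible (H.hullRel_mem_hull hxy) hx hlt hR
    obtain ⟨μ, h⟩ := H.matching.exists_right m (mem_AC_crit hm)
    obtain ⟨n, I, φ, φ', hφ, hφ', hr, hr', he, he', -⟩ :=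
      H.matching.exists_nbhd H.admissible H.limit H.fst H.snd h hm
    rw [← hr] at hxm hx'm
    obtain ⟨z, rfl⟩ := hxm
    obtain ⟨z', rfl⟩ := hx'm
    rw [H.hullRel_unique hxy (H.hullRel_of_AC h hm hφ hφ' hr hr' z),
      H.hullRel_unique hxy' (H.hullRel_of_AC h hm hφ hφ' hr hr' z'), he.2.2, he'.2.2]

theorem hullRel_R_of_lt (H : Matched ch A B T) {x y x' y' : ℕ} (hxy : HullRel F K A B T x y)
    (hxy' : HullRel F K A B T x' y') (hlt : x' < x) : K.R x x' = K.R y y' := by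
  by_cases hR : K.R x x' = 0
  · by_cases hR' : K.R y y' = 0
    · rw [hR, hR']
    · exact (H.symm.hullRel_R_of_ne_zero (H.hullRel_symm hxy) (H.hullRel_symm hxy')
        (H.hullRel_lt hxy' hxy hlt) hR').symm
  · exact H.hullRel_R_of_ne_zero hxy hxy' hlt hR

theorem hullRel_R (H : Matched ch A B T) {x y x' y' : ℕ} (hxy : HullRel F K A B T x y)
    (hxy' : HullRel F K A B T x' y') : K.R x x' = K.R y y' := by
  rcases lt_trichotomy x x' with hlt | rfl | hlt
  · rw [K.R_flip x', K.R_flip y', H.hullRel_R_of_lt hxy' hxy hlt]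
  · rw [H.hullRel_unique hxy hxy', K.R_self, K.R_self]
  · exact H.hullRel_R_of_lt hxy hxy' hlt

/-! ### Matching the closures -/

/-- The vertices of the hull of `A` which correspond to vertices in the closure of `B` form a closed
set. -/
theorem closed_preimage (H : Matched ch A B T) :
    Closed F K {x | ∃ y ∈ cl F K B, HullRel F K A B T x y} := by
  have hsub : {x | ∃ y ∈ cl F K B, HullRel F K A B T x y} ⊆ hull F K A := by
    rintro x ⟨y, -, hxy⟩
    exact H.hullRel_mem_hull hxy
  have hhull := closed_iff.1 (H.fst.closed_hull H.admissible H.limit)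
  have hhull' := closed_iff.1 (H.snd.closed_hull H.admissible H.limit)
  have hclB := H.snd.cl_subset_hull H.admissible H.limit
  rw [closed_iff]
  constructor
  · intro m hm
    -- The closed hull contains `m`, so `m` has a partner `μ`. It remains to see that `μ` is a
    -- splitting level of the closure of `B`.
    have hmh := hhull.1 (Sp_mono hsub hm)
    obtain ⟨μ, -, h⟩ := H.exists_hullRel hmh
    obtain ⟨a, ⟨α, hα, haα⟩, b, ⟨β, hβ, hbβ⟩, hma, hmb, hcut, hne⟩ := mem_sp.1 hm
    have hμα := H.hullRel_lt h haα hma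
    have hμβ := H.hullRel_lt h hbβ hmb
    have hag := (cut_eq_cut K hma.le hmb.le).1 hcut
    rw [H.hullRel_R haα h, H.hullRel_R hbβ h] at hne
    have hex : ∃ l, K.R α l ≠ K.R β l := ⟨μ, hne⟩
    have hlμ : Nat.find hex ≤ μ := Nat.find_min' hex hne
    have hU : K.U α = K.U β := by
      rw [← H.hullRel_U haα, ← H.hullRel_U hbβ, hag.1]
    have hsp : ∀ {S : Set ℕ}, α ∈ S → β ∈ S → Nat.find hex ∈ Sp K S := fun h1 h2 =>
      mem_sp.2 ⟨α, h1, β, h2, by omega, by omega,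
        (cut_eq_cut K (by omega) (by omega)).2 ⟨hU, fun r hr => by
          simpa using Nat.find_min hex hr⟩, Nat.find_spec hex⟩
    rcases hlμ.eq_or_lt with hl | hl
    · refine ⟨μ, (closed_iff.1 (closed_cl F K B)).1 ?_, h⟩
      rw [← hl]
      exact hsp hα hβ
    -- An earlier disagreement of `α` and `β` would be in the hull of `B` and pull back to a
    -- disagreement of `a` and `b` below `m`.
    · exfalso
      obtain ⟨l, -, hl'⟩ := H.symm.exists_hullRel (hhull'.1 (hsp (hclB hα) (hclB hβ)))
      have hl'' := H.symm.hullRel_symm hl'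
      have hlm : l < m := (H.hullRel_lt_iff hl'' h).2 hl
      refine Nat.find_spec hex ?_
      rw [← H.hullRel_R haα hl'', ← H.hullRel_R hbβ hl'']
      exact hag.2 l hlm
  · intro m hm
    by_cases hmh : m ∈ hull F K A
    -- All other members of the hull have partners in the closure of `B` by `exists_hullRel_cl`. A
    -- free start is stable for `A` and unrelated to larger hull vertices outside `A`.
    · have hfs : m ∈ FreeStart F K A := by
        by_contra hfs
        refine hm (H.exists_hullRel_cl ?_)
        rcases hmh with h | h | h
        · exact .inl h
        · exact absurd h hfs
        · exact .inr h
      refine (H.fst.free_start_stable H.admissible H.limit hfs).of_nonzero H.admissible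
        fun x hx hmx hR => ?_
      by_contra hxA
      exact hR (H.fst.hull_zero_of_critPlus H.admissible (hsub hx) hxA hmx
        (freeStart_critPlus hfs))
    · exact (hhull.2 m hmh).mono hsub

/-- Minimality of the closure, applied to the closed preimage. -/
theorem exists_cl (H : Matched ch A B T) {x : ℕ} (hx : x ∈ cl F K A) :
    ∃ y ∈ cl F K B, HullRel F K A B T x y :=
  cl_subset (fun _ ha => H.exists_hullRel_cl (.inl (mem_crit_of_mem ha))) H.closed_preimage hx

end Matched

end matching

/-! ### Enumerations -/

theorem forall_finite_lt_iff {X : Set ℕ} {n : ℕ} :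
    (∀ hf : X.Finite, n < hf.toFinset.card) ↔ (n : ℕ∞) < X.encard := by
  by_cases hf : X.Finite
  · simp only [hf, forall_true_left, hf.encard_eq_coe_toFinset_card, Nat.cast_lt]
  · simp [hf, Set.Infinite.encard_eq hf]

theorem nth_mem_set {X : Set ℕ} {n : ℕ} (h : (n : ℕ∞) < X.encard) : Nat.nth (· ∈ X) n ∈ X :=
  Nat.nth_mem n (forall_finite_lt_iff.2 h)

theorem nth_lt_nth_iff {X : Set ℕ} {m n : ℕ} (hm : (m : ℕ∞) < X.encard)
    (hn : (n : ℕ∞) < X.encard) : Nat.nth (· ∈ X) m < Nat.nth (· ∈ X) n ↔ m < n := by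
  have key : ∀ {m n : ℕ}, (n : ℕ∞) < X.encard → m < n → Nat.nth (· ∈ X) m < Nat.nth (· ∈ X) n :=
    fun hn h => Nat.nth_lt_nth' h (forall_finite_lt_iff.2 hn)
  refine ⟨fun h => ?_, key hn⟩
  rcases lt_trichotomy m n with h' | rfl | h'
  · exact h'
  · exact absurd h (lt_irrefl _)
  · exact absurd h (key hm h').not_gt

theorem exists_nth_eq {X : Set ℕ} {x : ℕ} (hx : x ∈ X) :
    ∃ n : ℕ, (n : ℕ∞) < X.encard ∧ Nat.nth (· ∈ X) n = x := by
  obtain ⟨n, hn, h⟩ := Nat.exists_lt_card_nth_eq (p := (· ∈ X)) hx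
  exact ⟨n, forall_finite_lt_iff.1 hn, h⟩

/-- An increasing bijection between sets of natural numbers commutes with their enumerations. -/
theorem enum_of_bijection {X Y : Set ℕ} {Θ : ℕ → ℕ → Prop} (hl : ∀ x ∈ X, ∃ y ∈ Y, Θ x y)
    (hr : ∀ y ∈ Y, ∃ x ∈ X, Θ x y)
    (hlt : ∀ {x y x' y'}, Θ x y → Θ x' y' → (x < x' ↔ y < y')) :
    X.encard = Y.encard ∧ ∀ n : ℕ, (n : ℕ∞) < X.encard →
      Θ (Nat.nth (· ∈ X) n) (Nat.nth (· ∈ Y) n) := by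
  have hru : ∀ {x y y'}, Θ x y → Θ x y' → y = y' := fun h h' =>
    le_antisymm (not_lt.1 fun hc => absurd ((hlt h' h).2 hc) (lt_irrefl _))
      (not_lt.1 fun hc => absurd ((hlt h h').2 hc) (lt_irrefl _))
  have hlu : ∀ {x x' y}, Θ x y → Θ x' y → x = x' := fun h h' =>
    le_antisymm (not_lt.1 fun hc => absurd ((hlt h' h).1 hc) (lt_irrefl _))
      (not_lt.1 fun hc => absurd ((hlt h h').1 hc) (lt_irrefl _))
  have hcard : X.encard = Y.encard := by
    choose f hf hΘ using fun x : X => hl x x.2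
    refine Set.encard_congr (Equiv.ofBijective (fun x : X => (⟨f x, hf x⟩ : Y)) ⟨?_, ?_⟩)
    · intro x x' h
      have h' : f x = f x' := congrArg Subtype.val h
      exact Subtype.ext (hlu (hΘ x) (h' ▸ hΘ x'))
    · rintro ⟨y, hy⟩
      obtain ⟨x, hx, hxy⟩ := hr y hy
      exact ⟨⟨x, hx⟩, Subtype.ext (hru (hΘ ⟨x, hx⟩) hxy)⟩
  refine ⟨hcard, fun n => ?_⟩
  induction n using Nat.strong_induction_on with
  | _ n ih =>
  intro hn
  have hn' := hcard ▸ hn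
  obtain ⟨y, hy, h⟩ := hl _ (nth_mem_set hn)
  obtain ⟨k, hk, rfl⟩ := exists_nth_eq hy
  -- If the partner of the `n`-th element came too early, it would already be taken by an earlier
  -- element. If it came too late, the partner of the `n`-th element of `Y` would have index below
  -- `n`, also taken.
  rcases lt_trichotomy k n with hkn | rfl | hkn
  · have h1 := ih k hkn (hcard ▸ hk)
    have h2 := hlu h1 h
    exact absurd ((nth_lt_nth_iff (hcard ▸ hk) hn).2 hkn) (h2 ▸ lt_irrefl _)
  · exact h
  · obtain ⟨x, hx, h1⟩ := hr _ (nth_mem_set hn')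
    obtain ⟨j, hj, rfl⟩ := exists_nth_eq hx
    have h2 := (hlt h1 h).2 ((nth_lt_nth_iff hn' hk).2 hkn)
    have hjn := (nth_lt_nth_iff hj hn).1 h2
    have h3 := hru (ih j hjn hj) h1
    exact absurd ((nth_lt_nth_iff (hcard ▸ hj) hn').2 hjn) (h3 ▸ lt_irrefl _)

theorem envelope_eq_of_bijection {F : Set (FinStr L)} {K : Str L ℕ} {A B : Set ℕ}
    {Θ : ℕ → ℕ → Prop} (hl : ∀ x ∈ cl F K A, ∃ y ∈ cl F K B, Θ x y)
    (hr : ∀ y ∈ cl F K B, ∃ x ∈ cl F K A, Θ x y)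
    (hlt : ∀ {x y x' y'}, Θ x y → Θ x' y' → (x < x' ↔ y < y'))
    (hU : ∀ {x y}, Θ x y → K.U x = K.U y)
    (hR : ∀ {x y x' y'}, Θ x y → Θ x' y' → K.R x x' = K.R y y') :
    envelope F K A = envelope F K B := by
  obtain ⟨hcard, hΘ⟩ := enum_of_bijection hl hr hlt
  unfold envelope
  unfold enum
  revert hΘ
  generalize cl F K A = X at *
  generalize cl F K B = Y at *
  intro hΘ
  -- The underlying types depend on the cardinalities, so these are identified before the structures
  -- are compared pointwise.
  have key : ∀ N : ℕ∞, ∀ h : N = Y.encard,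
      (⟨N, K.pullback fun n : Below N => Nat.nth (· ∈ Y) n.1⟩ : EnumStr L) =
        ⟨Y.encard, K.pullback fun n : Below Y.encard => Nat.nth (· ∈ Y) n.1⟩ := by
    rintro N rfl
    rfl
  rw [← key _ hcard]
  congr 1
  ext m n
  · exact congrArg _ (hU (hΘ m.1 m.2))
  · exact congrArg _ (hR (hΘ m.1 m.2) (hΘ n.1 n.2))

theorem sigma_below_eq {α : Type} {N N' : ℕ∞} {f : Below N → α} {g : Below N' → α}
    (h : (⟨N, f⟩ : Σ N : ℕ∞, (Below N → α)) = ⟨N', g⟩) :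
    N = N' ∧ ∀ (n : ℕ) (hn : (n : ℕ∞) < N) (hn' : (n : ℕ∞) < N'), f ⟨n, hn⟩ = g ⟨n, hn'⟩ := by
  cases h
  exact ⟨rfl, fun _ _ _ => rfl⟩

theorem matching_of_diary_eq {F : Set (FinStr L)} {K : Str L ℕ} {A B : Set ℕ}
    (h : diary F K A = diary F K B) : ∃ T, Matching F K A B T := by
  obtain ⟨hcard, hentry⟩ := sigma_below_eq h
  refine ⟨fun x y => ∃ n : ℕ, (n : ℕ∞) < (Crit F K A).encard ∧ x = Nat.nth (· ∈ Crit F K A) n ∧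
    y = Nat.nth (· ∈ Crit F K B) n, ?_, ?_, ?_, ?_, ?_, ?_⟩
  · rintro _ _ ⟨n, hn, rfl, rfl⟩
    exact nth_mem_set hn
  · rintro _ _ ⟨n, hn, rfl, rfl⟩
    exact nth_mem_set (hcard ▸ hn)
  · intro x hx
    obtain ⟨n, hn, rfl⟩ := exists_nth_eq hx
    exact ⟨_, n, hn, rfl, rfl⟩
  · intro y hy
    obtain ⟨n, hn, rfl⟩ := exists_nth_eq hy
    exact ⟨_, n, hcard ▸ hn, rfl, rfl⟩
  · rintro _ _ _ _ ⟨n, hn, rfl, rfl⟩ ⟨n', hn', rfl, rfl⟩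
    rw [nth_lt_nth_iff hn hn', nth_lt_nth_iff (hcard ▸ hn) (hcard ▸ hn')]
  · rintro _ _ ⟨n, hn, rfl, rfl⟩
    exact hentry n hn (hcard ▸ hn)

/-- Diagonal substructures with the same diary have the same envelope. -/
theorem Diagonal.envelope_eq {F : Set (FinStr L)} {K : Str L ℕ} {ch : Choices F K} {A B : Set ℕ}
    (hF : Admissible F) (hK : IsFraisseLimit F K) (hA : Diagonal ch A) (hB : Diagonal ch B)
    (h : diary F K A = diary F K B) : envelope F K A = envelope F K B := by
  obtain ⟨T, hM⟩ := matching_of_diary_eq h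
  have H : Matched ch A B T := ⟨hF, hK, hA, hB, hM⟩
  refine envelope_eq_of_bijection (fun x hx => H.exists_cl hx) (fun y hy => ?_)
    H.hullRel_lt_iff H.hullRel_U H.hullRel_R
  obtain ⟨x, hx, hxy⟩ := H.symm.exists_cl hy
  exact ⟨x, hx, H.symm.hullRel_symm hxy⟩

end DiaryEnvelope

end

theorem mainTheorem7 (L : DiaryEnvelope.Lang) (F : Set (DiaryEnvelope.FinStr L))
    (hF : DiaryEnvelope.Admissible F) (hnd : ∀ i, DiaryEnvelope.NonDegenerate F i)
    (K : DiaryEnvelope.Str L ℕ) (hK : DiaryEnvelope.IsFraisseLimit F K)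
    (hKl : DiaryEnvelope.LeftDense F K) (ch : DiaryEnvelope.Choices F K) :
    (∀ A B : Set ℕ, DiaryEnvelope.Diagonal ch A → DiaryEnvelope.Diagonal ch B →
      DiaryEnvelope.diary F K A = DiaryEnvelope.diary F K B →
      DiaryEnvelope.envelope F K A = DiaryEnvelope.envelope F K B) ∧
    (∀ A : Set ℕ, DiaryEnvelope.Diagonal ch A →
      DiaryEnvelope.IsInteriorOf F K (DiaryEnvelope.cl F K A) A) :=
  ⟨fun _ _ hA hB h => hA.envelope_eq hF hK hB h, fun _ hA => hA.isInteriorOf hF hK⟩
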